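/- Let $\mathbb K$ be a field of characteristic zero. All differential graded Lie algebras (DGLAs) are $\mathbb Z$-graded over $\mathbb K$, and a morphism of DGLAs is a quasi-isomorphism if it induces isomorphisms in cohomology. For $n\ge 0$ let $\Omega_n=\mathbb K[t_0,\dots,t_n,dt_0,\dots,dt_n]/(\sum t_i-1,\sum dt_i)$ be the differential graded commutative algebra of polynomial differential forms on the standard $n$-simplex, with face maps $\delta^{k,n}\colon\Omega_n\to\Omega_{n-1}$. For a semicosimplicial DGLA $\mathfrak g^\Delta$ with DGLAs $\mathfrak g_n$ and coface maps $\partial_{k,n}\colon \mathfrak g_{n-1}\to\mathfrak g_n$, the Thom–Whitney DGLA $\operatorname{Tot}_{TW}(\mathfrak g^\Delta)$ is the total complex $\bigoplus_{i+j=m}C^{i,j}_{TW}$ of the bicomplex \[ C^{i,j}_{TW}(\mathfrak g^\Delta)=\Big\{(x_n)_{n\ge 0}\in\prod_{n}\Omega_n^i\otimes\mathfrak g_n^j \;\Big|\; \delta^{k,n}x_n=\partial_{k,n}x_{n-1}\ \text{ for all } n\ge1,\ 0\le k\le n\Big\}, \] with differential $d(\omega\otimes x)=d\omega\otimes x+(-1)^{|\omega|}\omega\otimes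 dx$ and bracket $[\omega\otimes x,\eta\otimes y]=(-1)^{|x||\eta|}\,\omega\wedge\eta\otimes[x,y]$ in each cosimplicial degree. For a sheaf $\mathcal L$ of DGLAs on a topological space $X$ and an open cover $\mathcal U=\{U_i\}_{i\in I}$ with $I$ totally ordered, $\mathcal L(\mathcal U)$ denotes the Čech semicosimplicial DGLA with $\mathcal L(\mathcal U)_n=\prod_{i_0<\dots<i_n}\mathcal L(U_{i_0}\cap\dots\cap U_{i_n})$, the coface maps being given by restriction. The cover $\mathcal U$ is acyclic with respect to $\mathcal L$ if $H^p(U_{i_0}\cap\dots\cap U_{i_n};\mathcal L^k)=0$ for all $p>0$, all $k\in\mathbb Z$, all $n\ge 0$ and all $i_0<\dots<i_n$. **Theorem.** Let $X$ be a paracompact Hausdorff topological space, and let $\mathcal L$ and $\mathcal A$ be sheaves of DGLAs on $X$ that are bounded below (that is, $\mathcal L^k=\mathcal A^k=0$ for all sufficiently negative $k$). Let $\varphi\colon\mathcal L\to\mathcal A$ be an acyclic resolution: a morphism of sheaves of DGLAs that induces isomorphisms $\mathcal H^*(\mathcal L)\to\mathcal H^*(\mathcal A)$ of cohomology sheaves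 and such that $H^p(X;\mathcal A^k)=0$ for all $p>0$ and all $k$. Let $A=\mathcal A(X)$ be the DGLA of global sections, and let $\mathcal U$ be an open cover of $X$ that is acyclic with respect to both $\mathcal L$ and $\mathcal A$. Then $\operatorname{Tot}_{TW}(\mathcal L(\mathcal U))$ is naturally quasi-isomorphic to $A$ as a DGLA. Precisely, in the diagram of DGLAs \[ \operatorname{Tot}_{TW}(\mathcal L(\mathcal U))\xrightarrow{\ \varphi\ }\operatorname{Tot}_{TW}(\mathcal A(\mathcal U))\longleftarrow A , \] where the left arrow is induced by $\varphi$ and the right arrow sends $a$ to $\big(1\otimes (a|_{U_{i_0}\cap\dots\cap U_{i_n}})_{i_0<\dots<i_n}\big)_n$, both arrows are quasi-isomorphisms of DGLAs, and the diagram is natural: for every morphism $\varphi'\colon\mathcal L'\to\mathcal A'$ of sheaves of DGLAs on $X$ and all morphisms $\alpha\colon\mathcal L\to\mathcal L'$, $\beta\colon\mathcal A\to\mathcal A'$ with $\beta\varphi=\varphi'\alpha$, the maps induced by $\alpha$ and $\beta$ form commutative squares between the diagrams of $\varphi$ and of $\varphi'$. -/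

import Mathlib

open CategoryTheory TopologicalSpace Opposite
open scoped TensorProduct DirectSum

universe u

noncomputable section

/-! ### Polynomial differential forms on the standard simplex -/

/-- Defining relations, between the generators `t i = inl i` and `dt i = inr i`, of the
algebra of polynomial differential forms on the standard `n`-simplex: graded commutativity
(the `t i` of degree 0, the `dt i` of degree 1), `∑ t i = 1` and `∑ dt i = 0`. -/
inductive PolyFormRel (K : Type u) [Field K] (n : ℕ) :
    FreeAlgebra K (Fin (n + 1) ⊕ Fin (n + 1)) →
      FreeAlgebra K (Fin (n + 1) ⊕ Fin (n + 1)) → Prop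
  | t_t (i j : Fin (n + 1)) : PolyFormRel K n
      (FreeAlgebra.ι K (.inl i) * FreeAlgebra.ι K (.inl j))
      (FreeAlgebra.ι K (.inl j) * FreeAlgebra.ι K (.inl i))
  | t_dt (i j : Fin (n + 1)) : PolyFormRel K n
      (FreeAlgebra.ι K (.inl i) * FreeAlgebra.ι K (.inr j))
      (FreeAlgebra.ι K (.inr j) * FreeAlgebra.ι K (.inl i))
  | dt_dt (i j : Fin (n + 1)) : PolyFormRel K n
      (FreeAlgebra.ι K (.inr i) * FreeAlgebra.ι K (.inr j))
      (-(FreeAlgebra.ι K (.inr j) * FreeAlgebra.ι K (.inr i)))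
  | dt_sq (i : Fin (n + 1)) : PolyFormRel K n
      (FreeAlgebra.ι K (.inr i) * FreeAlgebra.ι K (.inr i)) 0
  | sum_t : PolyFormRel K n (∑ i, FreeAlgebra.ι K (.inl i)) 1
  | sum_dt : PolyFormRel K n (∑ i, FreeAlgebra.ι K (.inr i)) 0

/-- `Ω_n = K[t_0,…,t_n,dt_0,…,dt_n]/(∑ t_i - 1, ∑ dt_i)`. -/
def PolyForm (K : Type u) [Field K] (n : ℕ) : Type u := RingQuot (PolyFormRel K n)

namespace PolyForm

variable {K : Type u} [Field K] {n : ℕ}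

instance : Ring (PolyForm K n) := inferInstanceAs (Ring (RingQuot _))

instance : Algebra K (PolyForm K n) := inferInstanceAs (Algebra K (RingQuot _))

/-- The quotient map from the free algebra. -/
def mk : FreeAlgebra K (Fin (n + 1) ⊕ Fin (n + 1)) →ₐ[K] PolyForm K n :=
  RingQuot.mkAlgHom K (PolyFormRel K n)

theorem mk_rel {x y : FreeAlgebra K (Fin (n + 1) ⊕ Fin (n + 1))} (h : PolyFormRel K n x y) :
    (mk x : PolyForm K n) = mk y :=
  RingQuot.mkAlgHom_rel K h

/-- The barycentric coordinate `t_i`. -/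
def t (i : Fin (n + 1)) : PolyForm K n := mk (FreeAlgebra.ι K (.inl i))

/-- The 1-form `dt_i`. -/
def dt (i : Fin (n + 1)) : PolyForm K n := mk (FreeAlgebra.ι K (.inr i))

theorem t_mul_t (i j : Fin (n + 1)) : (t i * t j : PolyForm K n) = t j * t i := by
  simpa [t] using mk_rel (PolyFormRel.t_t (K := K) i j)

theorem t_mul_dt (i j : Fin (n + 1)) : (t i * dt j : PolyForm K n) = dt j * t i := by
  simpa [t, dt] using mk_rel (PolyFormRel.t_dt (K := K) i j)

theorem dt_mul_dt (i j : Fin (n + 1)) : (dt i * dt j : PolyForm K n) = -(dt j * dt i) := by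
  simpa [dt] using mk_rel (PolyFormRel.dt_dt (K := K) i j)

theorem dt_mul_self (i : Fin (n + 1)) : (dt i * dt i : PolyForm K n) = 0 := by
  simpa [dt] using mk_rel (PolyFormRel.dt_sq (K := K) i)

theorem sum_t : (∑ i, t i : PolyForm K n) = 1 := by
  simpa [t] using mk_rel (PolyFormRel.sum_t (K := K) (n := n))

theorem sum_dt : (∑ i, dt i : PolyForm K n) = 0 := by
  simpa [dt] using mk_rel (PolyFormRel.sum_dt (K := K) (n := n))

/-- The universal property of `Ω_n` as an associative algebra. -/
def lift {B : Type*} [Ring B] [Algebra K B] (a b : Fin (n + 1) → B)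
    (haa : ∀ i j, a i * a j = a j * a i) (hab : ∀ i j, a i * b j = b j * a i)
    (hbb : ∀ i j, b i * b j = -(b j * b i)) (hb : ∀ i, b i * b i = 0)
    (ha1 : ∑ i, a i = 1) (hb0 : ∑ i, b i = 0) : PolyForm K n →ₐ[K] B :=
  RingQuot.liftAlgHom K ⟨FreeAlgebra.lift K (Sum.elim a b), by
    intro x y h
    cases h with
    | t_t i j => simpa using haa i j
    | t_dt i j => simpa using hab i j
    | dt_dt i j => simpa using hbb i j
    | dt_sq i => simpa using hb i
    | sum_t => simpa using ha1
    | sum_dt => simpa using hb0⟩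

section lift

variable {B : Type*} [Ring B] [Algebra K B] (a b : Fin (n + 1) → B)
    (haa : ∀ i j, a i * a j = a j * a i) (hab : ∀ i j, a i * b j = b j * a i)
    (hbb : ∀ i j, b i * b j = -(b j * b i)) (hb : ∀ i, b i * b i = 0)
    (ha1 : ∑ i, a i = 1) (hb0 : ∑ i, b i = 0)

theorem lift_t (i : Fin (n + 1)) : lift (K := K) a b haa hab hbb hb ha1 hb0 (t i) = a i := by
  simp only [lift, t, mk]
  erw [RingQuot.liftAlgHom_mkAlgHom_apply]
  simp

theorem lift_dt (i : Fin (n + 1)) : lift (K := K) a b haa hab hbb hb ha1 hb0 (dt i) = b i := by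
  simp only [lift, dt, mk]
  erw [RingQuot.liftAlgHom_mkAlgHom_apply]
  simp

end lift

theorem induction {P : PolyForm K n → Prop} (hK : ∀ r, P (algebraMap K _ r))
    (ht : ∀ i, P (t i)) (hdt : ∀ i, P (dt i)) (hmul : ∀ x y, P x → P y → P (x * y))
    (hadd : ∀ x y, P x → P y → P (x + y)) (x : PolyForm K n) : P x := by
  obtain ⟨y, rfl⟩ : ∃ y, mk y = x := RingQuot.mkAlgHom_surjective K _ x
  induction y using FreeAlgebra.induction with
  | grade0 r => simpa using hK r
  | grade1 i =>
    rcases i with i | i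
    · exact ht i
    · exact hdt i
  | mul a b ha hb => simpa using hmul _ _ ha hb
  | add a b ha hb => simpa using hadd _ _ ha hb

/-- The algebra map `x ↦ !![σ x, d x; 0, x]`, where `σ` is the sign involution and `d` the
exterior differential. That it is multiplicative is the graded Leibniz rule for `d`. -/
def matrixHom : PolyForm K n →ₐ[K] Matrix (Fin 2) (Fin 2) (PolyForm K n) :=
  lift (fun i => !![t i, dt i; 0, t i]) (fun i => !![-dt i, 0; 0, dt i])
    (fun i j => by
      simp [t_mul_t i j, t_mul_dt i j, t_mul_dt j i, add_comm])
    (fun i j => by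
      simp [t_mul_dt i j, dt_mul_dt i j])
    (fun i j => by
      simp [← dt_mul_dt i j])
    (fun i => by
      ext a b; fin_cases a <;> fin_cases b <;> simp [dt_mul_self i])
    (by
      ext a b; fin_cases a <;> fin_cases b <;> simp [Matrix.sum_apply, sum_t, sum_dt])
    (by
      ext a b; fin_cases a <;> fin_cases b <;> simp [Matrix.sum_apply, sum_dt])

/-- The exterior differential of `Ω_n`. -/
def d : PolyForm K n →ₗ[K] PolyForm K n where
  toFun x := matrixHom x 0 1
  map_add' x y := by simp
  map_smul' r x := by simp

/-- The sign involution of `Ω_n`, equal to `(-1)^i` on `i`-forms. -/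
def sgn : PolyForm K n →ₗ[K] PolyForm K n where
  toFun x := matrixHom x 0 0
  map_add' x y := by simp
  map_smul' r x := by simp

theorem matrixHom_apply (x : PolyForm K n) : matrixHom x = !![sgn x, d x; 0, x] := by
  suffices h : matrixHom x 1 0 = 0 ∧ matrixHom x 1 1 = x by
    ext a b; fin_cases a <;> fin_cases b <;> simp [h, sgn, d]
  induction x using induction with
  | hK r => simp [Matrix.algebraMap_matrix_apply]
  | ht i => simp [matrixHom, lift_t]
  | hdt i => simp [matrixHom, lift_dt]
  | hmul x y hx hy => simp [Matrix.mul_apply, Fin.sum_univ_two, hx, hy]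
  | hadd x y hx hy => simp [hx, hy]

@[simp] theorem d_t (i : Fin (n + 1)) : d (t i : PolyForm K n) = dt i := by
  simp [d, matrixHom, lift_t]

@[simp] theorem d_dt (i : Fin (n + 1)) : d (dt i : PolyForm K n) = 0 := by
  simp [d, matrixHom, lift_dt]

@[simp] theorem d_algebraMap (r : K) : d (algebraMap K (PolyForm K n) r) = 0 := by
  simp [d, Matrix.algebraMap_matrix_apply]

@[simp] theorem sgn_t (i : Fin (n + 1)) : sgn (t i : PolyForm K n) = t i := by
  simp [sgn, matrixHom, lift_t]

@[simp] theorem sgn_dt (i : Fin (n + 1)) : sgn (dt i : PolyForm K n) = -dt i := by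
  simp [sgn, matrixHom, lift_dt]

@[simp] theorem sgn_algebraMap (r : K) :
    sgn (algebraMap K (PolyForm K n) r) = algebraMap K _ r := by
  simp [sgn, Matrix.algebraMap_matrix_apply]

theorem sgn_mul (x y : PolyForm K n) : sgn (x * y) = sgn x * sgn y := by
  have h := congrFun (congrFun (map_mul matrixHom x y) 0) 0
  simpa [matrixHom_apply, Matrix.mul_fin_two] using h

theorem d_mul (x y : PolyForm K n) : d (x * y) = d x * y + sgn x * d y := by
  have h := congrFun (congrFun (map_mul matrixHom x y) 0) 1
  simpa [matrixHom_apply, Matrix.mul_fin_two, add_comm] using h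

theorem d_one : d (1 : PolyForm K n) = 0 := by
  simpa using d_algebraMap (n := n) (1 : K)

theorem sgn_d (x : PolyForm K n) : sgn (d x) = -d (sgn x) := by
  induction x using induction with
  | hK r => simp
  | ht i => simp
  | hdt i => simp
  | hmul x y hx hy => simp only [d_mul, sgn_mul, map_add, hx, hy]; noncomm_ring
  | hadd x y hx hy => simp only [map_add, hx, hy]; abel

theorem d_d (x : PolyForm K n) : d (d x) = 0 := by
  induction x using induction with
  | hK r => simp
  | ht i => simp
  | hdt i => simp
  | hmul x y hx hy => simp [d_mul, hx, hy, sgn_d]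
  | hadd x y hx hy => simp only [map_add, hx, hy, add_zero]

variable (K n) in
/-- The functions, i.e. the polynomials in the `t_i`. -/
def functions : Submodule K (PolyForm K n) :=
  Subalgebra.toSubmodule (Algebra.adjoin K (Set.range t))

variable (K n) in
/-- The degree `i` component `Ω_n^i` of `Ω_n`: the span of the products
`f * dt_{a_1} * ⋯ * dt_{a_i}` with `f` a polynomial in the `t_j`. -/
def forms (i : ℕ) : Submodule K (PolyForm K n) :=
  functions K n * (Submodule.span K (Set.range dt)) ^ i

theorem commute_of_mem_functions {f : PolyForm K n} (hf : f ∈ functions K n) (x : PolyForm K n) :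
    Commute f x := by
  induction hf using Algebra.adjoin_induction with
  | mem f hf =>
    obtain ⟨i, rfl⟩ := hf
    induction x using induction with
    | hK r => exact (Algebra.commutes r _).symm
    | ht j => exact t_mul_t i j
    | hdt j => exact t_mul_dt i j
    | hmul x y hx hy => exact hx.mul_right hy
    | hadd x y hx hy => exact hx.add_right hy
  | algebraMap r => exact Algebra.commutes r x
  | add f g _ _ hf hg => exact hf.add_left hg
  | mul f g _ _ hf hg => exact hf.mul_left hg

theorem functions_mul_self : functions K n * functions K n = functions K n :=
  Subalgebra.isIdempotentElem_toSubmodule _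

theorem mul_mem_forms {i j k : ℕ} (h : i + j = k) {x y : PolyForm K n} (hx : x ∈ forms K n i)
    (hy : y ∈ forms K n j) : x * y ∈ forms K n k := by
  subst h
  have h1 : Submodule.span K (Set.range (dt (K := K) (n := n))) ^ i * functions K n =
      functions K n * Submodule.span K (Set.range dt) ^ i :=
    Submodule.mul_comm_of_commute fun m _ f hf => (commute_of_mem_functions hf m).symm
  have h2 : forms K n i * forms K n j = forms K n (i + j) := by
    unfold forms
    rw [mul_assoc, ← mul_assoc (Submodule.span K (Set.range dt) ^ i), h1, mul_assoc, ← pow_add,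
      ← mul_assoc, functions_mul_self]
  exact h2 ▸ Submodule.mul_mem_mul hx hy

theorem one_mem_forms : (1 : PolyForm K n) ∈ forms K n 0 := by
  simp [forms, functions]

theorem sgn_of_mem_functions {f : PolyForm K n} (hf : f ∈ functions K n) : sgn f = f := by
  induction hf using Algebra.adjoin_induction with
  | mem f hf => obtain ⟨i, rfl⟩ := hf; simp
  | algebraMap r => simp
  | add f g _ _ hf hg => simp [hf, hg]
  | mul f g _ _ hf hg => simp [sgn_mul, hf, hg]

theorem span_dt_pow (i : ℕ) {x : PolyForm K n}
    (hx : x ∈ (Submodule.span K (Set.range (dt (K := K) (n := n)))) ^ i) :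
    sgn x = (-1 : K) ^ i • x ∧ d x = 0 ∧ ∀ y, x * y = sgn^[i] y * x := by
  induction i generalizing x with
  | zero =>
    obtain ⟨r, rfl⟩ := Submodule.mem_one.mp (by simpa using hx)
    simpa using fun y => Algebra.commutes r y
  | succ i ih =>
    rw [pow_succ] at hx
    induction hx using Submodule.mul_induction_on' with
    | mem_mul_mem a ha b hb =>
      obtain ⟨h1, h2, h3⟩ := ih ha
      have hb' : sgn b = -b ∧ d b = 0 ∧ ∀ y, b * y = sgn y * b := by
        induction hb using Submodule.span_induction with
        | mem x h =>
          obtain ⟨k, rfl⟩ := h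
          refine ⟨by simp, by simp, fun y => ?_⟩
          induction y using induction with
          | hK r => simpa using (Algebra.commutes r _).symm
          | ht i => simpa using (t_mul_dt i k).symm
          | hdt i => simpa using dt_mul_dt k i
          | hmul x y hx hy => rw [← mul_assoc, hx, mul_assoc, hy, sgn_mul, mul_assoc]
          | hadd x y hx hy => simp [mul_add, add_mul, hx, hy]
        | zero => simp
        | add x y _ _ hx hy =>
          refine ⟨by rw [map_add, hx.1, hy.1]; abel, by simp [hx.2.1, hy.2.1], fun z => ?_⟩
          rw [add_mul, mul_add, hx.2.2, hy.2.2]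
        | smul r x _ hx =>
          exact ⟨by simp [hx.1], by simp [hx.2.1], fun z => by simp [hx.2.2]⟩
      refine ⟨?_, ?_, fun y => ?_⟩
      · rw [sgn_mul, h1, hb'.1, pow_succ]; simp
      · rw [d_mul, h2, hb'.2.1]; simp
      · rw [mul_assoc, hb'.2.2, ← mul_assoc, h3, Function.iterate_succ_apply, mul_assoc]
    | add x _ y _ hx hy =>
      refine ⟨by rw [map_add, hx.1, hy.1, smul_add], by simp [hx.2.1, hy.2.1], fun z => ?_⟩
      rw [add_mul, mul_add, hx.2.2, hy.2.2]

theorem sgn_of_mem_forms {i : ℕ} {x : PolyForm K n} (hx : x ∈ forms K n i) :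
    sgn x = (-1 : K) ^ i • x := by
  induction hx using Submodule.mul_induction_on' with
  | mem_mul_mem f hf w hw =>
    rw [sgn_mul, sgn_of_mem_functions hf, (span_dt_pow i hw).1, mul_smul_comm]
  | add x _ y _ hx hy => rw [map_add, hx, hy, smul_add]

theorem d_mem_forms {i : ℕ} {x : PolyForm K n} (hx : x ∈ forms K n i) :
    d x ∈ forms K n (i + 1) := by
  induction hx using Submodule.mul_induction_on' with
  | mem_mul_mem f hf w hw =>
    have hw' : w ∈ forms K n i := by
      have : (1 : PolyForm K n) ∈ functions K n := one_mem (Algebra.adjoin K _)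
      simpa [forms] using Submodule.mul_mem_mul this hw
    rw [d_mul, (span_dt_pow i hw).2.1, mul_zero, add_zero]
    refine mul_mem_forms (add_comm 1 i) ?_ hw'
    clear hw hw'
    have h0 : ∀ f, f ∈ functions K n → f ∈ forms K n 0 := fun f hf => by
      rw [forms, pow_zero, mul_one]; exact hf
    induction hf using Algebra.adjoin_induction with
    | mem f hf =>
      obtain ⟨j, rfl⟩ := hf
      have : (1 : PolyForm K n) ∈ functions K n := one_mem (Algebra.adjoin K _)
      have h2 : (dt j : PolyForm K n) ∈ Submodule.span K (Set.range dt) ^ 1 := by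
        rw [pow_one]; exact Submodule.subset_span ⟨j, rfl⟩
      simpa [forms] using Submodule.mul_mem_mul this h2
    | algebraMap r => simp
    | add f g _ _ hf hg => simpa using add_mem hf hg
    | mul f g hf' hg' hf hg =>
      rw [d_mul, sgn_of_mem_functions hf']
      exact add_mem (mul_mem_forms (add_zero 1) hf (h0 g hg')) (mul_mem_forms (zero_add 1) (h0 f hf') hg)
  | add x _ y _ hx hy => simpa using add_mem hx hy

theorem mul_comm_forms {i j : ℕ} {x y : PolyForm K n} (hx : x ∈ forms K n i)
    (hy : y ∈ forms K n j) : x * y = (-1 : K) ^ (i * j) • (y * x) := by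
  have key : ∀ k : ℕ, sgn^[k] y = (-1 : K) ^ (k * j) • y := by
    intro k
    induction k with
    | zero => simp
    | succ k ih =>
      rw [Function.iterate_succ_apply', ih, map_smul, sgn_of_mem_forms hy, smul_smul, ← pow_add,
        add_mul, one_mul]
  induction hx using Submodule.mul_induction_on' with
  | mem_mul_mem f hf w hw =>
    rw [mul_assoc, (span_dt_pow i hw).2.2, key, smul_mul_assoc, mul_smul_comm, ← mul_assoc,
      (commute_of_mem_functions hf y).eq, mul_assoc]
  | add x _ x' _ hx hx' => rw [add_mul, mul_add, hx, hx', smul_add]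

theorem d_mul_forms {i : ℕ} {x : PolyForm K n} (hx : x ∈ forms K n i) (y : PolyForm K n) :
    d (x * y) = d x * y + (-1 : K) ^ i • (x * d y) := by
  rw [d_mul, sgn_of_mem_forms hx, smul_mul_assoc]

/-- The restriction `δ^{k,n+1} : Ω_{n+1} → Ω_n` to the `k`-th face, on which `t_k = 0`. -/
def face (k : Fin (n + 2)) : PolyForm K (n + 1) →ₐ[K] PolyForm K n :=
  lift (k.insertNth 0 t) (k.insertNth 0 dt)
    (fun i j => by
      induction i using k.succAboveCases <;> induction j using k.succAboveCases <;>
        simp [t_mul_t])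
    (fun i j => by
      induction i using k.succAboveCases <;> induction j using k.succAboveCases <;>
        simp [t_mul_dt])
    (fun i j => by
      induction i using k.succAboveCases <;> induction j using k.succAboveCases <;>
        simp [← dt_mul_dt])
    (fun i => by
      induction i using k.succAboveCases <;> simp [dt_mul_self])
    (by simp [Fin.sum_univ_succAbove _ k, sum_t])
    (by simp [Fin.sum_univ_succAbove _ k, sum_dt])

@[simp] theorem face_t (k : Fin (n + 2)) (i : Fin (n + 2)) :
    face k (t i : PolyForm K (n + 1)) = k.insertNth (α := fun _ => PolyForm K n) 0 t i :=
  lift_t ..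

@[simp] theorem face_dt (k : Fin (n + 2)) (i : Fin (n + 2)) :
    face k (dt i : PolyForm K (n + 1)) = k.insertNth (α := fun _ => PolyForm K n) 0 dt i :=
  lift_dt ..

theorem face_sgn (k : Fin (n + 2)) (x : PolyForm K (n + 1)) :
    face k (sgn x) = sgn (face k x) := by
  induction x using induction with
  | hK r => simp
  | ht i => induction i using k.succAboveCases <;> simp
  | hdt i => induction i using k.succAboveCases <;> simp
  | hmul x y hx hy => simp [sgn_mul, hx, hy]
  | hadd x y hx hy => simp [hx, hy]

theorem face_d (k : Fin (n + 2)) (x : PolyForm K (n + 1)) : face k (d x) = d (face k x) := by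
  induction x using induction with
  | hK r => simp
  | ht i => induction i using k.succAboveCases <;> simp
  | hdt i => induction i using k.succAboveCases <;> simp
  | hmul x y hx hy => simp [d_mul, hx, hy, face_sgn]
  | hadd x y hx hy => simp [hx, hy]

end PolyForm

/-! ### Differential graded Lie algebras -/

/-- A differential graded Lie algebra over `K`: a `ℤ`-graded cochain complex of `K`-vector
spaces with a bilinear bracket of degree 0 which is graded skew-symmetric, satisfies the graded
Jacobi identity and for which the differential is a graded derivation. -/
structure DGLA (K : Type u) [Field K] where
  /-- the underlying complex -/
  cx : CochainComplex (ModuleCat.{u} K) ℤ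
  /-- the bracket `L^i × L^j → L^k`, where `i + j = k` -/
  br (i j k : ℤ) (h : i + j = k) : cx.X i →ₗ[K] cx.X j →ₗ[K] cx.X k
  br_skew (i j k : ℤ) (h : i + j = k) (x : cx.X i) (y : cx.X j) :
    br i j k h x y = -((-1 : K) ^ (i * j) • br j i k (by lia) y x)
  br_jacobi (i j k ij jk ik l : ℤ) (hij : i + j = ij) (hjk : j + k = jk) (hik : i + k = ik)
    (hl : i + j + k = l) (x : cx.X i) (y : cx.X j) (z : cx.X k) :
    br i jk l (by lia) x (br j k jk hjk y z) =
      br ij k l (by lia) (br i j ij hij x y) z +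
        (-1 : K) ^ (i * j) • br j ik l (by lia) y (br i k ik hik x z)
  d_br (i j k : ℤ) (h : i + j = k) (x : cx.X i) (y : cx.X j) :
    (cx.d k (k + 1)).hom (br i j k h x y) =
      br (i + 1) j (k + 1) (by lia) ((cx.d i (i + 1)).hom x) y +
        (-1 : K) ^ i • br i (j + 1) (k + 1) (by lia) x ((cx.d j (j + 1)).hom y)

namespace DGLA

variable {K : Type u} [Field K]

/-- A morphism of DGLAs: a morphism of complexes that preserves brackets. -/
@[ext]
structure Hom (L M : DGLA K) where
  /-- the underlying morphism of complexes -/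
  f : L.cx ⟶ M.cx
  map_br (i j k : ℤ) (h : i + j = k) (x : L.cx.X i) (y : L.cx.X j) :
    (f.f k).hom (L.br i j k h x y) = M.br i j k h ((f.f i).hom x) ((f.f j).hom y)

instance : Category (DGLA K) where
  Hom := Hom
  id L := { f := 𝟙 _, map_br := by simp }
  comp φ ψ := { f := φ.f ≫ ψ.f, map_br := by simp [φ.map_br, ψ.map_br] }
  id_comp _ := Hom.ext (Category.id_comp _)
  comp_id _ := Hom.ext (Category.comp_id _)
  assoc _ _ _ := Hom.ext (Category.assoc _ _ _)

@[ext]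
theorem hom_ext {L M : DGLA K} {φ ψ : L ⟶ M} (h : φ.f = ψ.f) : φ = ψ := Hom.ext h

@[simp] theorem id_f (L : DGLA K) : Hom.f (𝟙 L) = 𝟙 L.cx := rfl

@[simp] theorem comp_f {L M N : DGLA K} (φ : L ⟶ M) (ψ : M ⟶ N) : (φ ≫ ψ).f = φ.f ≫ ψ.f := rfl

variable (K) in
/-- The functor forgetting the bracket. -/
def forgetBracket : DGLA K ⥤ CochainComplex (ModuleCat.{u} K) ℤ where
  obj L := L.cx
  map φ := φ.f

/-- A morphism of DGLAs is a quasi-isomorphism if it induces isomorphisms in cohomology. -/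
def IsQuasiIso {L M : DGLA K} (φ : L ⟶ M) : Prop := QuasiIso φ.f

/-- Two DGLAs are quasi-isomorphic if they are connected by a zigzag of quasi-isomorphisms of
DGLAs. -/
def QuasiIsomorphic : DGLA K → DGLA K → Prop :=
  Relation.EqvGen fun L M => ∃ φ : L ⟶ M, IsQuasiIso φ

/-- The product of a family of DGLAs. -/
def pi {ι : Type u} (L : ι → DGLA K) : DGLA K where
  cx :=
    { X := fun m => ModuleCat.of K (∀ a, (L a).cx.X m)
      d := fun m m' => ModuleCat.ofHom
        (LinearMap.pi fun a => ((L a).cx.d m m').hom ∘ₗ LinearMap.proj a)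
      shape := fun m m' h => by
        ext x a; simp [(L a).cx.shape m m' h]; rfl
      d_comp_d' := fun i j k _ _ => by
        ext x a; simp [← ModuleCat.comp_apply]; rfl }
  br i j k h := LinearMap.mk₂ K (fun x y a => (L a).br i j k h (x a) (y a))
    (fun _ _ _ => by funext a; simp) (fun _ _ _ => by funext a; simp)
    (fun _ _ _ => by funext a; simp) (fun _ _ _ => by funext a; simp)
  br_skew i j k h x y := by funext a; exact (L a).br_skew i j k h (x a) (y a)
  br_jacobi i j k ij jk ik l hij hjk hik hl x y z := by
    funext a; exact (L a).br_jacobi i j k ij jk ik l hij hjk hik hl (x a) (y a) (z a)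
  d_br i j k h x y := by funext a; exact (L a).d_br i j k h (x a) (y a)

/-- The morphism to a product given by morphisms to the factors. -/
def toPi {ι : Type u} {M : DGLA K} {L : ι → DGLA K} (φ : ∀ a, M ⟶ L a) : M ⟶ pi L where
  f :=
    { f := fun m => ModuleCat.ofHom (LinearMap.pi fun a => ((φ a).f.f m).hom)
      comm' := fun i j _ => by
        ext x; funext a
        exact congrArg (fun ψ => ψ.hom x) ((φ a).f.comm i j) }
  map_br i j k h x y := by funext a; exact (φ a).map_br i j k h x y

/-- The projections from a product. -/
def piProj {ι : Type u} (L : ι → DGLA K) (a : ι) : pi L ⟶ L a where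
  f :=
    { f := fun m => ModuleCat.ofHom (LinearMap.proj a)
      comm' := fun i j _ => by ext x; rfl }
  map_br i j k h x y := rfl

theorem toPi_proj {ι : Type u} {M : DGLA K} {L : ι → DGLA K} (φ : ∀ a, M ⟶ L a) (a : ι) :
    toPi φ ≫ piProj L a = φ a := rfl

theorem pi_hom_ext {ι : Type u} {M : DGLA K} {L : ι → DGLA K} {φ ψ : M ⟶ pi L}
    (h : ∀ a, φ ≫ piProj L a = ψ ≫ piProj L a) : φ = ψ := by
  ext m x
  funext a
  exact congrArg (fun θ : M ⟶ L a => (θ.f.f m).hom x) (h a)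

end DGLA

/-! ### Semicosimplicial DGLAs and the Thom–Whitney DGLA -/

/-- A semicosimplicial DGLA. -/
structure SemicosimplicialDGLA (K : Type u) [Field K] where
  obj : ℕ → DGLA K
  /-- `face n k` is the coface map `∂_{k,n+1}` -/
  face (n : ℕ) (k : Fin (n + 2)) : obj n ⟶ obj (n + 1)
  face_face (n : ℕ) (l k : Fin (n + 2)) (h : l ≤ k) :
    face n l ≫ face (n + 1) k.succ = face n k ≫ face (n + 1) l.castSucc

namespace SemicosimplicialDGLA

variable {K : Type u} [Field K]

/-- A morphism of semicosimplicial DGLAs. -/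
structure Hom (g h : SemicosimplicialDGLA K) where
  app (n : ℕ) : g.obj n ⟶ h.obj n
  face_app (n : ℕ) (k : Fin (n + 2)) : g.face n k ≫ app (n + 1) = app n ≫ h.face n k

end SemicosimplicialDGLA

/-- An augmentation of a semicosimplicial DGLA by a DGLA `L` (placed in cosimplicial
degree `-1`). -/
structure SemicosimplicialDGLA.Augmentation {K : Type u} [Field K] (g : SemicosimplicialDGLA K)
    (L : DGLA K) where
  hom : L ⟶ g.obj 0
  hom_face : hom ≫ g.face 0 0 = hom ≫ g.face 0 1

namespace ThomWhitney

variable {K : Type u} [Field K]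

section level

variable (L : DGLA K) (n : ℕ)

/-- The subspace `Ω_n^i ⊗ L^j` of `Ω_n ⊗ L^j`. -/
def bideg (i : ℕ) (j : ℤ) : Submodule K (PolyForm K n ⊗[K] L.cx.X j) :=
  LinearMap.range ((PolyForm.forms K n i).subtype.rTensor (L.cx.X j))

/-- The bilinear map `(ω ⊗ x, η ⊗ y) ↦ ωη ⊗ [x, y]`. -/
def prodBr (i j k : ℤ) (h : i + j = k) :
    PolyForm K n ⊗[K] L.cx.X i →ₗ[K] PolyForm K n ⊗[K] L.cx.X j →ₗ[K]
      PolyForm K n ⊗[K] L.cx.X k :=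
  TensorProduct.map₂ (LinearMap.mul K (PolyForm K n)) (L.br i j k h)

variable {L n}

@[simp] theorem prodBr_tmul (i j k : ℤ) (h : i + j = k) (ω η : PolyForm K n) (x : L.cx.X i)
    (y : L.cx.X j) : prodBr L n i j k h (ω ⊗ₜ x) (η ⊗ₜ y) = (ω * η) ⊗ₜ L.br i j k h x y := by
  simp [prodBr, TensorProduct.map₂_apply_tmul]

theorem tmul_mem_bideg {i : ℕ} {j : ℤ} {ω : PolyForm K n} (h : ω ∈ PolyForm.forms K n i)
    (x : L.cx.X j) : ω ⊗ₜ x ∈ bideg L n i j := ⟨⟨ω, h⟩ ⊗ₜ x, rfl⟩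

theorem bideg_induction {i : ℕ} {j : ℤ} {P : ∀ a, a ∈ bideg L n i j → Prop}
    (zero : P 0 (zero_mem _)) (add : ∀ x y hx hy, P x hx → P y hy → P (x + y) (add_mem hx hy))
    (tmul : ∀ ω (hω : ω ∈ PolyForm.forms K n i) x, P (ω ⊗ₜ x) (tmul_mem_bideg hω x)) {a}
    (ha : a ∈ bideg L n i j) : P a ha := by
  obtain ⟨a, rfl⟩ := ha
  induction a using TensorProduct.induction_on with
  | zero => simpa using zero
  | tmul ω x => exact tmul _ ω.2 x
  | add x y hx hy => simpa using add _ _ _ _ hx hy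

theorem prodBr_mem {i i' i'' : ℕ} (hi : i + i' = i'') {j j' j'' : ℤ} (h : j + j' = j'') {a b}
    (ha : a ∈ bideg L n i j) (hb : b ∈ bideg L n i' j') :
    prodBr L n j j' j'' h a b ∈ bideg L n i'' j'' := by
  induction ha using bideg_induction with
  | zero => simp
  | add x y _ _ hx hy => simpa using add_mem hx hy
  | tmul ω hω x =>
    induction hb using bideg_induction with
    | zero => simp
    | add x y _ _ hx hy => simpa using add_mem hx hy
    | tmul η hη y =>
      rw [prodBr_tmul]
      exact tmul_mem_bideg (PolyForm.mul_mem_forms hi hω hη) _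

theorem rTensor_d_mem {i : ℕ} {j : ℤ} {a} (ha : a ∈ bideg L n i j) :
    PolyForm.d.rTensor (L.cx.X j) a ∈ bideg L n (i + 1) j := by
  induction ha using bideg_induction with
  | zero => simp
  | add x y _ _ hx hy => simpa using add_mem hx hy
  | tmul ω hω x =>
    exact tmul_mem_bideg (PolyForm.d_mem_forms hω) x

theorem lTensor_mem {M : DGLA K} {i : ℕ} {j j' : ℤ} (f : L.cx.X j →ₗ[K] M.cx.X j') {a}
    (ha : a ∈ bideg L n i j) : f.lTensor (PolyForm K n) a ∈ bideg M n i j' := by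
  induction ha using bideg_induction with
  | zero => simp
  | add x y _ _ hx hy => simpa using add_mem hx hy
  | tmul ω hω x =>
    exact tmul_mem_bideg hω (f x)

theorem neg_one_zpow_congr {a b : ℤ} (h : Even (a - b)) : (-1 : K) ^ a = (-1) ^ b := by
  rw [show a = (a - b) + b by ring, zpow_add₀ (by simp), h.neg_one_zpow, one_mul]

theorem neg_one_zpow_mul (a b : ℤ) : (-1 : K) ^ a * (-1) ^ b = (-1) ^ (a + b) :=
  (zpow_add₀ (by simp) a b).symm

theorem prodBr_skew {i i' : ℕ} {j j' j'' : ℤ} (h : j + j' = j'') {a b}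
    (ha : a ∈ bideg L n i j) (hb : b ∈ bideg L n i' j') :
    prodBr L n j j' j'' h a b =
      -((-1 : K) ^ (i * i' + j * j') • prodBr L n j' j j'' (by lia) b a) := by
  induction ha using bideg_induction with
  | zero => simp
  | add x y _ _ hx hy => rw [map_add, LinearMap.add_apply, hx, hy, map_add, smul_add, neg_add]
  | tmul ω hω x =>
    induction hb using bideg_induction with
    | zero => simp
    | add x y _ _ hx hy => rw [map_add, hx, hy, map_add, LinearMap.add_apply, smul_add, neg_add]
    | tmul η hη y =>
      rw [prodBr_tmul, prodBr_tmul, PolyForm.mul_comm_forms hω hη, L.br_skew, TensorProduct.tmul_neg,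
        TensorProduct.smul_tmul_smul, ← neg_one_zpow_mul]
      norm_cast

theorem prodBr_jacobi {i i' : ℕ} {j k l jk kl jl m : ℤ} (hjk : j + k = jk) (hkl : k + l = kl)
    (hjl : j + l = jl) (hm : j + k + l = m) {a b} (c) (ha : a ∈ bideg L n i j)
    (hb : b ∈ bideg L n i' k) :
    prodBr L n j kl m (by lia) a (prodBr L n k l kl hkl b c) =
      prodBr L n jk l m (by lia) (prodBr L n j k jk hjk a b) c +
        (-1 : K) ^ (i * i' + j * k) •
          prodBr L n k jl m (by lia) b (prodBr L n j l jl hjl a c) := by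
  induction ha using bideg_induction with
  | zero => simp
  | add x y _ _ hx hy => simp only [map_add, LinearMap.add_apply, hx, hy, smul_add]; abel
  | tmul ω hω x =>
    induction hb using bideg_induction with
    | zero => simp
    | add x y _ _ hx hy => simp only [map_add, LinearMap.add_apply, hx, hy, smul_add]; abel
    | tmul η hη y =>
      induction c using TensorProduct.induction_on with
      | zero => simp
      | add x y hx hy => simp only [map_add, hx, hy, smul_add]; abel
      | tmul θ z =>
        simp only [prodBr_tmul]
        rw [L.br_jacobi j k l jk kl jl m hjk hkl hjl hm, TensorProduct.tmul_add, mul_assoc,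
          TensorProduct.tmul_smul, ← neg_one_zpow_mul,
          mul_comm ((-1 : K) ^ ((i : ℤ) * i')), mul_smul]
        congr 2
        rw [← mul_assoc, PolyForm.mul_comm_forms hω hη, smul_mul_assoc, mul_assoc,
          TensorProduct.smul_tmul']
        norm_cast

theorem rTensor_d_prodBr {i : ℕ} {j k l : ℤ} (h : j + k = l) {a} (b) (ha : a ∈ bideg L n i j) :
    PolyForm.d.rTensor (L.cx.X l) (prodBr L n j k l h a b) =
      prodBr L n j k l h (PolyForm.d.rTensor (L.cx.X j) a) b +
        (-1 : K) ^ (i : ℤ) • prodBr L n j k l h a (PolyForm.d.rTensor (L.cx.X k) b) := by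
  induction ha using bideg_induction with
  | zero => simp
  | add x y _ _ hx hy => simp only [map_add, LinearMap.add_apply, hx, hy, smul_add]; abel
  | tmul ω hω x =>
    induction b using TensorProduct.induction_on with
    | zero => simp
    | add x y hx hy => simp only [map_add, hx, hy, smul_add]; abel
    | tmul θ z =>
      simp [PolyForm.d_mul_forms hω, TensorProduct.add_tmul, TensorProduct.smul_tmul']

theorem lTensor_d_prodBr {j k l : ℤ} (h : j + k = l) (a b) :
    (L.cx.d l (l + 1)).hom.lTensor (PolyForm K n) (prodBr L n j k l h a b) =
      prodBr L n (j + 1) k (l + 1) (by lia) ((L.cx.d j (j + 1)).hom.lTensor _ a) b +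
        (-1 : K) ^ j •
          prodBr L n j (k + 1) (l + 1) (by lia) a ((L.cx.d k (k + 1)).hom.lTensor _ b) := by
  induction a using TensorProduct.induction_on with
  | zero => simp
  | add x y hx hy => simp only [map_add, LinearMap.add_apply, hx, hy, smul_add]; abel
  | tmul ω x =>
    induction b using TensorProduct.induction_on with
    | zero => simp
    | add x y hx hy => simp only [map_add, hx, hy, smul_add]; abel
    | tmul θ z => simp [L.d_br j k l h, TensorProduct.tmul_add]

theorem lTensor_prodBr {M : DGLA K} (φ : L ⟶ M) {j k l : ℤ} (h : j + k = l) (a b) :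
    (φ.f.f l).hom.lTensor (PolyForm K n) (prodBr L n j k l h a b) =
      prodBr M n j k l h ((φ.f.f j).hom.lTensor _ a) ((φ.f.f k).hom.lTensor _ b) := by
  induction a using TensorProduct.induction_on with
  | zero => simp
  | add x y hx hy => simp only [map_add, LinearMap.add_apply, hx, hy]
  | tmul ω x =>
    induction b using TensorProduct.induction_on with
    | zero => simp
    | add x y hx hy => simp only [map_add, hx, hy]
    | tmul θ z => simp [φ.map_br j k l h]

theorem face_prodBr (r : Fin (n + 2)) {j k l : ℤ} (h : j + k = l) (a b) :
    (PolyForm.face r).toLinearMap.rTensor (L.cx.X l) (prodBr L (n + 1) j k l h a b) =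
      prodBr L n j k l h ((PolyForm.face r).toLinearMap.rTensor _ a)
        ((PolyForm.face r).toLinearMap.rTensor _ b) := by
  induction a using TensorProduct.induction_on with
  | zero => simp
  | add x y hx hy => simp only [map_add, LinearMap.add_apply, hx, hy]
  | tmul ω x =>
    induction b using TensorProduct.induction_on with
    | zero => simp
    | add x y hx hy => simp only [map_add, hx, hy]
    | tmul θ z => simp

end level

theorem rTensor_lTensor {A B C D : Type u} [AddCommGroup A] [AddCommGroup B] [AddCommGroup C]
    [AddCommGroup D] [Module K A] [Module K B] [Module K C] [Module K D] (f : A →ₗ[K] B)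
    (f' : C →ₗ[K] D) (x : A ⊗[K] C) :
    f.rTensor D (f'.lTensor A x) = f'.lTensor B (f.rTensor C x) := by
  rw [← LinearMap.comp_apply, ← LinearMap.comp_apply, LinearMap.rTensor_comp_lTensor,
    LinearMap.lTensor_comp_rTensor]

/-- The product `∏_n Ω_n ⊗ g_n^j`. -/
def Seq (g : SemicosimplicialDGLA K) (j : ℤ) : Type u :=
  ∀ n, PolyForm K n ⊗[K] (g.obj n).cx.X j

namespace Seq

variable {g h : SemicosimplicialDGLA K} {j j' : ℤ}

instance : AddCommGroup (Seq g j) :=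
  inferInstanceAs (AddCommGroup (∀ n, PolyForm K n ⊗[K] (g.obj n).cx.X j))

instance : Module K (Seq g j) :=
  inferInstanceAs (Module K (∀ n, PolyForm K n ⊗[K] (g.obj n).cx.X j))

@[ext] theorem ext {x y : Seq g j} (h : ∀ n, x n = y n) : x = y := funext h

@[simp] theorem zero_apply (n : ℕ) : (0 : Seq g j) n = 0 := rfl

@[simp] theorem add_apply (x y : Seq g j) (n : ℕ) : (x + y) n = x n + y n := rfl

@[simp] theorem neg_apply (x : Seq g j) (n : ℕ) : (-x) n = -x n := rfl

@[simp] theorem smul_apply (r : K) (x : Seq g j) (n : ℕ) : (r • x) n = r • x n := rfl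

/-- Apply a linear map in each cosimplicial degree. -/
def map (f : ∀ n, PolyForm K n ⊗[K] (g.obj n).cx.X j →ₗ[K] PolyForm K n ⊗[K] (h.obj n).cx.X j') :
    Seq g j →ₗ[K] Seq h j' where
  toFun x n := f n (x n)
  map_add' x y := funext fun n => map_add (f n) (x n) (y n)
  map_smul' r x := funext fun n => map_smul (f n) r (x n)

theorem map_apply (f : ∀ n, PolyForm K n ⊗[K] (g.obj n).cx.X j →ₗ[K]
    PolyForm K n ⊗[K] (h.obj n).cx.X j') (x : Seq g j) (n : ℕ) : map f x n = f n (x n) := rfl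

end Seq

/-- The space `C^{i,j}_TW(g)` of the Thom–Whitney bicomplex: the sequences `(x_n)` of elements
`x_n ∈ Ω_n^i ⊗ g_n^j` with `δ^{k,n} x_n = ∂_{k,n} x_{n-1}` for all `n ≥ 1` and `0 ≤ k ≤ n`. -/
def bicomplex (g : SemicosimplicialDGLA K) (i : ℕ) (j : ℤ) :
    Submodule K (Seq g j) where
  carrier := { x | (∀ n, x n ∈ bideg (g.obj n) n i j) ∧
    ∀ (n : ℕ) (k : Fin (n + 2)), (PolyForm.face k).toLinearMap.rTensor _ (x (n + 1)) =
      ((g.face n k).f.f j).hom.lTensor _ (x n) }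
  add_mem' hx hy := ⟨fun n => add_mem (hx.1 n) (hy.1 n), fun n k => by
    simp only [Seq.add_apply, map_add, hx.2, hy.2]⟩
  zero_mem' := ⟨fun n => zero_mem _, fun n k => by simp⟩
  smul_mem' r x hx := ⟨fun n => Submodule.smul_mem _ r (hx.1 n), fun n k => by
    simp only [Seq.smul_apply, map_smul, hx.2]⟩

section bicomplex

variable (g : SemicosimplicialDGLA K)

/-- The differential `d ⊗ 1` of the Thom–Whitney bicomplex. -/
def dForm (i : ℕ) (j : ℤ) : bicomplex g i j →ₗ[K] bicomplex g (i + 1) j :=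
  LinearMap.restrict (Seq.map fun n => PolyForm.d.rTensor _)
    fun x hx => ⟨fun n => rTensor_d_mem (hx.1 n), fun n k => by
      have h1 := congrArg (PolyForm.d.rTensor _) (hx.2 n k)
      simp only [Seq.map_apply]
      rw [rTensor_lTensor] at h1
      rw [← h1, ← LinearMap.rTensor_comp_apply, ← LinearMap.rTensor_comp_apply]
      congr 2
      ext y
      exact PolyForm.face_d k y⟩

/-- The differential `1 ⊗ d` of the Thom–Whitney bicomplex. -/
def dLie (i : ℕ) (j j' : ℤ) : bicomplex g i j →ₗ[K] bicomplex g i j' :=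
  LinearMap.restrict
    (Seq.map fun n => ((g.obj n).cx.d j j').hom.lTensor _)
    fun x hx => ⟨fun n => lTensor_mem _ (hx.1 n), fun n k => by
      have h1 := congrArg (((g.obj (n + 1)).cx.d j j').hom.lTensor _) (hx.2 n k)
      simp only [Seq.map_apply]
      rw [← rTensor_lTensor] at h1
      rw [h1, ← LinearMap.lTensor_comp_apply, ← LinearMap.lTensor_comp_apply,
        ← ModuleCat.hom_comp, ← ModuleCat.hom_comp, (g.face n k).f.comm]⟩

/-- The bracket `(ω ⊗ x, η ⊗ y) ↦ (-1)^{|x||η|} ωη ⊗ [x, y]` of the Thom–Whitney bicomplex. -/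
def brBi (i i' i'' : ℕ) (hi : i + i' = i'') (j j' j'' : ℤ) (h : j + j' = j'') :
    bicomplex g i j →ₗ[K] bicomplex g i' j' →ₗ[K] bicomplex g i'' j'' :=
  let T (n : ℕ) := (-1 : K) ^ (j * i') • prodBr (g.obj n) n j j' j'' h
  LinearMap.mk₂ K
    (fun x y => ⟨fun n => T n (x.1 n) (y.1 n),
      fun n => Submodule.smul_mem _ _ (prodBr_mem hi h (x.2.1 n) (y.2.1 n)), fun n k => by
        simp only [T, LinearMap.smul_apply]
        rw [map_smul, map_smul, face_prodBr, x.2.2, y.2.2, lTensor_prodBr]⟩)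
    (fun x x' y => Subtype.ext <| funext fun n => (T n).map_add₂ (x.1 n) (x'.1 n) (y.1 n))
    (fun r x y => Subtype.ext <| funext fun n => (T n).map_smul₂ r (x.1 n) (y.1 n))
    (fun x y y' => Subtype.ext <| funext fun n => (T n (x.1 n)).map_add (y.1 n) (y'.1 n))
    (fun r x y => Subtype.ext <| funext fun n => (T n (x.1 n)).map_smul r (y.1 n))

variable {g}

theorem dForm_apply {i : ℕ} {j : ℤ} (x : bicomplex g i j) (n : ℕ) :
    (dForm g i j x).1 n = PolyForm.d.rTensor _ (x.1 n) := rfl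

theorem dLie_apply {i : ℕ} {j j' : ℤ} (x : bicomplex g i j) (n : ℕ) :
    (dLie g i j j' x).1 n = ((g.obj n).cx.d j j').hom.lTensor _ (x.1 n) := rfl

theorem brBi_apply {i i' i'' : ℕ} (hi : i + i' = i'') {j j' j'' : ℤ} (h : j + j' = j'')
    (x : bicomplex g i j) (y : bicomplex g i' j') (n : ℕ) :
    (brBi g i i' i'' hi j j' j'' h x y).1 n =
      (-1 : K) ^ (j * i') • prodBr (g.obj n) n j j' j'' h (x.1 n) (y.1 n) := rfl

variable (g)

/-- The degree `m` component `⨁_{i+j=m} C^{i,j}_TW(g)` of the total complex. -/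
abbrev totX (m : ℤ) : Type u :=
  ⨁ p : { p : ℕ × ℤ // (p.1 : ℤ) + p.2 = m }, bicomplex g p.1.1 p.1.2

/-- The inclusion of `C^{i,j}_TW(g)` into the total complex. -/
def inc (m : ℤ) (i : ℕ) (j : ℤ) (h : (i : ℤ) + j = m) : bicomplex g i j →ₗ[K] totX g m :=
  DirectSum.lof K { p : ℕ × ℤ // (p.1 : ℤ) + p.2 = m }
    (fun p => bicomplex g p.1.1 p.1.2) ⟨(i, j), h⟩

/-- The total differential, `d ⊗ 1 + (-1)^i (1 ⊗ d)` on `C^{i,j}_TW(g)`. -/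
def totD (m m' : ℤ) (h : m + 1 = m') : totX g m →ₗ[K] totX g m' :=
  DirectSum.toModule K _ _ fun p =>
    inc g m' (p.1.1 + 1) p.1.2 (by have := p.2; push_cast; lia) ∘ₗ dForm g p.1.1 p.1.2 +
      (-1 : K) ^ (p.1.1 : ℤ) •
        inc g m' p.1.1 (p.1.2 + 1) (by have := p.2; lia) ∘ₗ dLie g p.1.1 p.1.2 (p.1.2 + 1)

/-- The bracket of the total complex. -/
def totBr (m m' m'' : ℤ) (h : m + m' = m'') : totX g m →ₗ[K] totX g m' →ₗ[K] totX g m'' :=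
  DirectSum.toModule K _ _ fun p => LinearMap.flip <| DirectSum.toModule K _ _ fun q =>
    LinearMap.flip <| (brBi g p.1.1 q.1.1 _ rfl p.1.2 q.1.2 _ rfl).compr₂
      (inc g m'' (p.1.1 + q.1.1) (p.1.2 + q.1.2) (by
        have := p.2; have := q.2; push_cast; lia))

variable {g}

theorem tot_induction {m : ℤ} {P : totX g m → Prop} (zero : P 0)
    (add : ∀ x y, P x → P y → P (x + y))
    (inc : ∀ i j h (x : bicomplex g i j), P (inc g m i j h x)) (x : totX g m) : P x := by
  induction x using DirectSum.induction_on with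
  | zero => exact zero
  | of p x => exact inc p.1.1 p.1.2 p.2 x
  | add x y hx hy => exact add x y hx hy

theorem inc_congr {m : ℤ} {i i' : ℕ} {j : ℤ} (hi : i = i') (h : (i : ℤ) + j = m)
    (h' : (i' : ℤ) + j = m) {x : bicomplex g i j} {x' : bicomplex g i' j}
    (hx : ∀ n, x.1 n = x'.1 n) : inc g m i j h x = inc g m i' j h' x' := by
  subst hi
  congr 1
  ext n
  exact hx n

theorem totD_inc (m m' : ℤ) (h : m + 1 = m') (i : ℕ) (j : ℤ) (hij : (i : ℤ) + j = m)
    (x : bicomplex g i j) :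
    totD g m m' h (inc g m i j hij x) =
      inc g m' (i + 1) j (by push_cast; lia) (dForm g i j x) +
        (-1 : K) ^ (i : ℤ) • inc g m' i (j + 1) (by lia) (dLie g i j (j + 1) x) := by
  simp [totD, inc]

theorem totBr_inc (m m' m'' : ℤ) (h : m + m' = m'') (i i' i'' : ℕ) (hi : i + i' = i'')
    (j j' j'' : ℤ) (hj : j + j' = j'') (hij : (i : ℤ) + j = m) (hij' : (i' : ℤ) + j' = m')
    (x : bicomplex g i j) (y : bicomplex g i' j') :
    totBr g m m' m'' h (inc g m i j hij x) (inc g m' i' j' hij' y) =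
      inc g m'' i'' j'' (by lia) (brBi g i i' i'' hi j j' j'' hj x y) := by
  subst hi hj
  simp [totBr, inc]

theorem totD_totD (m m' m'' : ℤ) (h : m + 1 = m') (h' : m' + 1 = m'') (x : totX g m) :
    totD g m' m'' h' (totD g m m' h x) = 0 := by
  induction x using tot_induction with
  | zero => simp
  | add x y hx hy => simp [hx, hy]
  | inc i j hij x =>
    have h1 : dForm g (i + 1) j (dForm g i j x) = 0 := by
      ext n
      simp only [dForm_apply]
      rw [← LinearMap.rTensor_comp_apply,
        show (PolyForm.d ∘ₗ PolyForm.d : PolyForm K n →ₗ[K] _) = 0 from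
          LinearMap.ext PolyForm.d_d]
      simp
    have h2 : dLie g i (j + 1) (j + 1 + 1) (dLie g i j (j + 1) x) = 0 := by
      ext n
      simp only [dLie_apply]
      rw [← LinearMap.lTensor_comp_apply, ← ModuleCat.hom_comp]
      simp
    have h3 : dForm g i (j + 1) (dLie g i j (j + 1) x) =
        dLie g (i + 1) j (j + 1) (dForm g i j x) := by
      ext n
      simp only [dLie_apply, dForm_apply]
      rw [rTensor_lTensor]
    have h4 : (-1 : K) ^ ((i + 1 : ℕ) : ℤ) = -(-1) ^ (i : ℤ) := by
      push_cast; rw [zpow_add₀ (by simp)]; simp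
    simp only [totD_inc, map_add, map_smul, h1, h2, h3, h4, map_zero, smul_zero, zero_add,
      add_zero]
    rw [← add_smul, neg_add_cancel, zero_smul]

theorem totBr_skew (m m' m'' : ℤ) (h : m + m' = m'') (x : totX g m) (y : totX g m') :
    totBr g m m' m'' h x y =
      -((-1 : K) ^ (m * m') • totBr g m' m m'' (by lia) y x) := by
  induction x using tot_induction with
  | zero => simp
  | add x y hx hy => simp only [map_add, LinearMap.add_apply, hx, hy, smul_add, neg_add]
  | inc i j hij x =>
    induction y using tot_induction with
    | zero => simp
    | add x y hx hy => simp only [map_add, LinearMap.add_apply, hx, hy, smul_add, neg_add]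
    | inc i' j' hij' y =>
      rw [totBr_inc m m' m'' h i i' _ rfl j j' _ rfl,
        totBr_inc m' m m'' _ i' i _ (add_comm i' i) j' j _ (add_comm j' j), ← map_smul, ← map_neg]
      congr 1
      ext n
      simp only [brBi_apply, Submodule.coe_neg, Submodule.coe_smul, Seq.neg_apply, Seq.smul_apply]
      rw [prodBr_skew _ (x.2.1 n) (y.2.1 n), smul_neg, smul_smul, smul_smul, neg_one_zpow_mul,
        neg_one_zpow_mul, ← hij, ← hij']
      congr 2
      exact neg_one_zpow_congr ⟨-(i * j'), by ring⟩

theorem totBr_jacobi (i j k ij jk ik l : ℤ) (hij : i + j = ij) (hjk : j + k = jk)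
    (hik : i + k = ik) (hl : i + j + k = l) (x : totX g i) (y : totX g j) (z : totX g k) :
    totBr g i jk l (by lia) x (totBr g j k jk hjk y z) =
      totBr g ij k l (by lia) (totBr g i j ij hij x y) z +
        (-1 : K) ^ (i * j) • totBr g j ik l (by lia) y (totBr g i k ik hik x z) := by
  induction x using tot_induction with
  | zero => simp
  | add x y hx hy => simp only [map_add, LinearMap.add_apply, hx, hy, smul_add]; abel
  | inc a a' ha x =>
    induction y using tot_induction with
    | zero => simp
    | add x y hx hy => simp only [map_add, LinearMap.add_apply, hx, hy, smul_add]; abel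
    | inc b b' hb y =>
      induction z using tot_induction with
      | zero => simp
      | add x y hx hy => simp only [map_add, hx, hy, smul_add]; abel
      | inc c c' hc z =>
        rw [totBr_inc j k jk _ b c _ rfl b' c' _ rfl, totBr_inc i j ij _ a b _ rfl a' b' _ rfl,
          totBr_inc i k ik _ a c _ rfl a' c' _ rfl,
          totBr_inc i jk l _ a (b + c) (a + b + c) (by lia) a' (b' + c') (a' + b' + c') (by lia),
          totBr_inc ij k l _ (a + b) c (a + b + c) (by lia) (a' + b') c' (a' + b' + c') (by lia),
          totBr_inc j ik l _ b (a + c) (a + b + c) (by lia) b' (a' + c') (a' + b' + c') (by lia),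
          ← map_smul, ← map_add]
        congr 1
        ext n
        simp only [brBi_apply, Submodule.coe_add, Submodule.coe_smul, Seq.add_apply,
          Seq.smul_apply, map_smul, LinearMap.smul_apply, smul_smul]
        rw [prodBr_jacobi rfl rfl rfl rfl (z.1 n) (x.2.1 n) (y.2.1 n), smul_add, smul_smul]
        simp only [neg_one_zpow_mul]
        push_cast
        congr 2
        · exact neg_one_zpow_congr ⟨0, by ring⟩
        · rw [← ha, ← hb]
          exact neg_one_zpow_congr ⟨-(a * b'), by ring⟩

theorem totD_totBr (i j k : ℤ) (h : i + j = k) (x : totX g i) (y : totX g j) :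
    totD g k (k + 1) rfl (totBr g i j k h x y) =
      totBr g (i + 1) j (k + 1) (by lia) (totD g i (i + 1) rfl x) y +
        (-1 : K) ^ i • totBr g i (j + 1) (k + 1) (by lia) x (totD g j (j + 1) rfl y) := by
  induction x using tot_induction with
  | zero => simp
  | add x y hx hy => simp only [map_add, LinearMap.add_apply, hx, hy, smul_add]; abel
  | inc a a' ha x =>
    induction y using tot_induction with
    | zero => simp
    | add x y hx hy => simp only [map_add, hx, hy, smul_add]; abel
    | inc b b' hb y =>
      rw [totBr_inc i j k _ a b _ rfl a' b' _ rfl]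
      simp only [totD_inc, map_add, map_smul, LinearMap.add_apply, LinearMap.smul_apply]
      rw [totBr_inc (i + 1) j (k + 1) _ (a + 1) b (a + b + 1) (by lia) a' b' (a' + b') rfl,
        totBr_inc (i + 1) j (k + 1) _ a b (a + b) rfl (a' + 1) b' (a' + b' + 1) (by lia),
        totBr_inc i (j + 1) (k + 1) _ a (b + 1) (a + b + 1) (by lia) a' b' (a' + b') rfl,
        totBr_inc i (j + 1) (k + 1) _ a b (a + b) rfl a' (b' + 1) (a' + b' + 1) (by lia)]
      have h1 : dForm g (a + b) (a' + b') (brBi g a b _ rfl a' b' _ rfl x y) =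
          brBi g (a + 1) b (a + b + 1) (by lia) a' b' (a' + b') rfl (dForm g a a' x) y +
            (-1 : K) ^ i •
              brBi g a (b + 1) (a + b + 1) (by lia) a' b' (a' + b') rfl x (dForm g b b' y) := by
        ext n
        simp only [brBi_apply, dForm_apply, Submodule.coe_add, Submodule.coe_smul, Seq.add_apply,
          Seq.smul_apply, map_smul, smul_smul]
        rw [rTensor_d_prodBr rfl (y.1 n) (x.2.1 n), smul_add, smul_smul]
        simp only [neg_one_zpow_mul]
        push_cast
        congr 2
        rw [← ha]
        exact neg_one_zpow_congr ⟨-a', by ring⟩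
      have h2 : (-1 : K) ^ ((a + b : ℕ) : ℤ) • dLie g (a + b) (a' + b') (a' + b' + 1)
            (brBi g a b _ rfl a' b' _ rfl x y) =
          (-1 : K) ^ (a : ℤ) • brBi g a b (a + b) rfl (a' + 1) b' (a' + b' + 1) (by lia)
              (dLie g a a' (a' + 1) x) y +
            (-1 : K) ^ i • (-1 : K) ^ (b : ℤ) •
              brBi g a b (a + b) rfl a' (b' + 1) (a' + b' + 1) (by lia) x
                (dLie g b b' (b' + 1) y) := by
        ext n
        simp only [brBi_apply, dLie_apply, Submodule.coe_add, Submodule.coe_smul, Seq.add_apply,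
          Seq.smul_apply, map_smul, smul_smul]
        rw [lTensor_d_prodBr rfl (x.1 n) (y.1 n), smul_add, smul_smul]
        simp only [neg_one_zpow_mul]
        push_cast
        congr 2
        · exact neg_one_zpow_congr ⟨0, by ring⟩
        · rw [← ha]
          exact neg_one_zpow_congr ⟨0, by ring⟩
      rw [h1, ← map_smul (inc g (k + 1) (a + b) (a' + b' + 1) _), h2]
      simp only [map_add, map_smul, smul_add]
      abel

end bicomplex

/-- The Thom–Whitney DGLA `Tot_TW(g)` of a semicosimplicial DGLA. -/
def tot (g : SemicosimplicialDGLA K) : DGLA K where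
  cx :=
    { X := fun m => ModuleCat.of K (totX g m)
      d := fun m m' => if h : m + 1 = m' then ModuleCat.ofHom (totD g m m' h) else 0
      shape := fun m m' h => dif_neg h
      d_comp_d' := fun m m' m'' h h' => by
        obtain rfl : m + 1 = m' := h
        obtain rfl : m + 1 + 1 = m'' := h'
        rw [dif_pos rfl, dif_pos rfl, ← ModuleCat.ofHom_comp]
        refine ModuleCat.hom_ext (LinearMap.ext fun x => ?_)
        exact totD_totD m (m + 1) (m + 1 + 1) rfl rfl x }
  br := totBr g
  br_skew := totBr_skew
  br_jacobi := totBr_jacobi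
  d_br i j k h x y := by
    simp only [dite_true, ModuleCat.hom_ofHom]
    exact totD_totBr i j k h x y

section functoriality

variable {g h : SemicosimplicialDGLA K}

/-- The map of Thom–Whitney bicomplexes induced by a morphism of semicosimplicial DGLAs. -/
def bicomplexMap (φ : g.Hom h) (i : ℕ) (j : ℤ) : bicomplex g i j →ₗ[K] bicomplex h i j :=
  LinearMap.restrict
    (Seq.map fun n => ((φ.app n).f.f j).hom.lTensor _)
    fun x hx => ⟨fun n => lTensor_mem _ (hx.1 n), fun n k => by
      have h1 := congrArg (((φ.app (n + 1)).f.f j).hom.lTensor _) (hx.2 n k)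
      simp only [Seq.map_apply]
      rw [← rTensor_lTensor] at h1
      rw [h1, ← LinearMap.lTensor_comp_apply, ← LinearMap.lTensor_comp_apply,
        ← ModuleCat.hom_comp, ← ModuleCat.hom_comp, ← HomologicalComplex.comp_f,
        ← HomologicalComplex.comp_f, ← DGLA.comp_f, ← DGLA.comp_f, φ.face_app]⟩

theorem bicomplexMap_apply (φ : g.Hom h) {i : ℕ} {j : ℤ} (x : bicomplex g i j) (n : ℕ) :
    (bicomplexMap φ i j x).1 n = ((φ.app n).f.f j).hom.lTensor _ (x.1 n) := rfl

/-- The linear map `Tot_TW(g)^m → Tot_TW(h)^m` induced by a morphism `g → h`. -/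
def totXMap (φ : g.Hom h) (m : ℤ) : totX g m →ₗ[K] totX h m :=
  DirectSum.toModule K _ _ fun p => inc h m p.1.1 p.1.2 p.2 ∘ₗ bicomplexMap φ p.1.1 p.1.2

theorem totXMap_inc (φ : g.Hom h) (m : ℤ) (i : ℕ) (j : ℤ) (hij : (i : ℤ) + j = m)
    (x : bicomplex g i j) :
    totXMap φ m (inc g m i j hij x) = inc h m i j hij (bicomplexMap φ i j x) := by
  simp [totXMap, inc]

theorem totXMap_totD (φ : g.Hom h) (m m' : ℤ) (hm : m + 1 = m') (x : totX g m) :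
    totXMap φ m' (totD g m m' hm x) = totD h m m' hm (totXMap φ m x) := by
  induction x using tot_induction with
  | zero => simp
  | add x y hx hy => simp only [map_add, hx, hy]
  | inc i j hij x =>
    simp only [totD_inc, map_add, map_smul, totXMap_inc]
    have h1 : bicomplexMap φ (i + 1) j (dForm g i j x) = dForm h i j (bicomplexMap φ i j x) := by
      ext n
      simp only [bicomplexMap_apply, dForm_apply]
      rw [rTensor_lTensor]
    have h2 : bicomplexMap φ i (j + 1) (dLie g i j (j + 1) x) =
        dLie h i j (j + 1) (bicomplexMap φ i j x) := by
      ext n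
      simp only [bicomplexMap_apply, dLie_apply]
      rw [← LinearMap.lTensor_comp_apply, ← LinearMap.lTensor_comp_apply,
        ← ModuleCat.hom_comp, ← ModuleCat.hom_comp, (φ.app n).f.comm]
    rw [h1, h2]

theorem totXMap_totBr (φ : g.Hom h) (i j k : ℤ) (hk : i + j = k) (x : totX g i)
    (y : totX g j) :
    totXMap φ k (totBr g i j k hk x y) = totBr h i j k hk (totXMap φ i x) (totXMap φ j y) := by
  induction x using tot_induction with
  | zero => simp
  | add x y hx hy => simp only [map_add, LinearMap.add_apply, hx, hy]
  | inc a a' ha x =>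
    induction y using tot_induction with
    | zero => simp
    | add x y hx hy => simp only [map_add, hx, hy]
    | inc b b' hb y =>
      rw [totBr_inc i j k _ a b _ rfl a' b' _ rfl]
      simp only [totXMap_inc]
      rw [totBr_inc i j k _ a b _ rfl a' b' _ rfl]
      congr 1
      ext n
      simp only [bicomplexMap_apply, brBi_apply, map_smul]
      rw [lTensor_prodBr]

/-- The morphism `Tot_TW(g) → Tot_TW(h)` induced by a morphism of semicosimplicial DGLAs. -/
def totMap (φ : g.Hom h) : tot g ⟶ tot h where
  f :=
    { f := fun m => ModuleCat.ofHom (totXMap φ m)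
      comm' := fun m m' hm => by
        obtain rfl : m + 1 = m' := hm
        simp only [tot, dite_true]
        rw [← ModuleCat.ofHom_comp, ← ModuleCat.ofHom_comp]
        refine ModuleCat.hom_ext (LinearMap.ext fun x => ?_)
        exact (totXMap_totD φ m (m + 1) rfl x).symm }
  map_br := totXMap_totBr φ

end functoriality

section augmentation

variable {g : SemicosimplicialDGLA K} {L : DGLA K}

/-- The iterated map `∂_{n,n} ⋯ ∂_{1,1} ∂_{0,0} : L → g_n` of an augmentation. -/
def augIter (ε : g.Augmentation L) : ∀ n, L ⟶ g.obj n
  | 0 => ε.hom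
  | n + 1 => augIter ε n ≫ g.face n (Fin.last (n + 1))

theorem augIter_face (ε : g.Augmentation L) (n : ℕ) (k : Fin (n + 2)) :
    augIter ε n ≫ g.face n k = augIter ε (n + 1) := by
  induction n with
  | zero =>
    change ε.hom ≫ g.face 0 k = ε.hom ≫ g.face 0 1
    fin_cases k
    · exact ε.hom_face
    · rfl
  | succ n ih =>
    induction k using Fin.lastCases with
    | last => rfl
    | cast l =>
      change (augIter ε n ≫ g.face n (Fin.last (n + 1))) ≫ _ = augIter ε (n + 1) ≫ _
      rw [Category.assoc, ← g.face_face n l (Fin.last _) (Fin.le_last _), ← Category.assoc, ih l]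
      rfl

/-- The map `x ↦ (1 ⊗ ∂_{n,n} ⋯ ∂_{1,1} ∂_{0,0} x)_n` from `L^m` to `C^{0,m}_TW(g)`. -/
def augBi (ε : g.Augmentation L) (m : ℤ) : L.cx.X m →ₗ[K] bicomplex g 0 m where
  toFun x := ⟨fun n => 1 ⊗ₜ ((augIter ε n).f.f m).hom x,
    fun n => tmul_mem_bideg PolyForm.one_mem_forms _, fun n k => by
      simp [← augIter_face ε n k]⟩
  map_add' x y := Subtype.ext <| funext fun n =>
    (TensorProduct.mk K (PolyForm K n) _ 1 ∘ₗ ((augIter ε n).f.f m).hom).map_add x y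
  map_smul' r x := Subtype.ext <| funext fun n =>
    (TensorProduct.mk K (PolyForm K n) _ 1 ∘ₗ ((augIter ε n).f.f m).hom).map_smul r x

theorem augBi_apply (ε : g.Augmentation L) {m : ℤ} (x : L.cx.X m) (n : ℕ) :
    (augBi ε m x).1 n = 1 ⊗ₜ ((augIter ε n).f.f m).hom x := rfl

/-- The morphism `L → Tot_TW(g)` induced by an augmentation. -/
def augmentation (ε : g.Augmentation L) : L ⟶ tot g where
  f :=
    { f := fun m => ModuleCat.ofHom (inc g m 0 m (by simp) ∘ₗ augBi ε m)
      comm' := fun m m' hm => by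
        obtain rfl : m + 1 = m' := hm
        ext x
        simp only [tot, dite_true]
        change totD g m (m + 1) rfl (inc g m 0 m _ (augBi ε m x)) =
          inc g (m + 1) 0 (m + 1) _ (augBi ε (m + 1) ((L.cx.d m (m + 1)).hom x))
        rw [totD_inc]
        have h1 : dForm g 0 m (augBi ε m x) = 0 := by
          ext n
          simp [dForm_apply, augBi_apply, PolyForm.d_one]
        have h2 : dLie g 0 m (m + 1) (augBi ε m x) =
            augBi ε (m + 1) ((L.cx.d m (m + 1)).hom x) := by
          ext n
          simp only [dLie_apply, augBi_apply, LinearMap.lTensor_tmul]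
          congr 1
          exact congrArg (fun ψ => ψ.hom x) ((augIter ε n).f.comm m (m + 1))
        rw [h1, h2]
        simp }
  map_br i j k h x y := by
    change inc g k 0 k _ (augBi ε k (L.br i j k h x y)) =
      totBr g i j k h (inc g i 0 i _ (augBi ε i x)) (inc g j 0 j _ (augBi ε j y))
    rw [totBr_inc i j k h 0 0 0 rfl i j k h]
    congr 1
    ext n
    simp [brBi_apply, augBi_apply, (augIter ε n).map_br i j k h]

end augmentation

end ThomWhitney

/-! ### Sheaves of DGLAs -/

/-- The degree `k` component of a DGLA, as a functor. -/
def DGLA.degree (K : Type u) [Field K] (k : ℤ) : DGLA K ⥤ ModuleCat.{u} K :=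
  DGLA.forgetBracket K ⋙ HomologicalComplex.eval _ _ k

/-- A sheaf of DGLAs on `X`: a presheaf of DGLAs each of whose graded components is a sheaf. -/
structure DGLASheaf (K : Type u) [Field K] (X : TopCat.{u}) where
  presheaf : (Opens X)ᵒᵖ ⥤ DGLA K
  isSheaf (k : ℤ) :
    Presheaf.IsSheaf (Opens.grothendieckTopology X) (presheaf ⋙ DGLA.degree K k)

namespace DGLASheaf

variable {K : Type u} [Field K] {X : TopCat.{u}}

/-- The DGLA `L(V)` of sections over `V`. -/
abbrev sections (L : DGLASheaf K X) (V : Opens X) : DGLA K := L.presheaf.obj (op V)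

/-- A morphism of sheaves of DGLAs is a morphism of the underlying presheaves. -/
abbrev Hom (L M : DGLASheaf K X) := L.presheaf ⟶ M.presheaf

/-- The sheaf `L^k` of `K`-vector spaces. -/
def degree (L : DGLASheaf K X) (k : ℤ) :
    Sheaf (Opens.grothendieckTopology X) (ModuleCat.{u} K) :=
  ⟨L.presheaf ⋙ DGLA.degree K k, L.isSheaf k⟩

/-- The complex of sheaves of `K`-vector spaces underlying a sheaf of DGLAs. -/
def complex (L : DGLASheaf K X) :
    CochainComplex (Sheaf (Opens.grothendieckTopology X) (ModuleCat.{u} K)) ℤ where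
  X k := L.degree k
  d i j := ⟨{ app := fun V => (L.presheaf.obj V).cx.d i j
              naturality := fun _ _ f => (L.presheaf.map f).f.comm i j }⟩
  shape i j h := by
    ext V : 3
    exact (L.presheaf.obj V).cx.shape i j h
  d_comp_d' i j k _ _ := by
    ext V : 3
    exact (L.presheaf.obj V).cx.d_comp_d i j k

/-- The morphism of complexes of sheaves underlying a morphism of sheaves of DGLAs. -/
def complexMap {L M : DGLASheaf K X} (φ : L.Hom M) : L.complex ⟶ M.complex where
  f k := ⟨Functor.whiskerRight φ (DGLA.degree K k)⟩
  comm' i j _ := by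
    ext V : 3
    exact (φ.app V).f.comm i j

/-- A morphism of sheaves of DGLAs is a quasi-isomorphism if it induces isomorphisms between
the cohomology sheaves. -/
def IsQuasiIso {L M : DGLASheaf K X} (φ : L.Hom M) : Prop := QuasiIso (complexMap φ)

/-- `H^p(V; L^k) = 0` for all `p > 0` and all `k`. -/
def AcyclicOn (L : DGLASheaf K X) (V : Opens X) : Prop :=
  ∀ (k : ℤ) (p : ℕ), 0 < p →
    Subsingleton (Sheaf.H' ((sheafCompose (Opens.grothendieckTopology X)
      (forget₂ (ModuleCat.{u} K) AddCommGrpCat.{u})).obj (L.degree k)) p V)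

/-- A morphism `φ : L → A` is an acyclic resolution if it is a quasi-isomorphism and each sheaf
`A^k` is acyclic. -/
structure IsAcyclicResolution {L A : DGLASheaf K X} (φ : L.Hom A) : Prop where
  isQuasiIso : IsQuasiIso φ
  acyclic : A.AcyclicOn ⊤

/-- `L^k = 0` for all sufficiently negative `k`. -/
def BoundedBelow (L : DGLASheaf K X) : Prop :=
  ∃ N : ℤ, ∀ k < N, ∀ V : Opens X, Subsingleton ((L.sections V).cx.X k)

variable {I : Type u} [LinearOrder I] (U : I → Opens X)

/-- The intersection `U_{i_0} ∩ ⋯ ∩ U_{i_n}`, for `i_0 < ⋯ < i_n`. -/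
def inter {n : ℕ} (α : Fin (n + 1) ↪o I) : Opens X := ⨅ a, U (α a)

theorem inter_le {n : ℕ} (α : Fin (n + 2) ↪o I) (k : Fin (n + 2)) :
    inter U α ≤ inter U ((Fin.succAboveOrderEmb k).trans α) :=
  le_iInf fun a => iInf_le (fun a => U (α a)) (k.succAbove a)

/-- A family of opens is acyclic with respect to `L` if `H^p(U_{i_0} ∩ ⋯ ∩ U_{i_n}; L^k) = 0`
for all `p > 0`, all `k` and all nonempty finite intersections. -/
def AcyclicCover (L : DGLASheaf K X) : Prop :=
  ∀ (n : ℕ) (α : Fin (n + 1) ↪o I), L.AcyclicOn (inter U α)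

theorem piProj_map_congr (L : DGLASheaf K X) {n : ℕ} {β β' : Fin (n + 1) ↪o I} (h : β = β')
    {V : Opens X} (hβ : V ≤ inter U β) (hβ' : V ≤ inter U β') :
    DGLA.piProj (fun α : Fin (n + 1) ↪o I => L.sections (inter U α)) β ≫
        L.presheaf.map (homOfLE hβ).op =
      DGLA.piProj (fun α : Fin (n + 1) ↪o I => L.sections (inter U α)) β' ≫
        L.presheaf.map (homOfLE hβ').op := by
  subst h
  rfl

/-- The coface maps of the Čech semicosimplicial DGLA:
`(∂_k s)_{i_0 ⋯ i_{n+1}}` is the restriction of the component of `s` with `i_k` omitted. -/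
def cechFace (L : DGLASheaf K X) (n : ℕ) (k : Fin (n + 2)) :
    DGLA.pi (fun α : Fin (n + 1) ↪o I => L.sections (inter U α)) ⟶
      DGLA.pi (fun α : Fin (n + 2) ↪o I => L.sections (inter U α)) :=
  DGLA.toPi fun α => DGLA.piProj _ ((Fin.succAboveOrderEmb k).trans α) ≫
    L.presheaf.map (homOfLE (inter_le U α k)).op

theorem cechFace_proj (L : DGLASheaf K X) (n : ℕ) (k : Fin (n + 2)) (α : Fin (n + 2) ↪o I) :
    cechFace U L n k ≫ DGLA.piProj _ α =
      DGLA.piProj _ ((Fin.succAboveOrderEmb k).trans α) ≫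
        L.presheaf.map (homOfLE (inter_le U α k)).op := rfl

theorem cechFace_cechFace_proj (L : DGLASheaf K X) (n : ℕ) (l : Fin (n + 2)) (k : Fin (n + 3))
    (α : Fin (n + 3) ↪o I) :
    (cechFace U L n l ≫ cechFace U L (n + 1) k) ≫ DGLA.piProj _ α =
      DGLA.piProj _ ((Fin.succAboveOrderEmb l).trans ((Fin.succAboveOrderEmb k).trans α)) ≫
        L.presheaf.map (homOfLE ((inter_le U α k).trans (inter_le U _ l))).op := by
  rw [Category.assoc, cechFace_proj, ← Category.assoc, cechFace_proj, Category.assoc,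
    ← Functor.map_comp]
  rfl

/-- The Čech semicosimplicial DGLA `L(U)`, with `∏_{i_0 < ⋯ < i_n} L(U_{i_0} ∩ ⋯ ∩ U_{i_n})` in
cosimplicial degree `n`. -/
def cech (L : DGLASheaf K X) : SemicosimplicialDGLA K where
  obj n := DGLA.pi fun α : Fin (n + 1) ↪o I => L.sections (inter U α)
  face n k := cechFace U L n k
  face_face n l k h := by
    refine DGLA.pi_hom_ext fun α => ?_
    rw [cechFace_cechFace_proj, cechFace_cechFace_proj]
    apply piProj_map_congr
    ext i
    simp only [RelEmbedding.coe_trans, Function.comp_apply, Fin.succAboveOrderEmb_apply]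
    congr 1
    simp only [Fin.ext_iff, Fin.succAbove, Fin.lt_def, Fin.le_def] at h ⊢
    grind

/-- The morphism of Čech semicosimplicial DGLAs induced by a morphism of sheaves. -/
def cechMap {L M : DGLASheaf K X} (φ : L.Hom M) : (cech U L).Hom (cech U M) where
  app n := DGLA.toPi fun α => DGLA.piProj _ α ≫ φ.app _
  face_app n k := by
    refine DGLA.pi_hom_ext fun α => ?_
    exact congrArg (fun ψ => DGLA.piProj (fun α : Fin (n + 1) ↪o I => L.sections (inter U α))
      ((Fin.succAboveOrderEmb k).trans α) ≫ ψ) (φ.naturality (homOfLE (inter_le U α k)).op)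

/-- The augmentation `L(X) → ∏_i L(U_i)` given by restriction. -/
def cechAugmentation (L : DGLASheaf K X) : (cech U L).Augmentation (L.sections ⊤) where
  hom := DGLA.toPi fun α => L.presheaf.map (homOfLE le_top).op
  hom_face := by
    refine DGLA.pi_hom_ext fun α => ?_
    change L.presheaf.map _ ≫ L.presheaf.map _ = L.presheaf.map _ ≫ L.presheaf.map _
    rw [← Functor.map_comp, ← Functor.map_comp]
    rfl

/-- The Thom–Whitney DGLA `Tot_TW(L(U))`. -/
def totTW (L : DGLASheaf K X) : DGLA K := ThomWhitney.tot (cech U L)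

/-- The morphism `Tot_TW(L(U)) → Tot_TW(M(U))` induced by a morphism `L → M`. -/
def totTWMap {L M : DGLASheaf K X} (φ : L.Hom M) : totTW U L ⟶ totTW U M :=
  ThomWhitney.totMap (cechMap U φ)

/-- The natural morphism `L(X) → Tot_TW(L(U))`. -/
def toTotTW (L : DGLASheaf K X) : L.sections ⊤ ⟶ totTW U L :=
  ThomWhitney.augmentation (cechAugmentation U L)

end DGLASheaf

end

noncomputable section

/-! ### Vanishing of forms above the dimension -/

namespace PolyForm

variable {K : Type u} [Field K] {n : ℕ}

/-! The Thom–Whitney bicomplex has a form degree and a Lie degree, and each of the two arrows is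
handled by fixing one degree and using exactness in the other.

For the arrow induced by `φ`, fix the form degree. Forms prescribed compatibly on the faces of a
simplex extend to the simplex (`exists_faceT_eq`), so Thom–Whitney cochains of a given form degree
depend exactly on the semicosimplicial vector space (`IsTW.exists_lift`). Exactness of the cone of
`φ` in every cosimplicial degree is therefore inherited by the columns. Clearing the components of a
cone cocycle in increasing form degree stops after finitely many steps because the coefficients are
bounded below (`totMap_isQuasiIso`). The levelwise input is that the mapping cone of `φ` is a
bounded below acyclic complex of sheaves acyclic on each finite intersection, and such a complex has
exact sections (`exists_of_quasiIso`).

For the arrow from global sections, fix the Lie degree. The Poincaré lemma on simplices, absolute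
and relative to the boundary, together with Stokes' theorem, shows that closed Thom–Whitney cochains
have primitives wherever the Čech cohomology vanishes (`IsTW.exists_primitive`), and that closed
cochains of form degree zero are constant (`IsTW.exists_eq_one_tmul`), hence glue to global
sections. An element of the direct sum has finitely many form degrees, so clearing from the top down
terminates (`exists_of_vanishesAbove`). The vanishing of Čech cohomology is Leray's theorem
(`cechExact_of_isAcyclicOn`): dimension shifting along embeddings into injectives, where an
injective sheaf is a direct summand of a sheaf of discontinuous sections, whose Čech complex is
contracted pointwise.

Characteristic zero enters through the Poincaré lemma: a primitive is the contraction with the Euler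
field divided by a positive integer, the weight of the form. -/

theorem span_dt_insert_commute (a : Fin (n + 1)) (s : Set (Fin (n + 1))) :
    Commute (Submodule.span K {(dt a : PolyForm K n)}) (Submodule.span K (dt '' s)) := by
  have key : ∀ S T : Set (PolyForm K n), (∀ x ∈ S, ∀ y ∈ T, x * y = -(y * x)) →
      Submodule.span K S * Submodule.span K T ≤ Submodule.span K T * Submodule.span K S := by
    intro S T h
    rw [Submodule.span_mul_span, Submodule.span_le]
    rintro _ ⟨x, hx, y, hy, rfl⟩
    change x * y ∈ _
    rw [h x hx y hy]
    exact neg_mem (Submodule.mul_mem_mul (Submodule.subset_span hy) (Submodule.subset_span hx))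
  refine le_antisymm (key _ _ ?_) (key _ _ ?_)
  · rintro _ rfl _ ⟨j, _, rfl⟩
    exact dt_mul_dt a j
  · rintro _ ⟨j, _, rfl⟩ _ rfl
    exact dt_mul_dt j a

/-- The `dt a` anticommute, but the subspaces they span commute, so the binomial formula applies to
the line of `dt a` plus the span of the rest. Each term contains either the square of the line,
which is zero, or a power of the rest that is zero by induction. -/
theorem span_dt_pow_card (s : Finset (Fin (n + 1))) :
    Submodule.span K ((dt : _ → PolyForm K n) '' (s : Set (Fin (n + 1)))) ^ (s.card + 1) = 0 := by
  induction s using Finset.induction_on with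
  | empty => simp
  | insert a s ha ih =>
    rw [Finset.coe_insert, Set.image_insert_eq, Submodule.span_insert, Finset.card_insert_of_notMem ha,
      ← Submodule.add_eq_sup, (span_dt_insert_commute a _).add_pow]
    refine Finset.sum_eq_zero fun m hm => ?_
    have h2 : Submodule.span K {(dt a : PolyForm K n)} ^ 2 = 0 := by
      rw [pow_two, Submodule.span_mul_span]
      simp [dt_mul_self]
    rcases Nat.lt_or_ge m 2 with h | h
    · rw [show s.card + 1 + 1 - m = (s.card + 1) + (1 - m) by lia, pow_add _ (s.card + 1), ih]
      simp
    · rw [show m = 2 + (m - 2) by lia, pow_add, h2]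
      simp

/-- Since the `dt i` sum to zero, `dt 0` is redundant and only `n` generating 1-forms remain. -/
theorem forms_eq_bot {i : ℕ} (h : n < i) : forms K n i = ⊥ := by
  have h1 : Submodule.span K (Set.range (dt (K := K) (n := n))) ≤
      Submodule.span K (dt '' ((Finset.univ.erase (0 : Fin (n + 1)) : Finset _) : Set _)) := by
    rw [Submodule.span_le]
    rintro _ ⟨j, rfl⟩
    by_cases hj : j = 0
    · subst hj
      have h0 := sum_dt (K := K) (n := n)
      rw [← Finset.add_sum_erase _ _ (Finset.mem_univ (0 : Fin (n + 1)))] at h0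
      rw [eq_neg_of_add_eq_zero_left h0]
      exact neg_mem (sum_mem fun i hi => Submodule.subset_span ⟨i, hi, rfl⟩)
    · exact Submodule.subset_span ⟨j, by simpa using hj, rfl⟩
  have h2 := span_dt_pow_card (K := K) (Finset.univ.erase (0 : Fin (n + 1)))
  simp only [Finset.mem_univ, Finset.card_erase_of_mem, Finset.card_univ, Fintype.card_fin,
    Nat.add_sub_cancel] at h2
  have h3 : Submodule.span K (Set.range (dt (K := K) (n := n))) ^ i = ⊥ := by
    rw [eq_bot_iff]
    refine (pow_le_pow_left' h1 i).trans ?_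
    rw [show i = n + 1 + (i - (n + 1)) by lia, pow_add, h2]
    simp
  rw [forms, h3, Submodule.mul_bot]

theorem eq_zero_of_mem_forms {i : ℕ} (h : n < i) {x : PolyForm K n} (hx : x ∈ forms K n i) :
    x = 0 := by
  rwa [forms_eq_bot h, Submodule.mem_bot] at hx

theorem mem_forms_zero {x : PolyForm K n} : x ∈ forms K n 0 ↔ x ∈ functions K n := by
  rw [forms, pow_zero, mul_one]

theorem t_mem_forms (i : Fin (n + 1)) : (t i : PolyForm K n) ∈ forms K n 0 :=
  mem_forms_zero.2 (Algebra.subset_adjoin ⟨i, rfl⟩)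

theorem algebraMap_mem_forms (r : K) : algebraMap K (PolyForm K n) r ∈ forms K n 0 :=
  mem_forms_zero.2 (Subalgebra.algebraMap_mem _ r)

/-! ### The Poincaré lemma -/

variable (K) in
/-- The barycentric coordinates of the vertex `0`. -/
def originCoord (i : Fin (n + 1)) : K := if i = 0 then 1 else 0

theorem originCoord_of_ne {i : Fin (n + 1)} (h : i ≠ 0) : originCoord K i = 0 := if_neg h

theorem sum_originCoord : ∑ i : Fin (n + 1), originCoord K i = 1 := by
  simp [originCoord]

/-- The algebra map `x ↦ !![σ x, ι x; 0, x]`, where `σ` is the sign involution and `ι` the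
contraction with the Euler vector field based at the vertex `0`. -/
def contractionHom : PolyForm K n →ₐ[K] Matrix (Fin 2) (Fin 2) (PolyForm K n) :=
  lift (fun i => !![t i, 0; 0, t i])
    (fun i => !![-dt i, t i - algebraMap K _ (originCoord K i); 0, dt i])
    (fun i j => by simp [t_mul_t i j])
    (fun i j => by
      simp [t_mul_dt i j, mul_sub, sub_mul, t_mul_t i j, ← Algebra.commutes (originCoord K j) (t i : PolyForm K n)])
    (fun i j => by
      simp only [Matrix.mul_fin_two]
      ext a b; fin_cases a <;> fin_cases b <;>
        simp [mul_sub, sub_mul, t_mul_dt, dt_mul_dt j i,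
          ← Algebra.commutes (originCoord K j) (dt i : PolyForm K n),
          ← Algebra.commutes (originCoord K i) (dt j : PolyForm K n)]; abel)
    (fun i => by
      ext a b; fin_cases a <;> fin_cases b <;>
        simp [dt_mul_self i, mul_sub, sub_mul, t_mul_dt,
          ← Algebra.commutes (originCoord K i) (dt i : PolyForm K n)])
    (by
      ext a b; fin_cases a <;> fin_cases b <;> simp [Matrix.sum_apply, sum_t])
    (by
      ext a b; fin_cases a <;> fin_cases b <;>
        simp [Matrix.sum_apply, sum_dt, sum_t, ← map_sum, sum_originCoord])

/-- The contraction of forms with the Euler vector field based at the vertex `0`. -/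
def contraction : PolyForm K n →ₗ[K] PolyForm K n where
  toFun x := contractionHom x 0 1
  map_add' x y := by simp
  map_smul' r x := by simp

theorem contractionHom_apply (x : PolyForm K n) :
    contractionHom x = !![sgn x, contraction x; 0, x] := by
  suffices h : contractionHom x 1 0 = 0 ∧ contractionHom x 1 1 = x ∧ contractionHom x 0 0 = sgn x by
    ext a b; fin_cases a <;> fin_cases b <;> simp [h, contraction]
  induction x using induction with
  | hK r => simp [Matrix.algebraMap_matrix_apply]
  | ht i => simp [contractionHom, lift_t]
  | hdt i => simp [contractionHom, lift_dt]
  | hmul x y hx hy => simp [Matrix.mul_apply, Fin.sum_univ_two, hx, hy, sgn_mul]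
  | hadd x y hx hy => simp [hx, hy]

@[simp] theorem contraction_t (i : Fin (n + 1)) : contraction (t i : PolyForm K n) = 0 := by
  simp [contraction, contractionHom, lift_t]

@[simp] theorem contraction_dt (i : Fin (n + 1)) :
    contraction (dt i : PolyForm K n) = t i - algebraMap K _ (originCoord K i) := by
  simp [contraction, contractionHom, lift_dt]

@[simp] theorem contraction_algebraMap (r : K) :
    contraction (algebraMap K (PolyForm K n) r) = 0 := by
  simp [contraction, Matrix.algebraMap_matrix_apply]

theorem contraction_mul (x y : PolyForm K n) :
    contraction (x * y) = contraction x * y + sgn x * contraction y := by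
  have h := congrFun (congrFun (map_mul contractionHom x y) 0) 1
  simpa [contractionHom_apply, Matrix.mul_fin_two, add_comm] using h

theorem sgn_sgn (x : PolyForm K n) : sgn (sgn x) = x := by
  induction x using induction with
  | hK r => simp
  | ht i => simp
  | hdt i => simp
  | hmul x y hx hy => simp [sgn_mul, hx, hy]
  | hadd x y hx hy => simp [hx, hy]

theorem sgn_contraction (x : PolyForm K n) : sgn (contraction x) = -contraction (sgn x) := by
  induction x using induction with
  | hK r => simp
  | ht i => simp
  | hdt i => simp
  | hmul x y hx hy => simp only [contraction_mul, sgn_mul, map_add, hx, hy]; noncomm_ring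
  | hadd x y hx hy => simp only [map_add, hx, hy]; abel

variable (K n) in
/-- The Lie derivative `d ι + ι d` along the Euler vector field. -/
def lieDeriv : Module.End K (PolyForm K n) := d ∘ₗ contraction + contraction ∘ₗ d

theorem lieDeriv_apply (x : PolyForm K n) :
    lieDeriv K n x = d (contraction x) + contraction (d x) := rfl

/-- The anticommutator of two odd derivations is an even derivation: the mixed terms cancel because
`sgn` anticommutes with both `d` and `contraction`. Hence eigenvalues add under multiplication. -/
theorem lieDeriv_mul (x y : PolyForm K n) :
    lieDeriv K n (x * y) = lieDeriv K n x * y + x * lieDeriv K n y := by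
  simp only [lieDeriv_apply, contraction_mul, d_mul, map_add, sgn_contraction, sgn_d, sgn_sgn]
  noncomm_ring

theorem lieDeriv_d (x : PolyForm K n) : lieDeriv K n (d x) = d (lieDeriv K n x) := by
  simp [lieDeriv_apply, d_d]

theorem mul_mem_eigenspace {a b c : K} (h : a + b = c) {x y : PolyForm K n}
    (hx : x ∈ (lieDeriv K n).eigenspace a) (hy : y ∈ (lieDeriv K n).eigenspace b) :
    x * y ∈ (lieDeriv K n).eigenspace c := by
  rw [Module.End.mem_eigenspace_iff] at *
  rw [lieDeriv_mul, hx, hy, ← h, add_smul, smul_mul_assoc, mul_smul_comm]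

theorem span_dt_pow_le_eigenspace (i : ℕ) :
    Submodule.span K (Set.range (dt (K := K) (n := n))) ^ i ≤ (lieDeriv K n).eigenspace (i : K) := by
  induction i with
  | zero =>
    rw [pow_zero, Submodule.one_le, Module.End.mem_eigenspace_iff]
    rw [← map_one (algebraMap K (PolyForm K n))]
    simp [lieDeriv_apply, - map_one]
  | succ i ih =>
    rw [pow_succ, Submodule.mul_le]
    intro x hx y hy
    refine mul_mem_eigenspace (by push_cast; rfl) (ih hx) ?_
    rw [← SetLike.mem_coe]
    refine Submodule.span_le.2 ?_ hy
    rintro _ ⟨j, rfl⟩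
    simp [lieDeriv_apply]

/-- In the coordinates `t j` with `j ≠ 0` the Lie derivative is the Euler operator, which multiplies
a homogeneous polynomial by its degree. Constants are split off so that the remaining eigenvalues `m
+ 1` are nonzero in characteristic zero; the Poincaré lemma in degree zero rests on this. -/
theorem functions_le_iSup : functions K n ≤
    1 ⊔ ⨆ m : ℕ, functions K n ⊓ (lieDeriv K n).eigenspace ((m : K) + 1) := by
  intro f hf
  have ht : ∀ j : Fin (n + 1), j ≠ 0 → (t j : PolyForm K n) ∈
      ⨆ m : ℕ, functions K n ⊓ (lieDeriv K n).eigenspace ((m : K) + 1) := fun j hj =>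
    Submodule.mem_iSup_of_mem 0 ⟨Algebra.subset_adjoin ⟨j, rfl⟩, by
      simp [lieDeriv_apply, originCoord_of_ne hj]⟩
  induction hf using Algebra.adjoin_induction with
  | mem f hf =>
    obtain ⟨j, rfl⟩ := hf
    by_cases hj : j = 0
    · subst hj
      have h0 := sum_t (K := K) (n := n)
      rw [← Finset.add_sum_erase _ _ (Finset.mem_univ (0 : Fin (n + 1)))] at h0
      rw [eq_sub_of_add_eq h0]
      refine sub_mem (Submodule.mem_sup_left (Submodule.one_le.1 le_rfl)) (Submodule.mem_sup_right ?_)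
      exact sum_mem fun i hi => ht i (by simpa using hi)
    · exact Submodule.mem_sup_right (ht j hj)
  | algebraMap r => exact Submodule.mem_sup_left (Submodule.algebraMap_mem r)
  | add f g _ _ hf hg => exact add_mem hf hg
  | mul f g _ _ hf hg =>
    refine Set.mem_of_subset_of_mem ?_ (Submodule.mul_mem_mul hf hg)
    rw [SetLike.coe_subset_coe]
    simp only [Submodule.sup_mul, Submodule.mul_sup, one_mul, mul_one, Submodule.mul_iSup,
      Submodule.iSup_mul]
    refine sup_le le_rfl (iSup_le fun m => sup_le ?_ (iSup_le fun m' => ?_))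
    · exact le_sup_of_le_right (le_iSup_of_le m le_rfl)
    -- The index is the eigenvalue minus one: `(m + 1) + (m' + 1) = (m + m' + 1) + 1`.
    refine le_sup_of_le_right (le_iSup_of_le (m + m' + 1) ?_)
    rw [Submodule.mul_le]
    rintro x ⟨hx, hx'⟩ y ⟨hy, hy'⟩
    exact ⟨(Algebra.adjoin K (Set.range t)).mul_mem hx hy,
      mul_mem_eigenspace (by push_cast; ring) hx' hy'⟩

theorem span_dt_pow_le_forms (i : ℕ) :
    Submodule.span K (Set.range (dt (K := K) (n := n))) ^ i ≤ forms K n i := fun w hw => by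
  have : (1 : PolyForm K n) ∈ functions K n := one_mem (Algebra.adjoin K _)
  simpa [forms] using Submodule.mul_mem_mul this hw

theorem forms_le_iSup (i : ℕ) : forms K n i ≤
    ⨆ m : ℕ, forms K n i ⊓ (lieDeriv K n).eigenspace ((m : K) + i) := by
  have h1 : functions K n ≤ ⨆ m : ℕ, functions K n ⊓ (lieDeriv K n).eigenspace (m : K) := by
    refine functions_le_iSup.trans (sup_le (le_iSup_of_le 0 (le_inf ?_ ?_))
      (iSup_le fun m => le_iSup_of_le (m + 1) (by push_cast; rfl)))
    · exact Submodule.one_le.2 (one_mem (Algebra.adjoin K _))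
    · simpa using span_dt_pow_le_eigenspace (K := K) (n := n) 0
  conv_lhs => rw [forms]
  refine (mul_le_mul_left h1 _).trans ?_
  rw [Submodule.iSup_mul]
  refine iSup_mono fun m => Submodule.mul_le.2 ?_
  rintro x ⟨hx, hx'⟩ y hy
  exact ⟨Submodule.mul_mem_mul hx hy, mul_mem_eigenspace rfl hx' (span_dt_pow_le_eigenspace i hy)⟩

theorem contraction_of_mem_functions {f : PolyForm K n} (hf : f ∈ functions K n) :
    contraction f = 0 := by
  induction hf using Algebra.adjoin_induction with
  | mem f hf => obtain ⟨j, rfl⟩ := hf; simp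
  | algebraMap r => simp
  | add f g _ _ hf hg => simp [hf, hg]
  | mul f g _ _ hf hg => simp [contraction_mul, hf, hg]

theorem contraction_mem_forms {i : ℕ} {x : PolyForm K n} (hx : x ∈ forms K n (i + 1)) :
    contraction x ∈ forms K n i := by
  have key : ∀ (i : ℕ) (w : PolyForm K n),
      w ∈ Submodule.span K (Set.range (dt (K := K) (n := n))) ^ (i + 1) →
      contraction w ∈ forms K n i := by
    have base : ∀ w : PolyForm K n, w ∈ Submodule.span K (Set.range (dt (K := K) (n := n))) →
        contraction w ∈ forms K n 0 := by
      intro w hw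
      induction hw using Submodule.span_induction with
      | mem x h =>
        obtain ⟨j, rfl⟩ := h
        rw [contraction_dt]
        exact sub_mem (t_mem_forms j) (algebraMap_mem_forms _)
      | zero => simp
      | add x y _ _ hx hy => simpa using add_mem hx hy
      | smul r x _ hx => simpa using Submodule.smul_mem _ r hx
    intro i
    induction i with
    | zero => simpa using base
    | succ i ih =>
      intro w hw
      rw [pow_succ'] at hw
      induction hw using Submodule.mul_induction_on' with
      | mem_mul_mem a ha b hb =>
        rw [contraction_mul]
        refine add_mem (mul_mem_forms (by lia) (base a ha) (span_dt_pow_le_forms _ hb)) ?_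
        have ha' : a ∈ forms K n 1 := span_dt_pow_le_forms 1 (by simpa using ha)
        rw [sgn_of_mem_forms ha', smul_mul_assoc]
        exact Submodule.smul_mem _ _ (mul_mem_forms (by lia) ha' (ih b hb))
      | add x _ y _ hx hy => simpa using add_mem hx hy
  induction hx using Submodule.mul_induction_on' with
  | mem_mul_mem f hf w hw =>
    rw [contraction_mul, contraction_of_mem_functions hf, sgn_of_mem_functions hf, zero_mul, zero_add]
    exact mul_mem_forms (zero_add i) (mem_forms_zero.2 hf) (key i w hw)
  | add x _ y _ hx hy => simpa using add_mem hx hy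

end PolyForm

end

/-! ### Primitives of closed forms, and extension of forms from the faces. -/

noncomputable section

namespace PolyForm

variable {K : Type u} [Field K] {n : ℕ}

/-- The Lie derivative commutes with `d`, and eigenspaces of distinct eigenvalues are independent,
so every eigencomponent of a closed form is closed. On a closed form the Lie derivative reduces to
`d ∘ contraction`; thus the contraction of a component is a primitive of it up to the eigenvalue. -/
theorem exists_eigenvector_decomposition [CharZero K] {S : Submodule K (PolyForm K n)} (c : ℕ)
    {x : PolyForm K n} (hx : x ∈ ⨆ m : ℕ, S ⊓ (lieDeriv K n).eigenspace ((m : K) + c))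
    (hd : d x = 0) : ∃ f : ℕ →₀ PolyForm K n, (∀ m, f m ∈ S) ∧ (f.sum fun _ y => y) = x ∧
      ∀ m, d (f m) = 0 ∧ d (contraction (f m)) = ((m : K) + c) • f m := by
  obtain ⟨f, hf, hfx⟩ := (Submodule.mem_iSup_iff_exists_finsupp _ _).1 hx
  have hE : ∀ m, lieDeriv K n (f m) = ((m : K) + c) • f m := fun m =>
    Module.End.mem_eigenspace_iff.1 (hf m).2
  have hinj : Function.Injective fun m : ℕ => (m : K) + c := fun a b h => by simpa using h
  have hind := ((lieDeriv K n).eigenspaces_iSupIndep).comp hinj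
  rw [iSupIndep_iff_finsetSum_eq_zero_imp_eq_zero] at hind
  have h0 : ∀ m, d (f m) = 0 := by
    intro m
    by_cases hm : m ∈ f.support
    · refine hind f.support (fun m => d (f m)) (fun m _ => ?_) ?_ m hm
      · simp only [Function.comp_apply, Module.End.mem_eigenspace_iff]
        rw [lieDeriv_d, hE, map_smul]
      · rw [← map_sum, ← hd, ← hfx]; rfl
    · rw [Finsupp.notMem_support_iff.1 hm, map_zero]
  refine ⟨f, fun m => (hf m).1, hfx, fun m => ⟨h0 m, ?_⟩⟩
  rw [← hE, lieDeriv_apply, h0, map_zero, add_zero]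

/-- The Poincaré lemma in positive degrees. -/
theorem exists_primitive [CharZero K] {i : ℕ} {x : PolyForm K n} (hx : x ∈ forms K n (i + 1))
    (hd : d x = 0) : ∃ y ∈ forms K n i, d y = x := by
  obtain ⟨f, hf, rfl, hf'⟩ := exists_eigenvector_decomposition (i + 1) (forms_le_iSup (i + 1) hx) hd
  refine ⟨f.sum fun m y => ((m : K) + (i + 1 : ℕ))⁻¹ • contraction y,
    sum_mem fun m _ => Submodule.smul_mem _ _ (contraction_mem_forms (hf m)), ?_⟩
  rw [Finsupp.sum, map_sum]
  refine Finset.sum_congr rfl fun m _ => ?_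
  have : (m : K) + (i + 1 : ℕ) ≠ 0 := by norm_cast
  rw [map_smul, (hf' m).2, smul_smul, inv_mul_cancel₀ this, one_smul]

/-- The Poincaré lemma in degree zero. -/
theorem exists_eq_algebraMap [CharZero K] {x : PolyForm K n} (hx : x ∈ forms K n 0)
    (hd : d x = 0) : ∃ r : K, x = algebraMap K _ r := by
  obtain ⟨c, hc, y, hy, rfl⟩ := Submodule.mem_sup.1 (functions_le_iSup (mem_forms_zero.1 hx))
  obtain ⟨r, rfl⟩ := Submodule.mem_one.1 hc
  rw [map_add, d_algebraMap, zero_add] at hd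
  obtain ⟨f, hf, rfl, hf'⟩ := exists_eigenvector_decomposition 1 (by simpa using hy) hd
  refine ⟨r, ?_⟩
  rw [add_eq_left]
  -- Functions have zero contraction, so each component is annihilated by its nonzero eigenvalue `m
  -- + 1`.
  refine Finset.sum_eq_zero fun m _ => ?_
  have h := (hf' m).2
  rw [contraction_of_mem_functions (hf m), map_zero] at h
  have : (m : K) + (1 : ℕ) ≠ 0 := by norm_cast
  exact (smul_eq_zero.1 h.symm).resolve_left this

/-! ### Pullback along simplicial maps -/

/-- The pullback of forms along the affine map of simplices given by a map of vertices. -/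
def pull {m : ℕ} (f : Fin (m + 1) → Fin (n + 1)) : PolyForm K n →ₐ[K] PolyForm K m :=
  lift (fun i => ∑ a, if f a = i then t a else 0) (fun i => ∑ a, if f a = i then dt a else 0)
    (fun i j => by
      have : ∀ a, Commute (if f a = i then (t a : PolyForm K m) else 0)
          (∑ b, if f b = j then t b else 0) := fun a =>
        Commute.sum_right _ _ _ fun b _ => by
          split_ifs <;> first | exact t_mul_t a b | exact Commute.zero_left _ | exact Commute.zero_right _
      exact Commute.sum_left _ _ _ fun a _ => this a)
    (fun i j => by
      have : ∀ a, Commute (if f a = i then (t a : PolyForm K m) else 0)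
          (∑ b, if f b = j then dt b else 0) := fun a =>
        Commute.sum_right _ _ _ fun b _ => by
          split_ifs <;> first | exact t_mul_dt a b | exact Commute.zero_left _ | exact Commute.zero_right _
      exact Commute.sum_left _ _ _ fun a _ => this a)
    (fun i j => by
      rw [Finset.sum_mul_sum, Finset.sum_mul_sum, Finset.sum_comm, ← Finset.sum_neg_distrib]
      refine Finset.sum_congr rfl fun a _ => ?_
      rw [← Finset.sum_neg_distrib]
      refine Finset.sum_congr rfl fun b _ => ?_
      split_ifs <;> simp [dt_mul_dt b a])
    (fun i => by
      -- A vertex form pulls back to the sum of the `dt a` over a fibre; a sum of anticommuting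
      -- square-zero elements again has square zero.
      have h2 : ∀ s : Finset (Fin (m + 1)),
          (∑ a ∈ s, (dt a : PolyForm K m)) * ∑ a ∈ s, dt a = 0 := by
        intro s
        induction s using Finset.induction_on with
        | empty => simp
        | insert a s ha ih =>
          rw [Finset.sum_insert ha, add_mul, mul_add, mul_add, dt_mul_self, ih, Finset.mul_sum,
            Finset.sum_mul, zero_add, add_zero, ← Finset.sum_add_distrib]
          exact Finset.sum_eq_zero fun b _ => by rw [dt_mul_dt a b, neg_add_cancel]
      rw [← Finset.sum_filter]
      exact h2 _)
    (by rw [Finset.sum_comm]; simp [sum_t])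
    (by rw [Finset.sum_comm]; simp [sum_dt])

theorem pull_t {m : ℕ} (f : Fin (m + 1) → Fin (n + 1)) (i : Fin (n + 1)) :
    pull f (t i : PolyForm K n) = ∑ a, if f a = i then t a else 0 := lift_t ..

theorem pull_dt {m : ℕ} (f : Fin (m + 1) → Fin (n + 1)) (i : Fin (n + 1)) :
    pull f (dt i : PolyForm K n) = ∑ a, if f a = i then dt a else 0 := lift_dt ..

theorem pull_pull {m l : ℕ} (f : Fin (m + 1) → Fin (n + 1)) (g : Fin (l + 1) → Fin (m + 1))
    (x : PolyForm K n) : pull g (pull f x) = pull (f ∘ g) x := by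
  induction x using induction with
  | hK r => simp
  | ht i =>
    simp only [pull_t, map_sum, Function.comp_apply, apply_ite (pull g), map_zero]
    simp only [← Finset.sum_filter]
    -- The sums over nested fibres are regrouped by the innermost vertex `a`, which determines the
    -- middle vertex `g a`.
    rw [Finset.sum_comm' (t' := Finset.univ.filter fun a => f (g a) = i) (s' := fun a => {g a})]
    · simp
    · intro x y; simp; grind
  | hdt i =>
    simp only [pull_dt, map_sum, Function.comp_apply, apply_ite (pull g), map_zero]
    simp only [← Finset.sum_filter]
    rw [Finset.sum_comm' (t' := Finset.univ.filter fun a => f (g a) = i) (s' := fun a => {g a})]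
    · simp
    · intro x y; simp; grind
  | hmul x y hx hy => simp [hx, hy]
  | hadd x y hx hy => simp [hx, hy]

theorem pull_id (x : PolyForm K n) : pull id x = x := by
  induction x using induction with
  | hK r => simp
  | ht i => simp [pull_t]
  | hdt i => simp [pull_dt]
  | hmul x y hx hy => simp [hx, hy]
  | hadd x y hx hy => simp [hx, hy]

theorem face_eq_pull (k : Fin (n + 2)) (x : PolyForm K (n + 1)) :
    face k x = pull k.succAbove x := by
  induction x using induction with
  | hK r => simp
  | ht i => induction i using k.succAboveCases <;> simp [pull_t, Fin.succAbove_ne]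
  | hdt i => induction i using k.succAboveCases <;> simp [pull_dt, Fin.succAbove_ne]
  | hmul x y hx hy => simp [hx, hy]
  | hadd x y hx hy => simp [hx, hy]

theorem pull_mem_forms {m : ℕ} (f : Fin (m + 1) → Fin (n + 1)) {i : ℕ} {x : PolyForm K n}
    (hx : x ∈ forms K n i) : pull f x ∈ forms K m i := by
  have h1 : ∀ y ∈ functions K n, pull f y ∈ functions K m := by
    intro y hy
    induction hy using Algebra.adjoin_induction with
    | mem y hy =>
      obtain ⟨j, rfl⟩ := hy
      rw [pull_t]
      refine sum_mem fun a _ => ?_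
      split_ifs
      · exact Algebra.subset_adjoin ⟨a, rfl⟩
      · exact zero_mem _
    | algebraMap r =>
      rw [AlgHom.commutes]
      exact Subalgebra.algebraMap_mem (Algebra.adjoin K (Set.range t)) r
    | add f g _ _ hf hg => simpa using add_mem hf hg
    | mul f g _ _ hf hg =>
      rw [map_mul]
      exact (Algebra.adjoin K (Set.range t)).mul_mem hf hg
  have h2 : (Submodule.span K (Set.range (dt (K := K) (n := n)))).map (pull f).toLinearMap ≤
      Submodule.span K (Set.range (dt (K := K) (n := m))) := by
    rw [Submodule.map_span_le]
    rintro _ ⟨j, rfl⟩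
    change pull f (dt j) ∈ _
    rw [pull_dt]
    refine sum_mem fun a _ => ?_
    split_ifs
    · exact Submodule.subset_span ⟨a, rfl⟩
    · exact zero_mem _
  have h3 : (forms K n i).map (pull f).toLinearMap ≤ forms K m i := by
    rw [forms, forms, Submodule.map_mul, Submodule.map_pow]
    exact mul_le_mul' (Submodule.map_le_iff_le_comap.2 h1) (pow_le_pow_left' h2 i)
  exact h3 (Submodule.mem_map_of_mem hx)

theorem face_mem_forms (k : Fin (n + 2)) {i : ℕ} {x : PolyForm K (n + 1)}
    (hx : x ∈ forms K (n + 1) i) : face k x ∈ forms K n i := by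
  rw [face_eq_pull]
  exact pull_mem_forms _ hx

/-- Evaluation at the vertex `0`, killing every `dt`, maps the algebra of forms to `K`, so this
algebra is nontrivial. -/
theorem algebraMap_injective : Function.Injective (algebraMap K (PolyForm K n)) := by
  have : Nontrivial (PolyForm K n) := by
    refine (lift (K := K) (n := n) (B := K) (fun i => if i = 0 then 1 else 0) (fun _ => 0)
      (fun _ _ => mul_comm _ _) (fun _ _ => mul_comm _ _) (by simp) (by simp) (by simp)
      (by simp)).toRingHom.domain_nontrivial
  exact (algebraMap K (PolyForm K n)).injective

theorem face_face_of_le (l k : Fin (n + 2)) (h : l ≤ k) (x : PolyForm K (n + 2)) :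
    face l (face k.succ x) = face k (face l.castSucc x) := by
  simp only [face_eq_pull, pull_pull]
  congr 2
  funext a
  simp only [Function.comp_apply, Fin.ext_iff, Fin.succAbove, Fin.lt_def, Fin.le_def] at h ⊢
  grind

/-! ### Forms vanishing on faces, and their extension -/

/-- The form `w` vanishes on the faces opposite to the vertices `k < r`. -/
def VanishesBelow (r : ℕ) (w : PolyForm K n) : Prop :=
  ∀ k : Fin (n + 1), (k : ℕ) < r → ∀ (m : ℕ) (f : Fin (m + 1) → Fin (n + 1)),
    (∀ a, f a ≠ k) → pull f w = 0

theorem pull_eq_zero_of_face_eq_zero {m : ℕ} {f : Fin (m + 1) → Fin (n + 2)} {k : Fin (n + 2)}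
    (hf : ∀ a, f a ≠ k) {w : PolyForm K (n + 1)} (h : face k w = 0) : pull f w = 0 := by
  choose g hg using fun a => Fin.exists_succAbove_eq (hf a)
  have : f = k.succAbove ∘ g := funext fun a => (hg a).symm
  rw [this, ← pull_pull, ← face_eq_pull, h, map_zero]

/-- Testing against all vertex maps that miss `k` lets `VanishesBelow` make sense on the 0-simplex
too, where no map misses the vertex and the condition is void. In positive dimension every such map
factors through the face opposite to `k`. -/
theorem vanishesBelow_iff {r : ℕ} {w : PolyForm K (n + 1)} :
    VanishesBelow r w ↔ ∀ k : Fin (n + 2), (k : ℕ) < r → face k w = 0 :=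
  ⟨fun h k hk => by rw [face_eq_pull]; exact h k hk n _ (Fin.succAbove_ne k),
    fun h k hk _ _ hf => pull_eq_zero_of_face_eq_zero hf (h k hk)⟩

theorem VanishesBelow.mono {r s : ℕ} (h : r ≤ s) {w : PolyForm K n} (hw : VanishesBelow s w) :
    VanishesBelow r w := fun k hk => hw k (hk.trans_le h)

theorem vanishesBelow_zero (w : PolyForm K n) : VanishesBelow 0 w := fun _ hk => by simp at hk

theorem VanishesBelow.sub {r : ℕ} {v w : PolyForm K n} (hv : VanishesBelow r v)
    (hw : VanishesBelow r w) : VanishesBelow r (v - w) := fun k hk m f hf => by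
  rw [map_sub, hv k hk m f hf, hw k hk m f hf, sub_zero]

theorem VanishesBelow.d {r : ℕ} {w : PolyForm K n} (hw : VanishesBelow r w) :
    VanishesBelow r (PolyForm.d w) := by
  cases n with
  | zero => exact fun k _ _ f hf => absurd (Subsingleton.elim (α := Fin 1) (f 0) k) (hf 0)
  | succ n =>
    rw [vanishesBelow_iff] at hw ⊢
    exact fun k hk => by rw [face_d, hw k hk, map_zero]

/-- `k.succAbove` fixes every vertex `l < r ≤ k`, so a vertex map missing `l` still misses `l` after
composition with it. -/
theorem VanishesBelow.face {r : ℕ} {w : PolyForm K (n + 1)} (hw : VanishesBelow r w)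
    (k : Fin (n + 2)) (hk : r ≤ k) : VanishesBelow r (face k w) := by
  intro l hl m f hf
  rw [face_eq_pull, pull_pull]
  refine hw l.castSucc (by simpa using hl) m _ fun a ha => hf a ?_
  have : l.castSucc < k := by simp [Fin.lt_def]; lia
  rw [← Fin.succAbove_of_castSucc_lt _ _ this] at ha
  exact Fin.succAbove_right_injective ha

/-- A simplex of positive dimension has a nonempty face opposite to the vertex `0`, and a constant
keeps its value there. -/
theorem eq_zero_of_vanishesBelow {r : ℕ} (hr : 0 < r) {c : K}
    (h : VanishesBelow r (algebraMap K (PolyForm K (n + 1)) c)) :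
    algebraMap K (PolyForm K (n + 1)) c = 0 := by
  have := vanishesBelow_iff.1 h 0 hr
  rw [AlgHom.commutes, map_eq_zero_iff _ algebraMap_injective] at this
  rw [this, map_zero]

/-- The partial sum `t_0 + ⋯ + t_j` of barycentric coordinates. -/
def tsum (j : ℕ) : PolyForm K n := ∑ a : Fin (n + 1), if (a : ℕ) ≤ j then t a else 0

theorem tsum_mem_forms (j : ℕ) : (tsum j : PolyForm K n) ∈ forms K n 0 :=
  sum_mem fun a _ => by
    split_ifs
    · exact t_mem_forms a
    · exact zero_mem _

theorem face_tsum (l : Fin (n + 2)) (j : ℕ) : face l (tsum j : PolyForm K (n + 1)) =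
    ∑ a : Fin (n + 1), if (l.succAbove a : ℕ) ≤ j then t a else 0 := by
  simp [tsum, Fin.sum_univ_succAbove _ l, apply_ite (face l)]

/-- A linear extension operator `Ω_n → Ω_{n+1}` from the last face, for forms that vanish on all
proper faces. -/
def extendLast (w : PolyForm K n) : PolyForm K (n + 1) :=
  ∑ j : Fin (n + 1), (-1 : K) ^ (n + j : ℕ) • (tsum j * pull j.predAbove w)

theorem val_predAbove (j : Fin (n + 1)) (a : Fin (n + 2)) :
    (j.predAbove a : ℕ) = if (j : ℕ) < a then (a : ℕ) - 1 else a := by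
  simp only [Fin.predAbove, Fin.lt_def, Fin.val_castSucc]
  split_ifs <;> simp

theorem val_succAbove (l : Fin (n + 2)) (a : Fin (n + 1)) :
    (l.succAbove a : ℕ) = if (a : ℕ) < l then (a : ℕ) else a + 1 := by
  simp only [Fin.succAbove, Fin.lt_def, Fin.val_castSucc]
  split_ifs <;> simp

theorem predAbove_succAbove_ne (j : Fin (n + 1)) (l : Fin (n + 2)) (h1 : (l : ℕ) ≠ j)
    (h2 : (l : ℕ) ≠ j + 1) : ∃ k : Fin (n + 1), ∀ a, j.predAbove (l.succAbove a) ≠ k := by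
  refine ⟨j.predAbove l, fun a => ?_⟩
  simp only [ne_eq, Fin.ext_iff, val_predAbove, val_succAbove]
  split_ifs <;> lia

theorem face_pull_predAbove_self (j : Fin (n + 1)) (l : Fin (n + 2))
    (h : (l : ℕ) = j ∨ (l : ℕ) = j + 1) (w : PolyForm K n) : face l (pull j.predAbove w) = w := by
  rw [face_eq_pull, pull_pull]
  convert pull_id w
  funext a
  simp only [Function.comp_apply, Fin.ext_iff, val_predAbove, val_succAbove, id]
  split_ifs <;> lia

/-- On the face `l` only the summands `j = l` and `j = l - 1` survive: any other one restricts `w`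
along a map that misses a vertex. Both survivors restrict to `(t_0 + ⋯ + t_{l-1}) w`, with opposite
signs, and cancel for `0 < l ≤ n`. For `l = 0` the coefficient is an empty sum. For the last face
only `j = n` remains, with sign `(-1)^(2n)` and coefficient `∑ t_a = 1`. -/
theorem face_extendLast {w : PolyForm K n} (hw : VanishesBelow (n + 1) w) (l : Fin (n + 2)) :
    face l (extendLast w) = if l = Fin.last (n + 1) then w else 0 := by
  have h0 : ∀ j : Fin (n + 1), (l : ℕ) ≠ j → (l : ℕ) ≠ j + 1 →
      face l ((-1 : K) ^ (n + j : ℕ) • (tsum j * pull j.predAbove w)) = 0 := by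
    intro j h1 h2
    obtain ⟨k, hk⟩ := predAbove_succAbove_ne j l h1 h2
    rw [map_smul, map_mul, face_eq_pull l (pull _ _), pull_pull,
      hw k k.2 n (j.predAbove ∘ l.succAbove) hk, mul_zero, smul_zero]
  have h1 : ∀ j : Fin (n + 1), ((l : ℕ) = j ∨ (l : ℕ) = j + 1) →
      face l ((-1 : K) ^ (n + j : ℕ) • (tsum j * pull j.predAbove w)) =
        (-1 : K) ^ (n + j : ℕ) • ((∑ a : Fin (n + 1), if (a : ℕ) < l then t a else 0) * w) := by
    intro j hj
    rw [map_smul, map_mul, face_pull_predAbove_self j l hj, face_tsum]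
    congr 2
    refine Finset.sum_congr rfl fun a _ => ?_
    congr 1
    rw [val_succAbove, eq_iff_iff]
    split_ifs <;> lia
  rw [extendLast, map_sum]
  split_ifs with h
  · subst h
    rw [Finset.sum_eq_single (Fin.last n), h1 _ (Or.inr (by simp))]
    · have (a : Fin (n + 1)) : (a : ℕ) < n + 1 := a.2
      simp only [this, if_true, sum_t, one_mul, Fin.val_last, ← two_mul, pow_mul, neg_one_sq, one_pow,
        one_smul]
    · intro j _ hj
      refine h0 j (by simp; lia) ?_
      simp only [ne_eq, Fin.ext_iff, Fin.val_last] at hj ⊢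
      lia
    · simp
  · obtain ⟨l, rfl⟩ := Fin.exists_castSucc_eq.2 h
    cases l using Fin.cases with
    | zero =>
      rw [Finset.sum_eq_single 0, h1 _ (Or.inl (by simp))]
      · simp
      · exact fun j _ hj => h0 j (fun h => hj (Fin.ext h.symm)) (by simp)
      · simp
    | succ l =>
      cases n with
      | zero => exact l.elim0
      | succ n =>
      rw [Finset.sum_eq_add l.castSucc l.succ, h1 _ (Or.inr (by simp)), h1 _ (Or.inl (by simp)),
        ← add_smul]
      · simp [pow_add]
      · simp [Fin.ext_iff]
      · intro j _ hj
        simp only [ne_eq, Fin.ext_iff, Fin.val_castSucc, Fin.val_succ] at hj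
        exact h0 j (by simp; lia) (by simp; lia)
      · simp
      · simp

/-- A form on the `r`-th face that vanishes where this face meets the previous ones extends to a
form that vanishes on the previous faces. -/
theorem exists_extension {i : ℕ} {w : PolyForm K n} (hi : w ∈ forms K n i) (r : Fin (n + 2))
    (hw : VanishesBelow r w) :
    ∃ v ∈ forms K (n + 1) i, VanishesBelow r v ∧ face r v = w := by
  induction r using Fin.lastCases with
  | last =>
    -- The last vertex has no successor with which it could be collapsed. Here `w` vanishes on all
    -- faces of its simplex, as `extendLast` requires.
    refine ⟨extendLast w, sum_mem fun j _ => Submodule.smul_mem _ _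
      (mul_mem_forms (zero_add i) (tsum_mem_forms _) (pull_mem_forms _ hi)), ?_, ?_⟩
    · rw [vanishesBelow_iff]
      intro k hk
      rw [face_extendLast hw, if_neg]
      rintro rfl
      exact lt_irrefl _ hk
    · rw [face_extendLast hw, if_pos rfl]
  | cast r =>
    -- The degeneracy collapsing `r` with `r + 1` is a retraction onto the face `r`. Over a vertex
    -- `k < r` its fibre is `k` alone, so vanishing on the earlier faces persists.
    refine ⟨pull r.predAbove w, pull_mem_forms _ hi, ?_, face_pull_predAbove_self r _ (by simp) w⟩
    intro k hk m f hf
    rw [pull_pull]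
    simp only [Fin.val_castSucc] at hk hw
    refine hw ⟨k, by lia⟩ hk m _ fun a ha => hf a ?_
    revert ha
    simp only [Function.comp_apply, Fin.ext_iff, val_predAbove]
    split_ifs <;> lia

end PolyForm

end

/-! ### Relative Poincaré lemmas, integration and Stokes' theorem. -/

noncomputable section

/-- The alternating sum over the codimension two faces vanishes. -/
theorem sum_sum_neg_one_pow_face (R : Type*) [CommRing R] {M : Type*} [AddCommGroup M] [Module R M]
    {n : ℕ} (a : Fin (n + 2) → Fin (n + 3) → M)
    (h : ∀ l k : Fin (n + 2), l ≤ k → a l k.succ = a k l.castSucc) :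
    ∑ k : Fin (n + 3), ∑ l : Fin (n + 2),
      (-1 : R) ^ (k : ℕ) • (-1 : R) ^ (l : ℕ) • a l k = 0 := by
  rw [← Finset.sum_product']
  -- The involution exchanges the two orders in which the same two vertices can be omitted; it
  -- shifts exactly one index by one and so reverses the sign.
  refine Finset.sum_involution (fun p _ =>
    if hp : (p.2 : ℕ) < p.1 then (⟨p.2, by lia⟩, ⟨p.1 - 1, by lia⟩)
    else (⟨p.2 + 1, by lia⟩, ⟨p.1, by lia⟩)) ?_ ?_ ?_ ?_
  · rintro ⟨⟨k, hk⟩, ⟨l, hl⟩⟩ -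
    dsimp only
    split_ifs with hp
    · obtain ⟨k, rfl⟩ : ∃ k', k = k' + 1 := ⟨k - 1, by lia⟩
      have := h ⟨l, hl⟩ ⟨k, by lia⟩ (by simp [Fin.le_def]; lia)
      simp only [Fin.succ_mk, Fin.castSucc_mk] at this
      simp only [this, Nat.add_sub_cancel, pow_succ]
      module
    · have := h ⟨k, by lia⟩ ⟨l, hl⟩ (by simp [Fin.le_def]; lia)
      simp only [Fin.succ_mk, Fin.castSucc_mk] at this
      simp only [this, pow_succ]
      module
  · rintro ⟨⟨k, hk⟩, ⟨l, hl⟩⟩ - -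
    dsimp only
    split_ifs with hp <;> simp only [ne_eq, Prod.mk.injEq, Fin.mk.injEq] <;> lia
  · simp
  · rintro ⟨⟨k, hk⟩, ⟨l, hl⟩⟩ -
    by_cases hp : l < k
    · have : ¬ (k - 1 < l) := by lia
      simp only [hp, this, dite_true, dite_false, Prod.mk.injEq, Fin.mk.injEq]
      lia
    · have : k < l + 1 := by lia
      simp only [hp, this, dite_true, dite_false, Prod.mk.injEq, Fin.mk.injEq]
      lia

namespace PolyForm

variable {K : Type u} [Field K] {n : ℕ}

theorem VanishesBelow.succ {w : PolyForm K (n + 1)} (r : Fin (n + 2)) (hw : VanishesBelow r w)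
    (h : PolyForm.face r w = 0) : VanishesBelow (r + 1) w := by
  rw [vanishesBelow_iff] at hw ⊢
  intro k hk
  rcases Nat.lt_succ_iff_lt_or_eq.1 hk with hk | hk
  · exact hw k hk
  · obtain rfl : k = r := Fin.ext hk
    exact h

/-- The faces have dimension below `i` and carry no nonzero `i`-forms. -/
theorem vanishesBelow_of_mem_forms {i : ℕ} (h : n ≤ i) {w : PolyForm K n} (hw : w ∈ forms K n i)
    (r : ℕ) : VanishesBelow r w := by
  cases n with
  | zero => exact fun k _ _ f hf => absurd (Subsingleton.elim (α := Fin 1) (f 0) k) (hf 0)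
  | succ n => exact vanishesBelow_iff.2 fun k _ => eq_zero_of_mem_forms h (face_mem_forms k hw)

variable [CharZero K]

/-- The Poincaré lemma relative to a proper subset of the faces. -/
theorem exists_primitive_vanishesBelow (r : ℕ) : ∀ (n : ℕ) (_ : r ≤ n) (i : ℕ) (x : PolyForm K n)
    (_ : x ∈ forms K n (i + 1)) (_ : d x = 0) (_ : VanishesBelow r x),
    ∃ y ∈ forms K n i, VanishesBelow r y ∧ d y = x := by
  induction r with
  | zero =>
    intro n _ i x hx hd _
    obtain ⟨y, hy, rfl⟩ := exists_primitive hx hd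
    exact ⟨y, hy, vanishesBelow_zero y, rfl⟩
  | succ r ih =>
    intro n hn i x hx hd hv
    cases n with
    | zero => lia
    | succ n =>
    obtain ⟨y, hy, hyv, rfl⟩ := ih _ (by lia) i x hx hd (hv.mono (by lia))
    let k : Fin (n + 2) := ⟨r, by lia⟩
    have h1 : d (face k y) = 0 := by
      rw [← face_d]; exact vanishesBelow_iff.1 hv k (Nat.lt_succ_self r)
    have h2 : VanishesBelow r (face k y) := hyv.face k le_rfl
    cases i with
    | zero =>
      -- The restriction of the primitive to the face `r` is a constant. For `r = 0` it may be
      -- subtracted. For `r > 0` this face has dimension at least `r`, hence positive, and the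
      -- constant vanishes because it vanishes on an earlier face.
      obtain ⟨c, hc⟩ := exists_eq_algebraMap (face_mem_forms k hy) h1
      rcases Nat.eq_zero_or_pos r with rfl | hr
      · refine ⟨y - algebraMap K _ c, sub_mem hy (algebraMap_mem_forms c),
          VanishesBelow.succ k (vanishesBelow_zero _) ?_, by simp⟩
        rw [map_sub, hc, AlgHom.commutes, sub_self]
      · refine ⟨y, hy, VanishesBelow.succ k hyv ?_, rfl⟩
        cases n with
        | zero => lia
        | succ n =>
          rw [hc] at h2 ⊢
          exact eq_zero_of_vanishesBelow hr h2
    | succ i =>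
      -- The closed restriction of `y` to the face `r` has a relative primitive by induction;
      -- subtracting `d` of an extension of that primitive kills the restriction without changing `d
      -- y`.
      obtain ⟨z, hz, hzv, hdz⟩ := ih n (by lia) i _ (face_mem_forms k hy) h1 h2
      obtain ⟨v, hv', hvv, hvz⟩ := exists_extension hz k hzv
      refine ⟨y - d v, sub_mem hy (d_mem_forms hv'), VanishesBelow.succ k (hyv.sub hvv.d) ?_, ?_⟩
      · rw [map_sub, face_d, hvz, hdz, sub_self]
      · rw [map_sub, d_d, sub_zero]

/-! ### Integration -/

/-- Top degree forms are closed, hence exact, and over a field `d` admits a linear section on them.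
It is extended to all forms so that the integral defined through it is linear on the whole algebra.
-/
theorem exists_primitive_linearMap (n : ℕ) :
    ∃ P : PolyForm K (n + 1) →ₗ[K] PolyForm K (n + 1),
      ∀ x ∈ forms K (n + 1) (n + 1), P x ∈ forms K (n + 1) n ∧ d (P x) = x := by
  let D : forms K (n + 1) n →ₗ[K] forms K (n + 1) (n + 1) := d.restrict fun x hx => d_mem_forms hx
  have hD : LinearMap.range D = ⊤ := by
    rw [LinearMap.range_eq_top]
    rintro ⟨x, hx⟩
    obtain ⟨y, hy, rfl⟩ :=
      exists_primitive hx (eq_zero_of_mem_forms (by lia) (d_mem_forms hx))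
    exact ⟨⟨y, hy⟩, rfl⟩
  obtain ⟨g, hg⟩ := D.exists_rightInverse_of_surjective hD
  obtain ⟨P, hP⟩ := LinearMap.exists_extend ((forms K (n + 1) n).subtype ∘ₗ g)
  refine ⟨P, fun x hx => ?_⟩
  have h1 : P x = g ⟨x, hx⟩ := LinearMap.congr_fun hP ⟨x, hx⟩
  rw [h1]
  exact ⟨(g ⟨x, hx⟩).2, congrArg Subtype.val (LinearMap.congr_fun hg ⟨x, hx⟩)⟩

variable (K) in
/-- Integration of top degree forms over the simplex, normalized so that Stokes' theorem holds. -/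
def integral : ∀ n : ℕ, PolyForm K n →ₗ[K] K
  | 0 => (lift (fun _ => 1) (fun _ => 0) (by simp) (by simp) (by simp) (by simp) (by simp)
      (by simp) : PolyForm K 0 →ₐ[K] K).toLinearMap
  | n + 1 => ∑ k : Fin (n + 2), (-1 : K) ^ (k : ℕ) •
      (integral n ∘ₗ (face k).toLinearMap ∘ₗ (exists_primitive_linearMap n).choose)

theorem integral_zero_algebraMap (c : K) : integral K 0 (algebraMap K _ c) = c := by
  simp only [integral, AlgHom.toLinearMap_apply, AlgHom.commutes]
  rfl

/-- The integral is defined by imposing Stokes' formula on a chosen primitive; this is the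
independence of the choice. A closed function on the 1-simplex is constant and its endpoint values
cancel. In higher dimension `z = d w`, and Stokes one dimension lower gives an alternating sum over
codimension two faces, which is zero. -/
theorem sum_integral_face_of_d_eq_zero (hS : ∀ m, n = m + 1 → ∀ y ∈ forms K (m + 1) m,
      integral K (m + 1) (d y) = ∑ k : Fin (m + 2), (-1 : K) ^ (k : ℕ) * integral K m (face k y))
    {z : PolyForm K (n + 1)} (hz : z ∈ forms K (n + 1) n) (hd : d z = 0) :
    ∑ k : Fin (n + 2), (-1 : K) ^ (k : ℕ) * integral K n (face k z) = 0 := by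
  cases n with
  | zero =>
    obtain ⟨c, rfl⟩ := exists_eq_algebraMap hz hd
    simp [Fin.sum_univ_two]
  | succ n =>
    obtain ⟨w, hw, rfl⟩ := exists_primitive hz hd
    simp only [face_d, hS n rfl _ (face_mem_forms _ hw), Finset.mul_sum]
    exact sum_sum_neg_one_pow_face K (fun l k => integral K n (face l (face k w))) fun l k h => by
      rw [face_face_of_le l k h]

/-- Stokes' theorem. -/
theorem integral_d (n : ℕ) : ∀ y ∈ forms K (n + 1) n, integral K (n + 1) (d y) =
    ∑ k : Fin (n + 2), (-1 : K) ^ (k : ℕ) * integral K n (face k y) := by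
  have main : ∀ n, (∀ m, n = m + 1 → ∀ y ∈ forms K (m + 1) m, integral K (m + 1) (d y) =
      ∑ k : Fin (m + 2), (-1 : K) ^ (k : ℕ) * integral K m (face k y)) →
      ∀ y ∈ forms K (n + 1) n, integral K (n + 1) (d y) =
        ∑ k : Fin (n + 2), (-1 : K) ^ (k : ℕ) * integral K n (face k y) := by
    intro n hS y hy
    obtain ⟨h1, h2⟩ := (exists_primitive_linearMap (K := K) n).choose_spec (d y) (d_mem_forms hy)
    have h3 := sum_integral_face_of_d_eq_zero hS (sub_mem h1 hy) (by rw [map_sub, h2, sub_self])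
    simp only [map_sub, mul_sub, Finset.sum_sub_distrib, sub_eq_zero] at h3
    rw [← h3, integral]
    simp
  induction n with
  | zero => exact main 0 fun m hm => by lia
  | succ n ih =>
    refine main (n + 1) fun m hm => ?_
    obtain rfl : n = m := by lia
    exact ih

theorem integral_d_of_vanishesBelow {y : PolyForm K (n + 1)} (hy : y ∈ forms K (n + 1) n)
    (hv : VanishesBelow (n + 1) y) :
    integral K (n + 1) (d y) = (-1) ^ (n + 1) * integral K n (face (Fin.last _) y) := by
  rw [integral_d n y hy, Finset.sum_eq_single (Fin.last (n + 1))]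
  · simp
  · intro k _ hk
    rw [vanishesBelow_iff.1 hv k (Fin.val_lt_last hk), map_zero, mul_zero]
  · simp

/-- A form of integral one on the last face extends by zero on the other faces; by Stokes, `d` of
the extension has integral one up to sign. -/
theorem exists_integral_eq_one (n : ℕ) : ∃ x ∈ forms K n n, integral K n x = 1 := by
  induction n with
  | zero => exact ⟨algebraMap K _ 1, algebraMap_mem_forms 1, integral_zero_algebraMap 1⟩
  | succ n ih =>
    obtain ⟨x, hx, h1⟩ := ih
    obtain ⟨v, hv, hvv, hvx⟩ := exists_extension hx (Fin.last _)
      (vanishesBelow_of_mem_forms le_rfl hx _)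
    refine ⟨(-1 : K) ^ (n + 1) • d v, Submodule.smul_mem _ _ (d_mem_forms hv), ?_⟩
    rw [map_smul, integral_d_of_vanishesBelow hv hvv, hvx, h1, mul_one, smul_eq_mul, ← mul_pow]
    simp

/-- The Poincaré lemma relative to the boundary of the simplex. -/
theorem exists_relative_primitive (n : ℕ) : ∀ (i : ℕ) (x : PolyForm K n)
    (_ : x ∈ forms K n (i + 1)) (_ : d x = 0) (_ : VanishesBelow (n + 1) x) (_ : i + 1 ≤ n)
    (_ : i + 1 = n → integral K n x = 0),
    ∃ y ∈ forms K n i, VanishesBelow (n + 1) y ∧ d y = x := by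
  induction n with
  | zero => intro i x _ _ _ h; lia
  | succ n ih =>
    intro i x hx hd hv hi hint
    obtain ⟨y, hy, hyv, rfl⟩ := exists_primitive_vanishesBelow (n + 1) _ le_rfl i x hx hd
      (hv.mono (by lia))
    have h1 : d (face (Fin.last _) y) = 0 := by
      rw [← face_d]; exact vanishesBelow_iff.1 hv _ (by simp)
    have h2 : VanishesBelow (n + 1) (face (Fin.last _) y) := hyv.face _ (by simp)
    -- As `y` vanishes on all other faces, Stokes moves the integral condition to the last face,
    -- which is what the induction on dimension requires.
    have h3 : i = n → integral K n (face (Fin.last _) y) = 0 := by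
      rintro rfl
      have := hint rfl
      rw [integral_d_of_vanishesBelow hy hyv] at this
      simpa using this
    cases i with
    | zero =>
      refine ⟨y, hy, VanishesBelow.succ (Fin.last _) (by simpa using hyv) ?_, rfl⟩
      obtain ⟨c, hc⟩ := exists_eq_algebraMap (face_mem_forms (Fin.last _) hy) h1
      rw [hc] at h2 h3 ⊢
      -- On a point the integral is the value, so the integral condition kills the constant; on a
      -- larger face the constant already vanishes on a boundary face.
      cases n with
      | zero =>
        have := h3 rfl
        rw [integral_zero_algebraMap] at this
        rw [this, map_zero]
      | succ n => exact eq_zero_of_vanishesBelow (by lia) h2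
    | succ i =>
      obtain ⟨z, hz, hzv, hdz⟩ := ih i _ (face_mem_forms _ hy) h1 h2 (by lia) h3
      obtain ⟨v, hv', hvv, hvz⟩ := exists_extension hz (Fin.last _) hzv
      refine ⟨y - d v, sub_mem hy (d_mem_forms hv'),
        VanishesBelow.succ (Fin.last _) (hyv.sub hvv.d) ?_, ?_⟩
      · rw [map_sub, face_d, hvz, hdz, sub_self]
      · rw [map_sub, d_d, sub_zero]

end PolyForm

end

noncomputable section

/-! ### Tensor products of subspaces -/

namespace Submodule

variable {K : Type u} [Field K] {A B : Type u} [AddCommGroup A] [Module K A] [AddCommGroup B]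
  [Module K B]

/-- The image of `S ⊗ W` in `A ⊗ W`, for a subspace `S` of `A`. -/
def tens (S : Submodule K A) (W : Type u) [AddCommGroup W] [Module K W] :
    Submodule K (A ⊗[K] W) := LinearMap.range (S.subtype.rTensor W)

variable {W : Type u} [AddCommGroup W] [Module K W] {W' : Type u} [AddCommGroup W'] [Module K W']

theorem tmul_mem_tens {S : Submodule K A} {a : A} (h : a ∈ S) (w : W) : a ⊗ₜ w ∈ S.tens W :=
  ⟨⟨a, h⟩ ⊗ₜ w, rfl⟩

theorem lTensor_mem_tens {S : Submodule K A} (f : W →ₗ[K] W') {x : A ⊗[K] W} (hx : x ∈ S.tens W) :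
    f.lTensor A x ∈ S.tens W' := by
  obtain ⟨y, rfl⟩ := hx
  exact ⟨f.lTensor S y, by
    rw [← LinearMap.comp_apply, ← LinearMap.comp_apply, LinearMap.rTensor_comp_lTensor,
      LinearMap.lTensor_comp_rTensor]⟩

theorem rTensor_mem_tens {S : Submodule K A} {T : Submodule K B} {f : A →ₗ[K] B}
    (h : ∀ a ∈ S, f a ∈ T) {x : A ⊗[K] W} (hx : x ∈ S.tens W) : f.rTensor W x ∈ T.tens W := by
  obtain ⟨y, rfl⟩ := hx
  refine ⟨(f.restrict h).rTensor W y, ?_⟩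
  rw [← LinearMap.rTensor_comp_apply, ← LinearMap.rTensor_comp_apply]
  rfl

theorem rTensor_eq_zero_of_mem_tens {S : Submodule K A} {f : A →ₗ[K] B} (h : ∀ a ∈ S, f a = 0)
    {x : A ⊗[K] W} (hx : x ∈ S.tens W) : f.rTensor W x = 0 := by
  obtain ⟨y, rfl⟩ := hx
  rw [← LinearMap.rTensor_comp_apply, show f ∘ₗ S.subtype = 0 from LinearMap.ext fun a => h a a.2]
  simp

theorem tens_mono {S T : Submodule K A} (h : S ≤ T) : S.tens W ≤ T.tens W := fun x hx => by
  simpa using rTensor_mem_tens (f := LinearMap.id) h hx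

theorem eq_zero_of_mem_tens_bot {S : Submodule K A} (hS : S = ⊥) {x : A ⊗[K] W}
    (hx : x ∈ S.tens W) : x = 0 := by
  simpa using rTensor_eq_zero_of_mem_tens (f := LinearMap.id) (by simp [hS]) hx

/-- To lift an element of `S ⊗ W` along `f ⊗ 1`, it suffices to lift those elements of `S` that
satisfy all linear conditions satisfied by the given element. -/
theorem exists_mem_tens_of_forall {S : Submodule K A} {T : Submodule K B} (f : B →ₗ[K] A)
    {x : A ⊗[K] W} (hx : x ∈ S.tens W)
    (h : ∀ c ∈ S, (∀ (M : Type u) [AddCommGroup M] [Module K M] (φ : A →ₗ[K] M),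
      φ.rTensor W x = 0 → φ c = 0) → ∃ y ∈ T, f y = c) :
    ∃ y ∈ T.tens W, f.rTensor W y = x := by
  obtain ⟨x', rfl⟩ := hx
  let b := Module.Basis.ofVectorSpace K W
  obtain ⟨c, rfl⟩ := TensorProduct.eq_repr_basis_right b x'
  have key : ∀ a, ∃ y ∈ T, f y = c a := by
    intro a
    refine h _ (c a).2 fun M _ _ φ hφ => ?_
    -- Expanding along a basis of `W` makes every linear condition on `x` a condition on each
    -- coefficient.
    have h1 := TensorProduct.sum_tmul_basis_right_eq_zero b
      (c.mapRange (φ ∘ₗ S.subtype) (map_zero _)) (by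
        rw [Finsupp.sum_mapRange_index (by simp), ← hφ]
        simp [Finsupp.sum])
    simpa using DFunLike.congr_fun h1 a
  choose g hgT hg using key
  refine ⟨∑ a ∈ c.support, g a ⊗ₜ b a, sum_mem fun a _ => tmul_mem_tens (hgT a) _, ?_⟩
  simp [Finsupp.sum, hg]

/-- Tensoring with a subspace is exact. -/
theorem exists_lTensor_eq {S : Submodule K A} {W'' : Type u} [AddCommGroup W''] [Module K W'']
    {f : W' →ₗ[K] W} {p : W →ₗ[K] W''} (h : ∀ w, p w = 0 → ∃ w', f w' = w) {x : A ⊗[K] W}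
    (hx : x ∈ S.tens W) (hp : p.lTensor A x = 0) : ∃ y ∈ S.tens W', f.lTensor A y = x := by
  obtain ⟨x', rfl⟩ := hx
  let b := Module.Basis.ofVectorSpace K S
  obtain ⟨c, rfl⟩ := TensorProduct.eq_repr_basis_left b x'
  have h0 : p.lTensor S (c.sum fun i n => b i ⊗ₜ n) = 0 := by
    -- By flatness the vanishing of `p ⊗ 1` can be tested in the larger space `A ⊗ W''`.
    refine Module.Flat.rTensor_preserves_injective_linearMap S.subtype S.subtype_injective ?_
    rw [map_zero, ← hp, ← LinearMap.comp_apply, ← LinearMap.comp_apply,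
      LinearMap.rTensor_comp_lTensor, LinearMap.lTensor_comp_rTensor]
  have key : ∀ a, ∃ w', f w' = c a := by
    intro a
    refine h _ ?_
    have h1 := TensorProduct.sum_tmul_basis_left_eq_zero b (c.mapRange p (map_zero _)) (by
        rw [Finsupp.sum_mapRange_index (by simp), ← h0]
        simp [Finsupp.sum])
    simpa using DFunLike.congr_fun h1 a
  choose g hg using key
  refine ⟨∑ a ∈ c.support, (b a : A) ⊗ₜ g a, sum_mem fun a _ => tmul_mem_tens (b a).2 _, ?_⟩
  simp [Finsupp.sum, hg]

end Submodule

/-! ### Extension of forms with coefficients -/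

namespace PolyForm

variable {K : Type u} [Field K] {n : ℕ} {W : Type u} [AddCommGroup W] [Module K W]

variable (K n) in
/-- The `i`-forms that vanish on the faces opposite to the vertices `k < r`. -/
def relForms (i r : ℕ) : Submodule K (PolyForm K n) where
  carrier := { w | w ∈ forms K n i ∧ VanishesBelow r w }
  add_mem' hv hw := ⟨add_mem hv.1 hw.1, fun k hk m f hf => by
    rw [map_add, hv.2 k hk m f hf, hw.2 k hk m f hf, add_zero]⟩
  zero_mem' := ⟨zero_mem _, fun k hk m f hf => map_zero _⟩
  smul_mem' c w hw := ⟨Submodule.smul_mem _ c hw.1, fun k hk m f hf => by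
    rw [map_smul, hw.2 k hk m f hf, smul_zero]⟩

theorem relForms_le {i r : ℕ} : relForms K n i r ≤ forms K n i := fun _ h => h.1

/-- The restriction to a face, with coefficients. -/
abbrev faceT (k : Fin (n + 2)) (W : Type u) [AddCommGroup W] [Module K W] :
    PolyForm K (n + 1) ⊗[K] W →ₗ[K] PolyForm K n ⊗[K] W :=
  (face k).toLinearMap.rTensor W

theorem faceT_faceT (l k : Fin (n + 2)) (h : l ≤ k) (x : PolyForm K (n + 2) ⊗[K] W) :
    faceT l W (faceT k.succ W x) = faceT k W (faceT l.castSucc W x) := by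
  rw [← LinearMap.rTensor_comp_apply, ← LinearMap.rTensor_comp_apply]
  congr 2
  ext y
  exact face_face_of_le l k h y

theorem faceT_mem {i : ℕ} (k : Fin (n + 2)) {x : PolyForm K (n + 1) ⊗[K] W}
    (hx : x ∈ (forms K (n + 1) i).tens W) : faceT k W x ∈ (forms K n i).tens W :=
  Submodule.rTensor_mem_tens (fun _ ha => face_mem_forms k ha) hx

theorem mem_tens_relForms_zero {i : ℕ} {x : PolyForm K 0 ⊗[K] W} (hx : x ∈ (forms K 0 i).tens W)
    (r : ℕ) : x ∈ (relForms K 0 i r).tens W :=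
  Submodule.tens_mono (S := forms K 0 i) (T := relForms K 0 i r) (fun _ ha => ⟨ha, fun k _ _ f hf =>
    absurd (Subsingleton.elim (α := Fin 1) (f 0) k) (hf 0)⟩) hx

/-- Over a field, cutting out a subspace by linear conditions commutes with tensoring: the
coefficients of `x` vanish on the faces on which `x` does. -/
theorem mem_tens_relForms {i r : ℕ} {x : PolyForm K (n + 1) ⊗[K] W}
    (hx : x ∈ (forms K (n + 1) i).tens W)
    (h : ∀ k : Fin (n + 2), (k : ℕ) < r → faceT k W x = 0) :
    x ∈ (relForms K (n + 1) i r).tens W := by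
  obtain ⟨y, hy, hyx⟩ := Submodule.exists_mem_tens_of_forall (T := relForms K (n + 1) i r)
    LinearMap.id hx fun c hc h' => ⟨c, ⟨hc, vanishesBelow_iff.2 fun k hk => h' _ _ (h k hk)⟩, rfl⟩
  rw [LinearMap.rTensor_id, LinearMap.id_apply] at hyx
  rwa [← hyx]

theorem faceT_eq_zero {i r : ℕ} {x : PolyForm K (n + 1) ⊗[K] W}
    (hx : x ∈ (relForms K (n + 1) i r).tens W) (k : Fin (n + 2)) (hk : (k : ℕ) < r) :
    faceT k W x = 0 :=
  Submodule.rTensor_eq_zero_of_mem_tens (S := relForms K (n + 1) i r)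
    (fun _ ha => vanishesBelow_iff.1 ha.2 k hk) hx

/-- Forms on the faces of a simplex that agree on the faces of codimension two. -/
def FacesCompatible : ∀ {n : ℕ}, (Fin (n + 2) → PolyForm K n ⊗[K] W) → Prop
  | 0, _ => True
  | _ + 1, y => ∀ l k, l ≤ k → faceT l W (y k.succ) = faceT k W (y l.castSucc)

/-- Compatible forms with coefficients on the faces of a simplex extend to the simplex. -/
theorem exists_faceT_eq {i : ℕ} (y : Fin (n + 2) → PolyForm K n ⊗[K] W)
    (hy : ∀ k, y k ∈ (forms K n i).tens W)
    (hc : FacesCompatible y) :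
    ∃ x ∈ (forms K (n + 1) i).tens W, ∀ k, faceT k W x = y k := by
  have key : ∀ r ≤ n + 2, ∃ x ∈ (forms K (n + 1) i).tens W,
      ∀ k : Fin (n + 2), (k : ℕ) < r → faceT k W x = y k := by
    intro r
    induction r with
    | zero => exact fun _ => ⟨0, zero_mem _, by simp⟩
    | succ r ih =>
      intro hr
      obtain ⟨x, hx, hxy⟩ := ih (by lia)
      let s : Fin (n + 2) := ⟨r, by lia⟩
      -- By compatibility the error on the face `s` vanishes where this face meets the earlier ones,
      -- so it extends by a form that leaves the faces already treated unchanged.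
      have h1 : y s - faceT s W x ∈ (relForms K n i r).tens W := by
        have h2 : y s - faceT s W x ∈ (forms K n i).tens W := sub_mem (hy s) (faceT_mem s hx)
        cases n with
        | zero => exact mem_tens_relForms_zero h2 r
        | succ n =>
          refine mem_tens_relForms h2 fun l hl => ?_
          obtain ⟨k, hk⟩ : ∃ k : Fin (n + 2), k.succ = s :=
            Fin.exists_succ_eq.2 fun h0 => by simp [s, Fin.ext_iff] at h0; lia
          have hlk : l ≤ k := by
            have h3 : (k : ℕ) + 1 = r := congrArg Fin.val hk
            exact Fin.le_def.2 (by lia)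
          rw [← hk, map_sub, faceT_faceT l k hlk, hc l k hlk, hxy l.castSucc (by simpa using hl), sub_self]
      obtain ⟨v, hv, hvx⟩ := Submodule.exists_mem_tens_of_forall
        (T := relForms K (n + 1) i r) (face s).toLinearMap h1 fun c hc _ => by
          obtain ⟨v, h1, h2, h3⟩ := exists_extension hc.1 s hc.2
          exact ⟨v, ⟨h1, h2⟩, h3⟩
      refine ⟨x + v, add_mem hx (Submodule.tens_mono relForms_le hv), fun k hk => ?_⟩
      rcases Nat.lt_succ_iff_lt_or_eq.1 hk with hk | hk
      · rw [map_add, hxy k hk, faceT_eq_zero hv k hk, add_zero]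
      · obtain rfl : k = s := Fin.ext hk
        rw [map_add]
        erw [hvx]
        rw [add_sub_cancel]
  obtain ⟨x, hx, h⟩ := key (n + 2) le_rfl
  exact ⟨x, hx, fun k => h k k.2⟩

/-- The relative Poincaré lemma with coefficients. -/
theorem exists_relative_primitive_tens [CharZero K] {i : ℕ} {x : PolyForm K (n + 1) ⊗[K] W}
    (hx : x ∈ (forms K (n + 1) (i + 1)).tens W) (hd : d.rTensor W x = 0)
    (hf : ∀ k, faceT k W x = 0) (hi : i ≤ n)
    (hint : i = n → (integral K (n + 1)).rTensor W x = 0) :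
    ∃ y ∈ (forms K (n + 1) i).tens W, (∀ k, faceT k W y = 0) ∧ d.rTensor W y = x := by
  obtain ⟨y, hy, hyx⟩ := Submodule.exists_mem_tens_of_forall (T := relForms K (n + 1) i (n + 2)) d hx
    fun c hc h => by
      obtain ⟨y, h1, h2, h3⟩ := exists_relative_primitive (n + 1) i c hc (h _ _ hd)
        (vanishesBelow_iff.2 fun k _ => h _ _ (hf k)) (by lia) fun hin => h _ _ (hint (by lia))
      exact ⟨y, ⟨h1, h2⟩, h3⟩
  exact ⟨y, Submodule.tens_mono relForms_le hy, fun k => faceT_eq_zero hy k k.2, hyx⟩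

end PolyForm

end

noncomputable section

open PolyForm

/-! ### The Thom–Whitney complex of a semicosimplicial vector space -/

/-- A semicosimplicial vector space. -/
structure SemicosimplicialModule (K : Type u) [Field K] where
  obj : ℕ → ModuleCat.{u} K
  /-- `face n k` is the coface map `∂_{k,n+1}` -/
  face (n : ℕ) (k : Fin (n + 2)) : obj n →ₗ[K] obj (n + 1)
  face_face (n : ℕ) (l k : Fin (n + 2)) (h : l ≤ k) (x : obj n) :
    face (n + 1) k.succ (face n l x) = face (n + 1) l.castSucc (face n k x)

namespace SemicosimplicialModule

variable {K : Type u} [Field K]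

/-- The coface map, with coefficients in the forms. -/
abbrev cofaceT (V : SemicosimplicialModule K) (n : ℕ) (k : Fin (n + 2)) :
    PolyForm K n ⊗[K] V.obj n →ₗ[K] PolyForm K n ⊗[K] V.obj (n + 1) :=
  (V.face n k).lTensor (PolyForm K n)

/-- The elements of degree `i` of the Thom–Whitney complex. -/
structure IsTW (V : SemicosimplicialModule K) (i : ℕ)
    (x : ∀ n, PolyForm K n ⊗[K] V.obj n) : Prop where
  mem (n : ℕ) : x n ∈ (forms K n i).tens (V.obj n)
  face (n : ℕ) (k : Fin (n + 2)) : faceT k _ (x (n + 1)) = V.cofaceT n k (x n)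

variable {V : SemicosimplicialModule K}

/-- The simplicial identities of the faces are matched with the cosimplicial identities of `V`; this
lets the inductive construction continue to the next dimension. -/
theorem facesCompatible_of_faceT_eq {n : ℕ} {x : PolyForm K n ⊗[K] V.obj n}
    {y : PolyForm K (n + 1) ⊗[K] V.obj (n + 1)} (h : ∀ k, faceT k _ y = V.cofaceT n k x) :
    FacesCompatible fun k => V.cofaceT (n + 1) k y := by
  intro l k hlk
  dsimp only
  rw [faceT, faceT, ThomWhitney.rTensor_lTensor, ThomWhitney.rTensor_lTensor, h, h,
    ← LinearMap.lTensor_comp_apply, ← LinearMap.lTensor_comp_apply]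
  congr 2
  ext v
  exact V.face_face n l k hlk v

/-- Inductive construction of elements of the Thom–Whitney complex. -/
theorem exists_isTW {i : ℕ} (R : ∀ n, PolyForm K n ⊗[K] V.obj n → Prop)
    (h0 : ∃ x ∈ (forms K 0 i).tens (V.obj 0), R 0 x)
    (step : ∀ n, ∀ x ∈ (forms K n i).tens (V.obj n), R n x →
      ∀ y ∈ (forms K (n + 1) i).tens (V.obj (n + 1)), (∀ k, faceT k _ y = V.cofaceT n k x) →
      ∃ z ∈ (forms K (n + 1) i).tens (V.obj (n + 1)),
        (∀ k, faceT k _ z = V.cofaceT n k x) ∧ R (n + 1) z) :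
    ∃ x, V.IsTW i x ∧ ∀ n, R n (x n) := by
  -- Compatibility of the cofaces is carried along as data, since it is the condition for extending
  -- them to the next simplex.
  let S (n : ℕ) := { x : PolyForm K n ⊗[K] V.obj n // x ∈ (forms K n i).tens (V.obj n) ∧ R n x ∧
    FacesCompatible fun k => V.cofaceT n k x }
  have next (n : ℕ) (x : S n) : ∃ z : S (n + 1), ∀ k, faceT k _ z.1 = V.cofaceT n k x.1 := by
    obtain ⟨x, hx, hR, hc⟩ := x
    obtain ⟨y, hy, hyx⟩ := exists_faceT_eq (fun k => V.cofaceT n k x)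
      (fun k => Submodule.lTensor_mem_tens _ hx) hc
    obtain ⟨z, hz, hzx, hRz⟩ := step n x hx hR y hy hyx
    exact ⟨⟨z, hz, hRz, facesCompatible_of_faceT_eq hzx⟩, hzx⟩
  choose F hF using next
  obtain ⟨x0, hx0, hR0⟩ := h0
  let X : ∀ n, S n := fun n => Nat.rec ⟨x0, hx0, hR0, trivial⟩ F n
  exact ⟨fun n => (X n).1, ⟨fun n => (X n).2.1, fun n k => hF n (X n) k⟩, fun n => (X n).2.2.1⟩

/-- The functors of Thom–Whitney cochains of a given degree are exact. -/
theorem IsTW.exists_lift {V' V'' : SemicosimplicialModule K} (f : ∀ n, V'.obj n →ₗ[K] V.obj n)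
    (p : ∀ n, V.obj n →ₗ[K] V''.obj n)
    (hf : ∀ n k v, f (n + 1) (V'.face n k v) = V.face n k (f n v))
    (hex : ∀ n v, p n v = 0 → ∃ v', f n v' = v) {i : ℕ} {x : ∀ n, PolyForm K n ⊗[K] V.obj n}
    (hx : V.IsTW i x) (hp : ∀ n, (p n).lTensor _ (x n) = 0) (hpf : ∀ n v, p n (f n v) = 0) :
    ∃ x', V'.IsTW i x' ∧ ∀ n, (f n).lTensor _ (x' n) = x n := by
  refine exists_isTW (fun n x' => (f n).lTensor _ x' = x n) ?_ ?_
  · exact Submodule.exists_lTensor_eq (hex 0) (hx.mem 0) (hp 0)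
  · intro n x' _ hxx' y hy hyx'
    -- The error vanishes on the whole boundary, so it can be lifted with form parts vanishing
    -- there; the correction keeps the prescribed boundary values.
    have h1 : x (n + 1) - (f (n + 1)).lTensor _ y ∈ (relForms K (n + 1) i (n + 2)).tens _ := by
      refine mem_tens_relForms (sub_mem (hx.mem _) (Submodule.lTensor_mem_tens _ hy)) fun k _ => ?_
      rw [map_sub, hx.face, sub_eq_zero, faceT, ThomWhitney.rTensor_lTensor]
      erw [hyx' k]
      rw [← hxx', ← LinearMap.lTensor_comp_apply, ← LinearMap.lTensor_comp_apply]
      congr 2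
      ext v
      exact (hf n k v).symm
    obtain ⟨z, hz, hzx⟩ := Submodule.exists_lTensor_eq (hex (n + 1)) h1 (by
      rw [map_sub, hp, ← LinearMap.lTensor_comp_apply,
        show p (n + 1) ∘ₗ f (n + 1) = 0 from LinearMap.ext (hpf (n + 1))]
      simp)
    refine ⟨y + z, add_mem hy (Submodule.tens_mono relForms_le hz), fun k => ?_, ?_⟩
    · rw [map_add, hyx', faceT_eq_zero hz k k.2, add_zero]
    · rw [map_add, hzx, add_sub_cancel]

/-- The Čech differential. -/
def cechD (V : SemicosimplicialModule K) (n : ℕ) : V.obj n →ₗ[K] V.obj (n + 1) :=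
  ∑ k : Fin (n + 2), (-1 : K) ^ (k : ℕ) • V.face n k

theorem cechD_apply (n : ℕ) (v : V.obj n) :
    V.cechD n v = ∑ k : Fin (n + 2), (-1 : K) ^ (k : ℕ) • V.face n k v := by
  simp [cechD]

theorem IsTW.eq_zero {i : ℕ} {x : ∀ n, PolyForm K n ⊗[K] V.obj n} (hx : V.IsTW i x) {n : ℕ}
    (h : n < i) : x n = 0 :=
  Submodule.eq_zero_of_mem_tens_bot (forms_eq_bot h) (hx.mem n)

theorem eq_zero_of_mem {i n : ℕ} (h : n < i) {W : Type u} [AddCommGroup W] [Module K W]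
    {x : PolyForm K n ⊗[K] W} (hx : x ∈ (forms K n i).tens W) : x = 0 :=
  Submodule.eq_zero_of_mem_tens_bot (forms_eq_bot h) hx

theorem d_mem {i n : ℕ} {W : Type u} [AddCommGroup W] [Module K W]
    {x : PolyForm K n ⊗[K] W} (hx : x ∈ (forms K n i).tens W) :
    d.rTensor W x ∈ (forms K n (i + 1)).tens W :=
  Submodule.rTensor_mem_tens (fun _ ha => d_mem_forms ha) hx

theorem d_d_tens {n : ℕ} {W : Type u} [AddCommGroup W] [Module K W] (x : PolyForm K n ⊗[K] W) :
    d.rTensor W (d.rTensor W x) = 0 := by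
  rw [← LinearMap.rTensor_comp_apply,
    show (d ∘ₗ d : PolyForm K n →ₗ[K] _) = 0 from LinearMap.ext d_d]
  simp

theorem faceT_d {n : ℕ} {W : Type u} [AddCommGroup W] [Module K W] (k : Fin (n + 2))
    (x : PolyForm K (n + 1) ⊗[K] W) : faceT k W (d.rTensor W x) = d.rTensor W (faceT k W x) := by
  rw [← LinearMap.rTensor_comp_apply, ← LinearMap.rTensor_comp_apply]
  congr 2
  ext y
  exact face_d k y

theorem one_tmul_injective (n : ℕ) {W : Type u} [AddCommGroup W] [Module K W] {w w' : W}
    (h : (1 : PolyForm K n) ⊗ₜ[K] w = 1 ⊗ₜ w') : w = w' := by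
  refine ((Module.Flat.rTensor_preserves_injective_linearMap (M := W)
    (Algebra.linearMap K (PolyForm K n)) algebraMap_injective).comp
      (TensorProduct.lid K W).symm.injective) ?_
  simpa using h

variable [CharZero K]

/-- Integration over the simplex, with coefficients. -/
def integralT (n : ℕ) (W : Type u) [AddCommGroup W] [Module K W] : PolyForm K n ⊗[K] W →ₗ[K] W :=
  (TensorProduct.lid K W).toLinearMap ∘ₗ (integral K n).rTensor W

theorem integralT_lTensor (n : ℕ) {W W' : Type u} [AddCommGroup W] [Module K W] [AddCommGroup W']
    [Module K W'] (f : W →ₗ[K] W') (x : PolyForm K n ⊗[K] W) :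
    integralT n W' (f.lTensor _ x) = f (integralT n W x) := by
  induction x using TensorProduct.induction_on with
  | zero => simp
  | tmul a w => simp [integralT]
  | add x y hx hy => simp only [map_add, hx, hy]

/-- Stokes' theorem with coefficients. -/
theorem integralT_d (n : ℕ) {W : Type u} [AddCommGroup W] [Module K W]
    {y : PolyForm K (n + 1) ⊗[K] W} (hy : y ∈ (forms K (n + 1) n).tens W) :
    integralT (n + 1) W (d.rTensor W y) =
      ∑ k : Fin (n + 2), (-1 : K) ^ (k : ℕ) • integralT n W (faceT k W y) := by
  obtain ⟨y, rfl⟩ := hy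
  induction y using TensorProduct.induction_on with
  | zero => simp
  | tmul a w => simp [integralT, integral_d n a.1 a.2, Finset.sum_smul, mul_smul]
  | add x y hx hy => simp only [map_add, hx, hy, smul_add, Finset.sum_add_distrib]

/-- If the Čech cohomology of `V` vanishes in degree `i + 1`, so does its Thom–Whitney
cohomology. -/
theorem IsTW.exists_primitive {i : ℕ}
    (hV : ∀ v : V.obj (i + 1), V.cechD (i + 1) v = 0 → ∃ w, V.cechD i w = v)
    {x : ∀ n, PolyForm K n ⊗[K] V.obj n} (hx : V.IsTW (i + 1) x)
    (hd : ∀ n, d.rTensor _ (x n) = 0) :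
    ∃ y, V.IsTW i y ∧ ∀ n, d.rTensor _ (y n) = x n := by
  -- Stokes on the `(i + 2)`-simplex, where `x` is closed, makes the integral of `x (i + 1)` a Čech
  -- cocycle.
  obtain ⟨b, hb⟩ := hV (integralT _ _ (x (i + 1))) (by
    rw [cechD_apply, ← map_zero (integralT (K := K) (i + 1 + 1) (V.obj (i + 1 + 1))), ← hd (i + 1 + 1),
      integralT_d _ (hx.mem _)]
    refine Finset.sum_congr rfl fun k _ => ?_
    rw [hx.face, integralT_lTensor])
  obtain ⟨u, hu, hu1⟩ := exists_integral_eq_one (K := K) i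
  have hub : ∃ z ∈ (forms K i i).tens (V.obj i), integralT i _ z = b :=
    ⟨u ⊗ₜ b, Submodule.tmul_mem_tens hu b, by simp [integralT, hu1]⟩
  have hdz : ∀ n ≤ i, ∀ z ∈ (forms K n i).tens (V.obj n), d.rTensor _ z = x n := by
    intro n hn z hz
    rw [hx.eq_zero (by lia), eq_zero_of_mem (by lia) (d_mem hz)]
  -- The normalization of the integral of `y i` to `b` prepares dimension `i + 1`, the only one in
  -- which the relative Poincaré lemma has an obstruction.
  suffices h : ∃ y, V.IsTW i y ∧ ∀ n, d.rTensor _ (y n) = x n ∧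
      ∀ h : n = i, integralT n _ (y n) = h ▸ b by
    obtain ⟨y, hy, hyR⟩ := h
    exact ⟨y, hy, fun n => (hyR n).1⟩
  refine exists_isTW (V := V) (i := i)
    (fun n y => d.rTensor _ y = x n ∧ ∀ h : n = i, integralT n _ y = h ▸ b) ?_ ?_
  · rcases Nat.eq_zero_or_pos i with rfl | hi
    · obtain ⟨z, hz, hzb⟩ := hub
      exact ⟨z, hz, hdz 0 le_rfl z hz, fun _ => hzb⟩
    · exact ⟨0, zero_mem _, hdz 0 (by lia) 0 (zero_mem _), fun h => by lia⟩
  · intro n w hw hwR y hy hyw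
    rcases lt_trichotomy (n + 1) i with hn | rfl | hn
    · exact ⟨y, hy, hyw, hdz _ hn.le y hy, fun h => by lia⟩
    -- In dimension `i` the component can be chosen freely: its boundary values are `i`-forms on
    -- smaller simplices and vanish.
    · obtain ⟨z, hz, hzb⟩ := hub
      refine ⟨z, hz, fun k => ?_, hdz _ le_rfl z hz, fun _ => hzb⟩
      rw [eq_zero_of_mem (by lia) (faceT_mem k hz), eq_zero_of_mem (by lia) hw, map_zero]
    · have h1 : x (n + 1) - d.rTensor _ y ∈ (forms K (n + 1) (i + 1)).tens _ :=
        sub_mem (hx.mem _) (d_mem hy)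
      obtain ⟨z, hz, hzf, hzd⟩ := exists_relative_primitive_tens h1
        (by rw [map_sub, hd, d_d_tens, sub_zero]) (fun k => by
          rw [map_sub, hx.face, faceT_d, hyw, ThomWhitney.rTensor_lTensor, hwR.1, sub_self])
        (by lia) (by
          -- Stokes gives `∫ d y = cechD b`, because the faces of `y` are the cofaces of a cochain
          -- with integral `b`; this equals `∫ x (i + 1)`.
          rintro rfl
          apply (TensorProduct.lid K (V.obj (i + 1))).injective
          change integralT _ _ _ = _
          rw [map_sub, map_zero, ← hb, integralT_d _ hy, cechD_apply, sub_eq_zero]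
          refine Finset.sum_congr rfl fun k _ => ?_
          rw [hyw, integralT_lTensor, hwR.2 rfl])
      refine ⟨y + z, add_mem hy hz, fun k => by rw [map_add, hyw, hzf, add_zero], ?_,
        fun h => by lia⟩
      rw [map_add, hzd, add_sub_cancel]

/-- A closed Thom–Whitney cochain of degree zero is constant. -/
theorem IsTW.exists_eq_one_tmul {x : ∀ n, PolyForm K n ⊗[K] V.obj n} (hx : V.IsTW 0 x)
    (hd : ∀ n, d.rTensor _ (x n) = 0) :
    ∃ v : ∀ n, V.obj n, (∀ n, x n = 1 ⊗ₜ v n) ∧ ∀ n k, v (n + 1) = V.face n k (v n) := by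
  have h1 : ∀ n, ∃ v : V.obj n, x n = 1 ⊗ₜ v := by
    intro n
    -- Closedness passes to the coefficients of `x n`, and a closed function is a scalar.
    obtain ⟨y, -, hy⟩ := Submodule.exists_mem_tens_of_forall (T := (⊤ : Submodule K K))
      (Algebra.linearMap K (PolyForm K n)) (hx.mem n) fun c hc h => by
        obtain ⟨r, rfl⟩ := exists_eq_algebraMap hc (h _ _ (hd n))
        exact ⟨r, trivial, rfl⟩
    refine ⟨TensorProduct.lid K _ y, ?_⟩
    rw [← hy]
    obtain ⟨w, rfl⟩ := (TensorProduct.lid K (V.obj n)).symm.surjective y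
    simp
  choose v hv using h1
  refine ⟨v, hv, fun n k => ?_⟩
  have h2 := hx.face n k
  rw [hv, hv] at h2
  simp only [LinearMap.rTensor_tmul, AlgHom.toLinearMap_apply, map_one, LinearMap.lTensor_tmul] at h2
  exact one_tmul_injective n h2

end SemicosimplicialModule

end

noncomputable section

/-! ### A criterion for quasi-isomorphisms -/

namespace CochainComplex

variable {K : Type u} [Field K] {M N : CochainComplex (ModuleCat.{u} K) ℤ}

/-- The mapping cone of `f` is exact. -/
def ConeExact (f : M ⟶ N) : Prop :=
  ∀ h i j k : ℤ, h + 1 = i → i + 1 = j → j + 1 = k → ∀ (m : M.X j) (n : N.X i),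
    M.d j k m = 0 → f.f j m = N.d i j n →
      ∃ m' : M.X i, M.d i j m' = m ∧ ∃ n' : N.X h, f.f i m' + N.d h i n' = n

theorem exists_toCycles_of_homologyπ_eq_zero {i j : ℤ} (hij : i + 1 = j) (c : M.cycles j)
    (hc : M.homologyπ j c = 0) : ∃ a : M.X i, M.toCycles i j a = c := by
  have h := ShortComplex.exact_of_g_is_cokernel
    (ShortComplex.mk (M.toCycles i j) (M.homologyπ j) (by simp))
    (M.homologyIsCokernel i j (by simp [← hij]))
  exact (ShortComplex.moduleCat_exact_iff _).1 h c hc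

theorem exists_iCycles_eq {j k : ℤ} (hjk : j + 1 = k) (a : M.X j) (ha : M.d j k a = 0) :
    ∃ c : M.cycles j, M.iCycles j c = a := by
  have h := ShortComplex.exact_of_f_is_kernel
    (ShortComplex.mk (M.iCycles j) (M.d j k) (by simp))
    (M.cyclesIsKernel j k (by simp [← hjk]))
  exact (ShortComplex.moduleCat_exact_iff _).1 h a ha

theorem iCycles_injective (j : ℤ) : Function.Injective (M.iCycles j) :=
  (ModuleCat.mono_iff_injective _).1 inferInstance

theorem homologyπ_surjective (j : ℤ) : Function.Surjective (M.homologyπ j) :=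
  (ModuleCat.epi_iff_surjective _).1 inferInstance

/-- A cocycle `c` whose image is `d b` gives the cone cocycle `(c, b)`, whose exactness makes `c` a
boundary: injectivity. A cocycle `n` of the target gives `(0, n)`, whose exactness makes `n`
cohomologous to an image: surjectivity. -/
theorem ConeExact.quasiIso {f : M ⟶ N} (hf : ConeExact f) : QuasiIso f := by
  rw [quasiIso_iff]
  intro j
  rw [quasiIsoAt_iff_isIso_homologyMap]
  have hπ : ∀ (a : M.cycles j), HomologicalComplex.homologyMap f j (M.homologyπ j a) =
      N.homologyπ j (HomologicalComplex.cyclesMap f j a) := fun a => by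
    rw [← ModuleCat.comp_apply, HomologicalComplex.homologyπ_naturality, ModuleCat.comp_apply]
  have hi : ∀ (a : M.cycles j), N.iCycles j (HomologicalComplex.cyclesMap f j a) =
      f.f j (M.iCycles j a) := fun a => by
    rw [← ModuleCat.comp_apply, HomologicalComplex.cyclesMap_i, ModuleCat.comp_apply]
  have hd {P : CochainComplex (ModuleCat.{u} K) ℤ} (a : P.cycles j) :
      P.d j (j + 1) (P.iCycles j a) = 0 := by
    rw [← ModuleCat.comp_apply, HomologicalComplex.iCycles_d]; rfl
  have ht {P : CochainComplex (ModuleCat.{u} K) ℤ} (a : P.X (j - 1)) :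
      P.iCycles j (P.toCycles (j - 1) j a) = P.d (j - 1) j a := by
    rw [← ModuleCat.comp_apply, HomologicalComplex.toCycles_i]
  have hz {P : CochainComplex (ModuleCat.{u} K) ℤ} (a : P.X (j - 1)) :
      P.homologyπ j (P.toCycles (j - 1) j a) = 0 := by
    rw [← ModuleCat.comp_apply, HomologicalComplex.toCycles_comp_homologyπ]; rfl
  have : Mono (HomologicalComplex.homologyMap f j) := by
    rw [ModuleCat.mono_iff_injective, injective_iff_map_eq_zero]
    intro z hz0
    obtain ⟨c, rfl⟩ := homologyπ_surjective j z
    rw [hπ] at hz0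
    obtain ⟨b, hb⟩ := exists_toCycles_of_homologyπ_eq_zero (i := j - 1) (by lia) _ hz0
    obtain ⟨a, ha, -⟩ := hf (j - 1 - 1) (j - 1) j (j + 1) (by lia) (by lia) rfl (M.iCycles j c) b
      (hd c) (by rw [← hi, ← hb, ht])
    rw [← ht] at ha
    rw [← iCycles_injective j ha, hz]
  have : Epi (HomologicalComplex.homologyMap f j) := by
    rw [ModuleCat.epi_iff_surjective]
    intro z
    obtain ⟨c, rfl⟩ := homologyπ_surjective j z
    obtain ⟨a, ha, n, hn⟩ := hf (j - 1) j (j + 1) (j + 1 + 1) (by lia) rfl rfl 0 (N.iCycles j c)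
      (by simp) (by rw [hd]; simp)
    obtain ⟨a, rfl⟩ := exists_iCycles_eq rfl a ha
    refine ⟨M.homologyπ j a, ?_⟩
    rw [hπ, ← add_zero (N.homologyπ j _), ← hz n, ← map_add]
    congr 1
    apply iCycles_injective j
    rw [map_add, hi, ht, hn]
  exact isIso_of_mono_of_epi _

end CochainComplex

/-! ### Exactness of Thom–Whitney cochains on cones. -/

namespace SemicosimplicialModule

variable {K : Type u} [Field K]

/-- The product of two semicosimplicial vector spaces. -/
@[reducible]
def prod (V W : SemicosimplicialModule K) : SemicosimplicialModule K where
  obj n := ModuleCat.of K (V.obj n × W.obj n)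
  face n k := (V.face n k).prodMap (W.face n k)
  face_face n l k h x := Prod.ext (V.face_face n l k h x.1) (W.face_face n l k h x.2)

theorem IsTW.map {V W : SemicosimplicialModule K} (f : ∀ n, V.obj n →ₗ[K] W.obj n)
    (hf : ∀ n k v, f (n + 1) (V.face n k v) = W.face n k (f n v)) {i : ℕ}
    {x : ∀ n, PolyForm K n ⊗[K] V.obj n} (hx : V.IsTW i x) :
    W.IsTW i fun n => (f n).lTensor _ (x n) where
  mem n := Submodule.lTensor_mem_tens _ (hx.mem n)
  face n k := by
    rw [PolyForm.faceT, ThomWhitney.rTensor_lTensor]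
    erw [hx.face n k]
    rw [← LinearMap.lTensor_comp_apply, ← LinearMap.lTensor_comp_apply]
    congr 2
    ext v
    exact hf n k v

theorem IsTW.add {V : SemicosimplicialModule K} {i : ℕ} {x y : ∀ n, PolyForm K n ⊗[K] V.obj n}
    (hx : V.IsTW i x) (hy : V.IsTW i y) : V.IsTW i fun n => x n + y n where
  mem n := add_mem (hx.mem n) (hy.mem n)
  face n k := by rw [map_add, map_add, hx.face, hy.face]

/-- The cone of a map of complexes of semicosimplicial vector spaces that is exact in each
cosimplicial degree is exact on Thom–Whitney cochains. -/
theorem IsTW.exists_of_cone_exact {V₁ V₂ V₃ W₀ W₁ W₂ : SemicosimplicialModule K}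
    (dV : ∀ n, V₁.obj n →ₗ[K] V₂.obj n) (dV' : ∀ n, V₂.obj n →ₗ[K] V₃.obj n)
    (dW : ∀ n, W₀.obj n →ₗ[K] W₁.obj n) (dW' : ∀ n, W₁.obj n →ₗ[K] W₂.obj n)
    (f : ∀ n, V₁.obj n →ₗ[K] W₁.obj n) (f' : ∀ n, V₂.obj n →ₗ[K] W₂.obj n)
    (hdV : ∀ n k v, dV (n + 1) (V₁.face n k v) = V₂.face n k (dV n v))
    (hdW : ∀ n k v, dW (n + 1) (W₀.face n k v) = W₁.face n k (dW n v))
    (hf : ∀ n k v, f (n + 1) (V₁.face n k v) = W₁.face n k (f n v))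
    (hVV : ∀ n v, dV' n (dV n v) = 0) (hWW : ∀ n v, dW' n (dW n v) = 0)
    (hfd : ∀ n v, f' n (dV n v) = dW' n (f n v))
    (hex : ∀ n v w, dV' n v = 0 → f' n v = dW' n w → ∃ v' w', dV n v' = v ∧ f n v' + dW n w' = w)
    {i : ℕ} {x : ∀ n, PolyForm K n ⊗[K] V₂.obj n} {y : ∀ n, PolyForm K n ⊗[K] W₁.obj n}
    (hx : V₂.IsTW i x) (hy : W₁.IsTW i y) (hdx : ∀ n, (dV' n).lTensor _ (x n) = 0)
    (hxy : ∀ n, (f' n).lTensor _ (x n) = (dW' n).lTensor _ (y n)) :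
    ∃ x' y', V₁.IsTW i x' ∧ W₀.IsTW i y' ∧ (∀ n, (dV n).lTensor _ (x' n) = x n) ∧
      ∀ n, (f n).lTensor _ (x' n) + (dW n).lTensor _ (y' n) = y n := by
  -- The pair `(x, y)` becomes one cochain with values in `V₂ × W₁`, to be lifted along the cone
  -- differentials `V₁ × W₀ → V₂ × W₁ → V₃ × W₂`.
  have hz : (V₂.prod W₁).IsTW i fun n =>
      (LinearMap.inl K (V₂.obj n) (W₁.obj n)).lTensor _ (x n) +
        (LinearMap.inr K (V₂.obj n) (W₁.obj n)).lTensor _ (y n) := by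
    refine IsTW.add (V := V₂.prod W₁)
      (hx.map (W := V₂.prod W₁) (fun n => LinearMap.inl K (V₂.obj n) (W₁.obj n)) fun n k v => ?_)
      (hy.map (W := V₂.prod W₁) (fun n => LinearMap.inr K (V₂.obj n) (W₁.obj n)) fun n k v => ?_)
    · exact Prod.ext rfl (map_zero (W₁.face n k)).symm
    · exact Prod.ext (map_zero (V₂.face n k)).symm rfl
  have key := hz.exists_lift (V' := V₁.prod W₀) (V'' := V₃.prod W₂)
    (fun n => LinearMap.prod (dV n ∘ₗ LinearMap.fst K (V₁.obj n) (W₀.obj n))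
      (f n ∘ₗ LinearMap.fst K (V₁.obj n) (W₀.obj n) + dW n ∘ₗ LinearMap.snd K (V₁.obj n) (W₀.obj n)))
    (fun n => LinearMap.prod (dV' n ∘ₗ LinearMap.fst K (V₂.obj n) (W₁.obj n))
      (f' n ∘ₗ LinearMap.fst K (V₂.obj n) (W₁.obj n) -
        dW' n ∘ₗ LinearMap.snd K (V₂.obj n) (W₁.obj n)))
    (fun n k v => Prod.ext (hdV n k v.1) (by
      change f (n + 1) (V₁.face n k v.1) + dW (n + 1) (W₀.face n k v.2) =
        W₁.face n k (f n v.1 + dW n v.2)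
      rw [hf, hdW, map_add]))
    (fun n v hv => by
      obtain ⟨v', w', h1, h2⟩ := hex n v.1 v.2 (congrArg Prod.fst hv)
        (sub_eq_zero.1 (congrArg Prod.snd hv))
      exact ⟨(v', w'), Prod.ext h1 h2⟩)
  obtain ⟨z, hz', hFz⟩ := key (fun n => by
      rw [map_add, ← LinearMap.lTensor_comp_apply, ← LinearMap.lTensor_comp_apply,
        show LinearMap.prod (dV' n ∘ₗ LinearMap.fst K (V₂.obj n) (W₁.obj n))
          (f' n ∘ₗ LinearMap.fst K (V₂.obj n) (W₁.obj n) -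
            dW' n ∘ₗ LinearMap.snd K (V₂.obj n) (W₁.obj n)) ∘ₗ LinearMap.inl K _ _ =
            LinearMap.inl K _ _ ∘ₗ dV' n + LinearMap.inr K _ _ ∘ₗ f' n from
          LinearMap.ext fun v => by simp,
        show LinearMap.prod (dV' n ∘ₗ LinearMap.fst K (V₂.obj n) (W₁.obj n))
          (f' n ∘ₗ LinearMap.fst K (V₂.obj n) (W₁.obj n) -
            dW' n ∘ₗ LinearMap.snd K (V₂.obj n) (W₁.obj n)) ∘ₗ LinearMap.inr K _ _ =
            -(LinearMap.inr K _ _ ∘ₗ dW' n) from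
          LinearMap.ext fun v => by simp,
        LinearMap.lTensor_add, LinearMap.lTensor_neg, LinearMap.add_apply, LinearMap.neg_apply,
        LinearMap.lTensor_comp_apply, LinearMap.lTensor_comp_apply, LinearMap.lTensor_comp_apply,
        hdx, hxy, map_zero, zero_add, add_neg_cancel])
    (fun n v => Prod.ext (hVV n v.1) (by
      change f' n (dV n v.1) - dW' n (f n v.1 + dW n v.2) = 0
      rw [hfd, map_add, hWW, add_zero, sub_self]))
  have h1 := IsTW.map (V := V₁.prod W₀) (W := V₁) (fun n => LinearMap.fst K (V₁.obj n) (W₀.obj n))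
    (fun n k v => by rw [LinearMap.fst_apply, LinearMap.fst_apply, LinearMap.prodMap_apply]) hz'
  have h2 := IsTW.map (V := V₁.prod W₀) (W := W₀) (fun n => LinearMap.snd K (V₁.obj n) (W₀.obj n))
    (fun n k v => by rw [LinearMap.snd_apply, LinearMap.snd_apply, LinearMap.prodMap_apply]) hz'
  refine ⟨_, _, h1, h2, fun n => ?_, fun n => ?_⟩
  · have h3 := congrArg ((LinearMap.fst K (V₂.obj n) (W₁.obj n)).lTensor _) (hFz n)
    rw [← LinearMap.lTensor_comp_apply, map_add, ← LinearMap.lTensor_comp_apply,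
      ← LinearMap.lTensor_comp_apply, LinearMap.fst_prod] at h3
    rw [← LinearMap.lTensor_comp_apply, h3, LinearMap.fst_comp_inl, LinearMap.fst_comp_inr]
    simp
  · have h3 := congrArg ((LinearMap.snd K (V₂.obj n) (W₁.obj n)).lTensor _) (hFz n)
    rw [← LinearMap.lTensor_comp_apply, map_add, ← LinearMap.lTensor_comp_apply,
      ← LinearMap.lTensor_comp_apply, LinearMap.snd_prod] at h3
    rw [← LinearMap.lTensor_comp_apply, ← LinearMap.lTensor_comp_apply, ← LinearMap.add_apply,
      ← LinearMap.lTensor_add, h3, LinearMap.snd_comp_inl, LinearMap.snd_comp_inr]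
    simp

end SemicosimplicialModule

namespace SemicosimplicialDGLA

variable {K : Type u} [Field K]

/-- The semicosimplicial vector space of elements of degree `j`. -/
def deg (g : SemicosimplicialDGLA K) (j : ℤ) : SemicosimplicialModule K where
  obj n := (g.obj n).cx.X j
  face n k := ((g.face n k).f.f j).hom
  face_face n l k h x := congrArg (fun ψ => (ψ.f.f j).hom x) (g.face_face n l k h)

theorem isTW_of_mem {g : SemicosimplicialDGLA K} {i : ℕ} {j : ℤ}
    (x : ThomWhitney.bicomplex g i j) : (g.deg j).IsTW i x.1 :=
  ⟨x.2.1, x.2.2⟩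

variable {g h : SemicosimplicialDGLA K}

theorem Hom.app_face (φ : g.Hom h) (n : ℕ) (k : Fin (n + 2)) (j : ℤ) (x : (g.obj n).cx.X j) :
    (φ.app (n + 1)).f.f j ((g.face n k).f.f j x) = (h.face n k).f.f j ((φ.app n).f.f j x) :=
  congrArg (fun ψ => (ψ.f.f j).hom x) (φ.face_app n k)

end SemicosimplicialDGLA

namespace DGLA

variable {K : Type u} [Field K]

theorem Hom.f_d {L M : DGLA K} (φ : L ⟶ M) (i j : ℤ) (x : L.cx.X i) :
    φ.f.f j (L.cx.d i j x) = M.cx.d i j (φ.f.f i x) :=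
  (congrArg (fun ψ => ψ.hom x) (φ.f.comm i j)).symm

theorem d_d (L : DGLA K) (i j k : ℤ) (x : L.cx.X i) : L.cx.d j k (L.cx.d i j x) = 0 :=
  congrArg (fun ψ => ψ.hom x) (L.cx.d_comp_d i j k)

end DGLA

namespace ThomWhitney

variable {K : Type u} [Field K]

open SemicosimplicialDGLA SemicosimplicialModule CochainComplex

section column

variable {g h : SemicosimplicialDGLA K}

/-- The column of a given form degree of the Thom–Whitney bicomplex depends exactly on the
semicosimplicial DGLA. -/
theorem exists_of_coneExact (φ : g.Hom h) (hφ : ∀ n, ConeExact (φ.app n).f) (i : ℕ)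
    (j₀ j₁ j₂ j₃ : ℤ) (h₀ : j₀ + 1 = j₁) (h₁ : j₁ + 1 = j₂) (h₂ : j₂ + 1 = j₃)
    (x : bicomplex g i j₂) (y : bicomplex h i j₁) (hx : dLie g i j₂ j₃ x = 0)
    (hxy : bicomplexMap φ i j₂ x = dLie h i j₁ j₂ y) :
    ∃ (x' : bicomplex g i j₁) (y' : bicomplex h i j₀), dLie g i j₁ j₂ x' = x ∧
      bicomplexMap φ i j₁ x' + dLie h i j₀ j₁ y' = y := by
  obtain ⟨x', y', hx', hy', h3, h4⟩ := IsTW.exists_of_cone_exact (V₁ := g.deg j₁) (V₂ := g.deg j₂)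
    (V₃ := g.deg j₃) (W₀ := h.deg j₀) (W₁ := h.deg j₁) (W₂ := h.deg j₂)
    (fun n => ((g.obj n).cx.d j₁ j₂).hom) (fun n => ((g.obj n).cx.d j₂ j₃).hom)
    (fun n => ((h.obj n).cx.d j₀ j₁).hom) (fun n => ((h.obj n).cx.d j₁ j₂).hom)
    (fun n => ((φ.app n).f.f j₁).hom) (fun n => ((φ.app n).f.f j₂).hom)
    (fun n k v => ((g.face n k).f_d j₁ j₂ v).symm) (fun n k v => ((h.face n k).f_d j₀ j₁ v).symm)
    (fun n k v => φ.app_face n k j₁ v) (fun n v => (g.obj n).d_d _ _ _ v)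
    (fun n v => (h.obj n).d_d _ _ _ v) (fun n v => (φ.app n).f_d _ _ v)
    (fun n v w hv hvw => by
      obtain ⟨m, hm, n', hn⟩ := hφ n j₀ j₁ j₂ j₃ h₀ h₁ h₂ v w hv hvw
      exact ⟨m, n', hm, hn⟩)
    (isTW_of_mem x) (isTW_of_mem y) (fun n => congrArg (fun z => z.1 n) hx)
    (fun n => congrArg (fun z => z.1 n) hxy)
  exact ⟨⟨x', hx'.1, hx'.2⟩, ⟨y', hy'.1, hy'.2⟩, Subtype.ext (funext h3), Subtype.ext (funext h4)⟩

end column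

end ThomWhitney

end

/-! ### Clearing the total complex by form degree. -/

noncomputable section

namespace ThomWhitney

variable {K : Type u} [Field K]

open SemicosimplicialDGLA SemicosimplicialModule CochainComplex

section components

variable (g : SemicosimplicialDGLA K)

/-- The projection of the total complex onto `C^{i,j}_TW(g)`. -/
def comp (m : ℤ) (i : ℕ) (j : ℤ) (h : (i : ℤ) + j = m) : totX g m →ₗ[K] bicomplex g i j :=
  DirectSum.component K { p : ℕ × ℤ // (p.1 : ℤ) + p.2 = m }
    (fun p => bicomplex g p.1.1 p.1.2) ⟨(i, j), h⟩

variable {g}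

theorem comp_inc_self (m : ℤ) (i : ℕ) (j : ℤ) (h : (i : ℤ) + j = m) (x : bicomplex g i j) :
    comp g m i j h (inc g m i j h x) = x :=
  DirectSum.component.lof_self ..

theorem comp_inc_of_ne (m : ℤ) {i i' : ℕ} {j j' : ℤ} (h : (i : ℤ) + j = m)
    (h' : (i' : ℤ) + j' = m) (hi : i' ≠ i) (x : bicomplex g i' j') :
    comp g m i j h (inc g m i' j' h' x) = 0 := by
  rw [comp, inc, DirectSum.component.of, dif_neg]
  intro h
  exact hi (congrArg (fun p => p.1.1) h)

theorem tot_ext {m : ℤ} {x y : totX g m} (h : ∀ i j hij, comp g m i j hij x = comp g m i j hij y) :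
    x = y :=
  DirectSum.ext_component K fun p => h p.1.1 p.1.2 p.2

theorem comp_totD_zero {m m' : ℤ} (h : m + 1 = m') (h0 : ((0 : ℕ) : ℤ) + m = m)
    (h0' : ((0 : ℕ) : ℤ) + m' = m') (x : totX g m) :
    comp g m' 0 m' h0' (totD g m m' h x) = dLie g 0 m m' (comp g m 0 m h0 x) := by
  induction x using tot_induction with
  | zero => simp
  | add x y hx hy => simp only [map_add, hx, hy]
  | inc a b hab x =>
    subst h
    rw [totD_inc, map_add, map_smul, comp_inc_of_ne _ _ _ (by simp), zero_add]
    by_cases ha : a = 0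
    · subst ha
      obtain rfl : b = m := by simpa using hab
      rw [comp_inc_self, comp_inc_self]
      simp
    · rw [comp_inc_of_ne _ _ _ ha, comp_inc_of_ne _ _ _ ha]
      simp

theorem comp_totD_succ {m m' : ℤ} (h : m + 1 = m') {i : ℕ} {j j' : ℤ} (hj : j' + 1 = j)
    (h1 : ((i + 1 : ℕ) : ℤ) + j = m') (h2 : (i : ℤ) + j = m) (h3 : ((i + 1 : ℕ) : ℤ) + j' = m)
    (x : totX g m) :
    comp g m' (i + 1) j h1 (totD g m m' h x) = dForm g i j (comp g m i j h2 x) +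
      (-1 : K) ^ ((i + 1 : ℕ) : ℤ) • dLie g (i + 1) j' j (comp g m (i + 1) j' h3 x) := by
  induction x using tot_induction with
  | zero => simp
  | add x y hx hy => simp only [map_add, hx, hy, smul_add]; abel
  | inc a b hab x =>
    subst h hj
    rw [totD_inc, map_add, map_smul]
    by_cases ha : a = i
    · subst ha
      obtain rfl : b = j' + 1 := by lia
      rw [comp_inc_self, comp_inc_of_ne _ _ _ (by simp), comp_inc_self,
        comp_inc_of_ne _ _ _ (by simp)]
      simp
    · rw [comp_inc_of_ne (i := i + 1) _ _ _ (by simpa using ha), comp_inc_of_ne (i := i) _ _ _ ha]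
      by_cases ha' : a = i + 1
      · subst ha'
        obtain rfl : b = j' := by lia
        rw [comp_inc_self, comp_inc_self]
        simp
      · rw [comp_inc_of_ne _ _ _ ha', comp_inc_of_ne _ _ _ ha']
        simp

theorem comp_totXMap {h : SemicosimplicialDGLA K} (φ : g.Hom h) (m : ℤ) (i : ℕ) (j : ℤ)
    (hij : (i : ℤ) + j = m) (x : totX g m) :
    comp h m i j hij (totXMap φ m x) = bicomplexMap φ i j (comp g m i j hij x) := by
  induction x using tot_induction with
  | zero => simp
  | add x y hx hy => simp only [map_add, hx, hy]
  | inc a b hab x =>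
    rw [totXMap_inc]
    by_cases ha : a = i
    · subst ha
      obtain rfl : b = j := by lia
      rw [comp_inc_self, comp_inc_self]
    · rw [comp_inc_of_ne _ _ _ ha, comp_inc_of_ne _ _ _ ha, map_zero]

/-- The components of form degree less than `p` vanish. -/
def VanishesBelow {m : ℤ} (p : ℕ) (x : totX g m) : Prop :=
  ∀ i j h, i < p → comp g m i j h x = 0

/-- The components of form degree at least `p` vanish. -/
def VanishesAbove {m : ℤ} (p : ℕ) (x : totX g m) : Prop :=
  ∀ i j h, p ≤ i → comp g m i j h x = 0

theorem exists_vanishesAbove {m : ℤ} (x : totX g m) : ∃ p, VanishesAbove p x := by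
  induction x using tot_induction with
  | zero => exact ⟨0, fun i j h _ => map_zero _⟩
  | add x y hx hy =>
    obtain ⟨p, hp⟩ := hx
    obtain ⟨q, hq⟩ := hy
    exact ⟨max p q, fun i j h hi => by rw [map_add, hp _ _ _ (by lia), hq _ _ _ (by lia), add_zero]⟩
  | inc a b hab x =>
    exact ⟨a + 1, fun i j h hi => comp_inc_of_ne _ _ _ (by lia) _⟩

/-- The `d ⊗ 1` contribution to form degree `p` comes from form degree `p - 1`, where `x` vanishes;
only the Lie differential is left. -/
theorem VanishesBelow.comp_totD {m m' : ℤ} (h : m + 1 = m') {p : ℕ} {x : totX g m}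
    (hx : VanishesBelow p x) {j j' : ℤ} (hj : (p : ℤ) + j = m) (hj' : (p : ℤ) + j' = m') :
    comp g m' p j' hj' (totD g m m' h x) =
      (-1 : K) ^ (p : ℤ) • dLie g p j j' (comp g m p j hj x) := by
  cases p with
  | zero =>
    obtain rfl : j = m := by simpa using hj
    obtain rfl : j' = m' := by simpa using hj'
    rw [comp_totD_zero h (by simp)]
    simp
  | succ p =>
    rw [comp_totD_succ h (j' := j) (by lia) _ (by push_cast at hj'; lia) hj,
      hx _ _ _ (Nat.lt_succ_self p), map_zero, zero_add]

theorem VanishesBelow.sub_inc {m : ℤ} {p : ℕ} {x y : totX g m} (hx : VanishesBelow p x)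
    (hy : VanishesBelow p y) {j : ℤ} (hj : (p : ℤ) + j = m)
    (h : comp g m p j hj x = comp g m p j hj y) : VanishesBelow (p + 1) (x - y) := by
  intro i j' h' hi
  rw [map_sub]
  rcases Nat.lt_succ_iff_lt_or_eq.1 hi with hi | rfl
  · rw [hx _ _ _ hi, hy _ _ _ hi, sub_zero]
  · obtain rfl : j' = j := by lia
    rw [h, sub_self]

theorem vanishesBelow_inc {m : ℤ} {i p : ℕ} {j : ℤ} (h : (i : ℤ) + j = m) (hi : p ≤ i)
    (x : bicomplex g i j) : VanishesBelow p (inc g m i j h x) :=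
  fun _ _ _ h' => comp_inc_of_ne _ _ _ (by lia) _

theorem VanishesBelow.add {m : ℤ} {p : ℕ} {x y : totX g m} (hx : VanishesBelow p x)
    (hy : VanishesBelow p y) : VanishesBelow p (x + y) :=
  fun i j h hi => by rw [map_add, hx i j h hi, hy i j h hi, add_zero]

theorem VanishesBelow.smul {m : ℤ} {p : ℕ} (r : K) {x : totX g m} (hx : VanishesBelow p x) :
    VanishesBelow p (r • x) :=
  fun i j h hi => by rw [map_smul, hx i j h hi, smul_zero]

theorem VanishesBelow.totD {m m' : ℤ} (h : m + 1 = m') {p : ℕ} {x : totX g m}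
    (hx : VanishesBelow p x) : VanishesBelow p (totD g m m' h x) := by
  intro i j hij hi
  have hx' : VanishesBelow i x := fun a b hab ha => hx a b hab (ha.trans hi)
  rw [hx'.comp_totD h (j := j - 1) (by lia), hx _ _ _ hi, map_zero, smul_zero]

theorem VanishesBelow.totXMap {h : SemicosimplicialDGLA K} (φ : g.Hom h) {m : ℤ} {p : ℕ}
    {x : totX g m} (hx : VanishesBelow p x) : VanishesBelow p (totXMap φ m x) :=
  fun i j hij hi => by rw [comp_totXMap, hx _ _ _ hi, map_zero]

theorem subsingleton_bicomplex {i : ℕ} {j : ℤ} (h : ∀ n, Subsingleton ((g.obj n).cx.X j)) :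
    Subsingleton (bicomplex g i j) := by
  refine ⟨fun x y => Subtype.ext (funext fun n => ?_)⟩
  have := h n
  exact Subsingleton.elim (α := PolyForm K n ⊗[K] (g.obj n).cx.X j) _ _

/-- In total degree `m`, form degree at least `p` forces Lie degree at most `m - p`. With bounded
below coefficients this ends the upward induction. -/
theorem VanishesBelow.eq_zero {m : ℤ} {p : ℕ} {x : totX g m} (hx : VanishesBelow p x)
    (hg : ∀ j, p + j ≤ m → ∀ n, Subsingleton ((g.obj n).cx.X j)) : x = 0 := by
  refine tot_ext fun i j hij => ?_
  rw [map_zero]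
  rcases lt_or_ge i p with hi | hi
  · exact hx _ _ _ hi
  · have := subsingleton_bicomplex (i := i) (hg j (by lia))
    exact Subsingleton.elim _ _

end components

theorem tot_d (g : SemicosimplicialDGLA K) {m m' : ℤ} (h : m + 1 = m') (x : totX g m) :
    (tot g).cx.d m m' x = totD g m m' h x := by
  simp only [tot, dif_pos h]
  rfl

section functoriality

variable {g h : SemicosimplicialDGLA K}

/-- The lowest components of `x` and `y` form a cocycle of the cone of a single column. Column
exactness bounds it, and subtracting the total coboundary of that bound raises the lowest form
degree by one; `k` counts the degrees left before `P`. -/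
theorem exists_of_vanishesBelow (φ : g.Hom h) (hφ : ∀ n, ConeExact (φ.app n).f)
    {m₀ m₁ m₂ m₃ : ℤ} (h₀ : m₀ + 1 = m₁) (h₁ : m₁ + 1 = m₂) (h₂ : m₂ + 1 = m₃) (P : ℕ)
    (hg : ∀ j, P + j ≤ m₂ → ∀ n, Subsingleton ((g.obj n).cx.X j))
    (hh : ∀ j, P + j ≤ m₁ → ∀ n, Subsingleton ((h.obj n).cx.X j)) (k p : ℕ) (hp : p + k = P)
    (x : totX g m₂) (y : totX h m₁) (hxp : VanishesBelow p x) (hyp : VanishesBelow p y)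
    (hx : totD g m₂ m₃ h₂ x = 0) (hxy : totXMap φ m₂ x = totD h m₁ m₂ h₁ y) :
    ∃ x' y', totD g m₁ m₂ h₁ x' = x ∧ totXMap φ m₁ x' + totD h m₀ m₁ h₀ y' = y := by
  induction k generalizing p x y with
  | zero =>
    obtain rfl : p = P := hp
    refine ⟨0, 0, ?_, ?_⟩
    · rw [hxp.eq_zero hg, map_zero]
    · rw [hyp.eq_zero hh]
      simp
  | succ k ih =>
    have hs : (-1 : K) ^ (p : ℤ) ≠ 0 := by simp
    have hss : (-1 : K) ^ (p : ℤ) * (-1 : K) ^ (p : ℤ) = 1 := by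
      rw [← mul_zpow]; simp
    -- The factor `(-1)^p` on `y`, and later on `a`, compensates the sign of the Lie differential in
    -- the total differential.
    obtain ⟨a, b, ha, hab⟩ := exists_of_coneExact φ hφ p (m₀ - p) (m₁ - p) (m₂ - p) (m₃ - p)
      (by lia) (by lia) (by lia) (comp g m₂ p (m₂ - p) (by lia) x)
      ((-1 : K) ^ (p : ℤ) • comp h m₁ p (m₁ - p) (by lia) y)
      (by
        have h3 := hxp.comp_totD h₂ (j := m₂ - p) (j' := m₃ - p) (by lia) (by lia)
        rw [hx, map_zero] at h3
        exact (smul_eq_zero.1 h3.symm).resolve_left hs)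
      (by
        rw [← comp_totXMap, hxy, hyp.comp_totD h₁ (j := m₁ - p) (by lia), map_smul])
    have hz : VanishesBelow p ((-1 : K) ^ (p : ℤ) • inc g m₁ p (m₁ - p) (by lia) a) :=
      (vanishesBelow_inc _ le_rfl _).smul _
    have hw : VanishesBelow p (inc h m₀ p (m₀ - p) (by lia) b) := vanishesBelow_inc _ le_rfl _
    set z := (-1 : K) ^ (p : ℤ) • inc g m₁ p (m₁ - p) (by lia) a with hz_def
    set w := inc h m₀ p (m₀ - p) (by lia) b with hw_def
    obtain ⟨x', y', hx', hxy'⟩ := ih (p + 1) (by lia) (x - totD g m₁ m₂ h₁ z)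
      (y - (totXMap φ m₁ z + totD h m₀ m₁ h₀ w))
      (hxp.sub_inc (hz.totD h₁) (j := m₂ - p) (by lia) (by
        rw [hz.comp_totD h₁ (j := m₁ - p) (by lia), hz_def, map_smul, comp_inc_self, map_smul,
          smul_smul, hss, one_smul, ha]))
      (hyp.sub_inc ((hz.totXMap φ).add (hw.totD h₀)) (j := m₁ - p) (by lia) (by
        rw [map_add, hw.comp_totD h₀ (j := m₀ - p) (by lia), comp_totXMap, hz_def, hw_def,
          map_smul, comp_inc_self, comp_inc_self, map_smul, ← smul_add, hab, smul_smul, hss,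
          one_smul]))
      (by rw [map_sub, hx, totD_totD, sub_zero])
      (by rw [map_sub, hxy, totXMap_totD, map_sub, map_add, totD_totD, add_zero])
    refine ⟨x' + z, y' + w, ?_, ?_⟩
    · rw [map_add, hx', sub_add_cancel]
    · rw [map_add, map_add, add_add_add_comm, hxy', sub_add_cancel]

/-- If `g` and `h` are bounded below then `Tot_TW` turns levelwise quasi-isomorphisms into
quasi-isomorphisms. -/
theorem totMap_isQuasiIso (φ : g.Hom h) (hφ : ∀ n, ConeExact (φ.app n).f) (N : ℤ)
    (hg : ∀ j < N, ∀ n, Subsingleton ((g.obj n).cx.X j))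
    (hh : ∀ j < N, ∀ n, Subsingleton ((h.obj n).cx.X j)) : DGLA.IsQuasiIso (totMap φ) := by
  refine ConeExact.quasiIso fun m₀ m₁ m₂ m₃ h₀ h₁ h₂ x y hx hxy => ?_
  -- With this bound `P`, the inequality `P + j ≤ m₂` forces `j < N`.
  obtain ⟨x', y', h3, h4⟩ := exists_of_vanishesBelow φ hφ h₀ h₁ h₂ (m₂ - N + 1).toNat
    (fun j hj => hg j (by lia)) (fun j hj => hh j (by lia)) _ 0 (zero_add _) x y
    (fun i j h hi => by lia) (fun i j h hi => by lia)
    ((tot_d g h₂ x).symm.trans hx) (hxy.trans (tot_d h h₁ y))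
  exact ⟨x', (tot_d g h₁ x').trans h3, y',
    (congrArg (fun z : totX h m₁ => totXMap φ m₁ x' + z) (tot_d h h₀ y')).trans h4⟩

end functoriality

section augmentation

variable {g : SemicosimplicialDGLA K} {L : DGLA K}

theorem VanishesAbove.comp_totD {m m' : ℤ} (h : m + 1 = m') {p : ℕ} {x : totX g m}
    (hx : VanishesAbove (p + 1) x) {j : ℤ} (hj : (p : ℤ) + j = m)
    (hj' : ((p + 1 : ℕ) : ℤ) + j = m') :
    comp g m' (p + 1) j hj' (totD g m m' h x) = dForm g p j (comp g m p j hj x) := by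
  rw [comp_totD_succ h (j' := j - 1) (by lia) _ hj (by push_cast; lia), hx _ _ _ le_rfl, map_zero,
    smul_zero, add_zero]

/-- The total differential of `y` lies in form degree zero, so the top component of `y` is closed
for `d ⊗ 1`. In positive form degree, subtracting the coboundary of a primitive lowers the top
degree; in form degree zero a closed component comes from `L`. -/
theorem exists_of_vanishesAbove (ε : g.Augmentation L)
    (h0 : ∀ m (y : bicomplex g 0 m), dForm g 0 m y = 0 → ∃ b, augBi ε m b = y)
    (hs : ∀ q j (y : bicomplex g (q + 1) j), dForm g (q + 1) j y = 0 → ∃ w, dForm g q j w = y)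
    {m₀ m₁ m₂ : ℤ} (h₀ : m₀ + 1 = m₁) (h₁ : m₁ + 1 = m₂) (p : ℕ) (b : L.cx.X m₂)
    (y : totX g m₁) (hp : VanishesAbove p y)
    (hy : totD g m₁ m₂ h₁ y = inc g m₂ 0 m₂ (by simp) (augBi ε m₂ b)) :
    ∃ (x' : L.cx.X m₁) (y' : totX g m₀),
      inc g m₁ 0 m₁ (by simp) (augBi ε m₁ x') + totD g m₀ m₁ h₀ y' = y := by
  induction p generalizing y with
  | zero =>
    refine ⟨0, 0, ?_⟩
    simp only [map_zero, add_zero]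
    exact tot_ext fun i j h => by rw [hp i j h (Nat.zero_le i), map_zero]
  | succ p ih =>
    have hd (j : ℤ) (hj : (p : ℤ) + j = m₁) : dForm g p j (comp g m₁ p j hj y) = 0 := by
      rw [← hp.comp_totD h₁ hj (by push_cast; lia), hy, comp_inc_of_ne _ _ _ (by simp)]
    cases p with
    | zero =>
      obtain ⟨x', hx'⟩ := h0 _ _ (hd m₁ (by simp))
      refine ⟨x', 0, ?_⟩
      rw [hx', map_zero, add_zero]
      refine tot_ext fun i j h => ?_
      cases i with
      | zero =>
        obtain rfl : j = m₁ := by simpa using h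
        rw [comp_inc_self]
      | succ i => rw [comp_inc_of_ne _ _ _ (by simp), hp _ _ _ (by simp)]
    | succ q =>
      obtain ⟨w, hw⟩ := hs _ _ _ (hd (m₁ - ((q + 1 : ℕ) : ℤ)) (by lia))
      have hq : (q : ℤ) + (m₁ - ((q + 1 : ℕ) : ℤ)) = m₀ := by push_cast; lia
      have hwa : VanishesAbove (q + 1) (inc g m₀ q _ hq w) := fun i j h hi =>
        comp_inc_of_ne _ _ _ (by lia) _
      obtain ⟨x', y', hxy⟩ := ih (y - totD g m₀ m₁ h₀ (inc g m₀ q _ hq w)) (fun i j h hi => by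
        rw [map_sub]
        rcases eq_or_lt_of_le hi with rfl | hi
        · obtain rfl : j = m₁ - ((q + 1 : ℕ) : ℤ) := by lia
          rw [hwa.comp_totD h₀ hq, comp_inc_self, hw, sub_self]
        · obtain ⟨i, rfl⟩ : ∃ a, i = a + 1 := ⟨i - 1, by lia⟩
          rw [hp _ _ _ (by lia), comp_totD_succ h₀ (j' := j - 1) (by lia) _
            (by push_cast at h; lia) (by push_cast at h ⊢; lia), hwa _ _ _ (by lia),
            hwa _ _ _ (by lia)]
          simp)
        (by rw [map_sub, totD_totD, sub_zero, hy])
      exact ⟨x', y' + inc g m₀ q _ hq w, by rw [map_add, ← add_assoc, hxy, sub_add_cancel]⟩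

theorem augmentation_isQuasiIso_of_exact (ε : g.Augmentation L)
    (hinj : ∀ m, Function.Injective (augBi ε m))
    (h0 : ∀ m (y : bicomplex g 0 m), dForm g 0 m y = 0 → ∃ b, augBi ε m b = y)
    (hs : ∀ q j (y : bicomplex g (q + 1) j), dForm g (q + 1) j y = 0 → ∃ w, dForm g q j w = y) :
    DGLA.IsQuasiIso (augmentation ε) := by
  refine ConeExact.quasiIso fun m₀ m₁ m₂ m₃ h₀ h₁ h₂ x y hx hxy => ?_
  replace hxy := hxy.trans (tot_d g h₁ y)
  obtain ⟨p, hp⟩ := exists_vanishesAbove (g := g) (m := m₁) y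
  obtain ⟨x', y', h3⟩ := exists_of_vanishesAbove ε h0 hs h₀ h₁ p x y hp hxy.symm
  refine ⟨x', ?_, y', ?_⟩
  -- Applying the total differential to the decomposition of `y` shows that `d x'` and `x` have the
  -- same image in form degree zero.
  · apply hinj
    have h4 := ((augmentation ε).f_d m₁ m₂ x').trans (tot_d g h₁ _)
    have h5 : inc g m₂ 0 m₂ (by simp) (augBi ε m₂ (L.cx.d m₁ m₂ x')) =
        inc g m₂ 0 m₂ (by simp) (augBi ε m₂ x) := by
      refine Eq.trans (h4.trans ?_) hxy.symm
      rw [← h3, map_add, totD_totD, add_zero]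
      rfl
    have h6 := congrArg (comp g m₂ 0 m₂ (by simp)) h5
    rwa [comp_inc_self, comp_inc_self] at h6
  · exact (congrArg (fun z : totX g m₁ => inc g m₁ 0 m₁ (by simp) (augBi ε m₁ x') + z)
      (tot_d g h₀ y')).trans h3

/-- If each `g^j` is a resolution of `L^j` with respect to the Čech differential, then the
augmentation is a quasi-isomorphism. -/
theorem augmentation_isQuasiIso [CharZero K] (ε : g.Augmentation L)
    (hinj : ∀ m, Function.Injective (ε.hom.f.f m))
    (h0 : ∀ m (v : (g.obj 0).cx.X m), (g.face 0 0).f.f m v = (g.face 0 1).f.f m v →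
      ∃ b, ε.hom.f.f m b = v)
    (hs : ∀ m q (v : (g.deg m).obj (q + 1)), (g.deg m).cechD (q + 1) v = 0 →
      ∃ w, (g.deg m).cechD q w = v) :
    DGLA.IsQuasiIso (augmentation ε) := by
  refine augmentation_isQuasiIso_of_exact ε (fun m x y hxy => ?_) (fun m y hy => ?_)
    (fun q j y hy => ?_)
  · exact hinj m (one_tmul_injective 0 (congrArg (fun z => z.1 0) hxy))
  · obtain ⟨v, hv, hf⟩ := (isTW_of_mem y).exists_eq_one_tmul
      (fun n => congrArg (fun z => z.1 n) hy)
    obtain ⟨b, hb⟩ := h0 m (v 0) ((hf 0 0).symm.trans (hf 0 1))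
    refine ⟨b, Subtype.ext (funext fun n => ?_)⟩
    refine Eq.trans ?_ (hv n).symm
    rw [augBi_apply]
    congr 1
    induction n with
    | zero => exact hb
    | succ n ih =>
      rw [hf n (Fin.last _), ← ih]
      rfl
  · obtain ⟨w, hw, hdw⟩ := (isTW_of_mem y).exists_primitive (hs j q)
      (fun n => congrArg (fun z => z.1 n) hy)
    exact ⟨⟨w, hw.1, hw.2⟩, Subtype.ext (funext hdw)⟩

end augmentation

end ThomWhitney

end

noncomputable section

/-! ### Sections and cohomology of abelian sheaves -/

/-- The category of abelian sheaves on `X`. -/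
abbrev AbSheaf (X : TopCat.{u}) : Type _ :=
  Sheaf (Opens.grothendieckTopology X) AddCommGrpCat.{u}

namespace AbSheaf

open Abelian Limits

variable {X : TopCat.{u}}

/-- The abelian sheaf freely generated by the section `1` over `V`. -/
def free (V : Opens X) : AbSheaf X :=
  (yoneda ⋙ (Functor.whiskeringRight _ _ _).obj AddCommGrpCat.free ⋙
    presheafToSheaf (Opens.grothendieckTopology X) AddCommGrpCat.{u}).obj V

/-- Sections over `V` as morphisms from `free V`. -/
def homEquiv (V : Opens X) (F : AbSheaf X) : (free V ⟶ F) ≃ F.obj.obj (op V) :=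
  ((sheafificationAdjunction _ _).homEquiv _ _).trans <|
    ((AddCommGrpCat.adj.whiskerRight _).homEquiv _ _).trans yonedaEquiv

theorem homEquiv_comp {V : Opens X} {F G : AbSheaf X} (a : free V ⟶ F) (f : F ⟶ G) :
    homEquiv V G (a ≫ f) = f.hom.app (op V) (homEquiv V F a) := by
  let adj₁ := sheafificationAdjunction (Opens.grothendieckTopology X) AddCommGrpCat.{u}
  let adj₂ := AddCommGrpCat.adj.{u}.whiskerRight (Opens X)ᵒᵖ
  have h₁ := adj₁.homEquiv_naturality_right a f
  have h₂ := adj₂.homEquiv_naturality_right (adj₁.homEquiv _ _ a) f.hom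
  exact (congrArg (fun z => yonedaEquiv (adj₂.homEquiv _ _ z)) h₁).trans (congrArg yonedaEquiv h₂)

theorem exists_hom {V : Opens X} {F : AbSheaf X} (s : F.obj.obj (op V)) :
    ∃ a : free V ⟶ F, homEquiv V F a = s :=
  (homEquiv V F).surjective s

/-- The cohomology of `F` over `V` vanishes in positive degrees. -/
def IsAcyclicOn (F : AbSheaf X) (V : Opens X) : Prop :=
  ∀ p : ℕ, 0 < p → Subsingleton (F.H' p V)

theorem IsAcyclicOn.eq_zero {F : AbSheaf X} {V : Opens X} (hF : F.IsAcyclicOn V) {p : ℕ}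
    (hp : 0 < p) (x : Ext (free V) F p) : x = 0 :=
  (hF p hp).elim x 0

theorem isAcyclicOn_of_forall {F : AbSheaf X} {V : Opens X}
    (h : ∀ p : ℕ, 0 < p → ∀ x : Ext (free V) F p, x = 0) : F.IsAcyclicOn V :=
  fun p hp => ⟨fun x y => (h p hp x).trans (h p hp y).symm⟩

theorem isAcyclicOn_of_injective (F : AbSheaf X) [Injective F] (V : Opens X) : F.IsAcyclicOn V := by
  refine isAcyclicOn_of_forall fun p hp x => ?_
  obtain ⟨p, rfl⟩ : ∃ q, p = q + 1 := ⟨p - 1, by lia⟩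
  exact Ext.eq_zero_of_injective x

theorem isAcyclicOn_of_isZero {F : AbSheaf X} (hF : IsZero F) (V : Opens X) :
    F.IsAcyclicOn V := by
  have : Injective F := hF.injective
  exact isAcyclicOn_of_injective F V

section exact

variable {S : ShortComplex (AbSheaf X)} (hS : S.ShortExact) {V : Opens X}

include hS

theorem IsAcyclicOn.middle (h₁ : IsAcyclicOn S.X₁ V) (h₃ : IsAcyclicOn S.X₃ V) :
    IsAcyclicOn S.X₂ V :=
  isAcyclicOn_of_forall fun p hp x => by
    obtain ⟨y, rfl⟩ := Ext.covariant_sequence_exact₂ _ hS x (h₃.eq_zero hp _)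
    rw [h₁.eq_zero hp y, Ext.zero_comp]

theorem IsAcyclicOn.right (h₁ : IsAcyclicOn S.X₁ V) (h₂ : IsAcyclicOn S.X₂ V) :
    IsAcyclicOn S.X₃ V :=
  isAcyclicOn_of_forall fun p hp x => by
    obtain ⟨y, rfl⟩ := Ext.covariant_sequence_exact₃ _ hS x rfl (h₁.eq_zero (Nat.succ_pos p) _)
    rw [h₂.eq_zero hp y, Ext.zero_comp]

/-- A section is a morphism from `free V`, and the obstruction to lifting it lies in `Ext (free V)
S.X₁ 1`, the first cohomology over `V`. -/
theorem IsAcyclicOn.surjective (h₁ : IsAcyclicOn S.X₁ V) (s : S.X₃.obj.obj (op V)) :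
    ∃ t, S.g.hom.app (op V) t = s := by
  obtain ⟨a, rfl⟩ := exists_hom s
  obtain ⟨y, hy⟩ := Ext.covariant_sequence_exact₃ _ hS (Ext.mk₀ a) rfl (h₁.eq_zero one_pos _)
  obtain ⟨b, rfl⟩ := (Ext.mk₀_bijective _ _).2 y
  rw [Ext.mk₀_comp_mk₀] at hy
  exact ⟨homEquiv V _ b, by rw [← homEquiv_comp, (Ext.mk₀_bijective _ _).1 hy]⟩

end exact

theorem homEquiv_zero (V : Opens X) (F : AbSheaf X) : homEquiv V F 0 = 0 := by
  have h := homEquiv_comp (0 : free V ⟶ F) (0 : F ⟶ F)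
  rw [comp_zero] at h
  rw [h]
  rfl

theorem injective_of_mono {F G : AbSheaf X} (f : F ⟶ G) [Mono f] (V : Opens X) :
    Function.Injective (f.hom.app (op V)) := by
  intro s t hst
  obtain ⟨a, rfl⟩ := exists_hom s
  obtain ⟨b, rfl⟩ := exists_hom t
  rw [← homEquiv_comp, ← homEquiv_comp] at hst
  rw [(cancel_mono f).1 ((homEquiv V G).injective hst)]

theorem exists_of_exact {S : ShortComplex (AbSheaf X)} (hS : S.Exact) [Mono S.f] {V : Opens X}
    (s : S.X₂.obj.obj (op V)) (hs : S.g.hom.app (op V) s = 0) :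
    ∃ t, S.f.hom.app (op V) t = s := by
  obtain ⟨a, rfl⟩ := exists_hom s
  rw [← homEquiv_comp, ← homEquiv_zero] at hs
  refine ⟨homEquiv V _ (hS.lift a ((homEquiv V _).injective hs)), ?_⟩
  rw [← homEquiv_comp, hS.lift_f]

section complex

variable (C : CochainComplex (AbSheaf X) ℤ)

/-- The short complex `Z^i → C^i → Z^{i+1}`. -/
abbrev cyclesShortComplex (i : ℤ) : ShortComplex (AbSheaf X) :=
  ShortComplex.mk (C.iCycles i) (C.toCycles i (i + 1)) (by
    rw [← cancel_mono (C.iCycles (i + 1))]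
    simp)

variable {C}

/-- The cokernel of `C^i → Z^{i+1}` is the cohomology in degree `i + 1`, which vanishes. -/
theorem shortExact_cycles (hC : C.Acyclic) (i : ℤ) : (cyclesShortComplex C i).ShortExact where
  exact := by
    have : Mono (cyclesShortComplex C i).f := inferInstanceAs (Mono (C.iCycles i))
    refine ShortComplex.exact_of_f_is_kernel _ (KernelFork.IsLimit.ofι' _ _ fun {A} k hk =>
      ⟨C.liftCycles k (i + 1) (by simp) ?_, C.liftCycles_i k (i + 1) (by simp) _⟩)
    have hk' : k ≫ C.toCycles i (i + 1) = 0 := hk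
    rw [← C.toCycles_i, ← Category.assoc, hk', zero_comp]
  mono_f := inferInstanceAs (Mono (C.iCycles i))
  epi_g := Preadditive.epi_of_isZero_cokernel' _ (C.homologyIsCokernel i (i + 1) (by simp))
    ((C.exactAt_iff_isZero_homology (i + 1)).1 (hC (i + 1)))

/-- Below `N` the cycles are zero; from there acyclicity climbs along `0 → Z^i → C^i → Z^{i+1} → 0`.
-/
theorem isAcyclicOn_cycles (hC : C.Acyclic) {V : Opens X} (hV : ∀ i, IsAcyclicOn (C.X i) V) (N : ℤ)
    (hN : ∀ i < N, IsZero (C.X i)) (i : ℤ) : IsAcyclicOn (C.cycles i) V := by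
  have base : ∀ i < N, IsAcyclicOn (C.cycles i) V := fun i hi =>
    isAcyclicOn_of_isZero ((hN i hi).of_mono (C.iCycles i)) V
  have step : ∀ i, IsAcyclicOn (C.cycles i) V → IsAcyclicOn (C.cycles (i + 1)) V := fun i hi =>
    IsAcyclicOn.right (shortExact_cycles hC i) hi (hV i)
  have key : ∀ k : ℕ, IsAcyclicOn (C.cycles (N - 1 + k)) V := by
    intro k
    induction k with
    | zero => simpa using base (N - 1) (by lia)
    | succ k ih =>
      have := step _ ih
      rwa [add_assoc] at this
  rcases lt_or_ge i N with hi | hi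
  · exact base i hi
  · have := key (i - (N - 1)).toNat
    rwa [show N - 1 + ((i - (N - 1)).toNat : ℤ) = i by lia] at this

/-- Sections of a bounded below acyclic complex of acyclic sheaves form an exact complex. -/
theorem exists_of_d_eq_zero (hC : C.Acyclic) {V : Opens X} (hV : ∀ i, IsAcyclicOn (C.X i) V)
    (N : ℤ) (hN : ∀ i < N, IsZero (C.X i)) {i j k : ℤ} (hij : i + 1 = j) (hjk : j + 1 = k)
    (z : (C.X j).obj.obj (op V)) (hz : (C.d j k).hom.app (op V) z = 0) :
    ∃ w, (C.d i j).hom.app (op V) w = z := by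
  subst hij hjk
  have hker : (ShortComplex.mk (C.iCycles (i + 1)) (C.d (i + 1) (i + 1 + 1)) (by simp)).Exact :=
    ShortComplex.exact_of_f_is_kernel _ (C.cyclesIsKernel (i + 1) (i + 1 + 1) (by simp))
  have : Mono (ShortComplex.mk (C.iCycles (i + 1)) (C.d (i + 1) (i + 1 + 1)) (by simp)).f :=
    inferInstanceAs (Mono (C.iCycles (i + 1)))
  obtain ⟨t, rfl⟩ := exists_of_exact hker z hz
  obtain ⟨w, rfl⟩ := (isAcyclicOn_cycles hC hV N hN i).surjective (shortExact_cycles hC i) t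
  refine ⟨w, ?_⟩
  have h := C.toCycles_i i (i + 1)
  rw [← h]
  rfl

end complex

end AbSheaf

end

/-! ### Quasi-isomorphisms of sheaves and sections over acyclic opens. -/

noncomputable section

open Limits

namespace AbSheaf

variable {X : TopCat.{u}}

/-- The map induced on sections over `V`. -/
def sectionsMap (V : Opens X) {F G : AbSheaf X} (f : F ⟶ G) :
    F.obj.obj (op V) →+ G.obj.obj (op V) :=
  (f.hom.app (op V)).hom

theorem sectionsMap_comp (V : Opens X) {F G H : AbSheaf X} (f : F ⟶ G) (g : G ⟶ H)
    (s : F.obj.obj (op V)) : sectionsMap V (f ≫ g) s = sectionsMap V g (sectionsMap V f s) := rfl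

theorem sectionsMap_id (V : Opens X) (F : AbSheaf X) (s : F.obj.obj (op V)) :
    sectionsMap V (𝟙 F) s = s := rfl

theorem sectionsMap_zero (V : Opens X) (F G : AbSheaf X) (s : F.obj.obj (op V)) :
    sectionsMap V (0 : F ⟶ G) s = 0 := rfl

theorem sectionsMap_add (V : Opens X) {F G : AbSheaf X} (f g : F ⟶ G) (s : F.obj.obj (op V)) :
    sectionsMap V (f + g) s = sectionsMap V f s + sectionsMap V g s := rfl

theorem sectionsMap_neg (V : Opens X) {F G : AbSheaf X} (f : F ⟶ G) (s : F.obj.obj (op V)) :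
    sectionsMap V (-f) s = -sectionsMap V f s := rfl

theorem sectionsMap_sub (V : Opens X) {F G : AbSheaf X} (f g : F ⟶ G) (s : F.obj.obj (op V)) :
    sectionsMap V (f - g) s = sectionsMap V f s - sectionsMap V g s := rfl

section forget

variable (K : Type u) [Field K] (X : TopCat.{u})

/-- The functor forgetting the action of `K`. -/
abbrev forgetModule : Sheaf (Opens.grothendieckTopology X) (ModuleCat.{u} K) ⥤ AbSheaf X :=
  sheafCompose (Opens.grothendieckTopology X) (forget₂ (ModuleCat.{u} K) AddCommGrpCat.{u})

instance : (forgetModule K X).Additive where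
  map_add := rfl

instance : PreservesFiniteLimits (forgetModule K X) where
  preservesFiniteLimits J _ _ := by
    let e : forgetModule K X ⋙ sheafToPresheaf _ _ ≅ sheafToPresheaf _ _ ⋙
        (Functor.whiskeringRight _ _ _).obj (forget₂ (ModuleCat.{u} K) AddCommGrpCat.{u}) :=
      Iso.refl _
    have : PreservesLimitsOfShape J (forgetModule K X ⋙ sheafToPresheaf _ _) :=
      preservesLimitsOfShape_of_natIso e.symm
    exact preservesLimitsOfShape_of_reflects_of_preserves _ (sheafToPresheaf _ _)

/-- Epimorphisms of sheaves are the locally surjective maps, a condition that does not see the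
scalars. With preservation of finite limits this makes the forgetful functor exact, so
quasi-isomorphisms survive the passage to abelian sheaves, where cohomology is defined. -/
instance : (forgetModule K X).PreservesEpimorphisms where
  preserves f hf := by
    rw [← Sheaf.isLocallySurjective_iff_epi'] at hf ⊢
    exact ⟨fun s => hf.imageSieve_mem s⟩

instance : (forgetModule K X).PreservesHomology :=
  Functor.preservesHomology_of_preservesEpis_and_kernels _

end forget

theorem acyclic_mappingCone {C : Type*} [Category C] [Abelian C] {M N : CochainComplex C ℤ}
    (f : M ⟶ N) [QuasiIso f] : (CochainComplex.mappingCone f).Acyclic := by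
  have h : HomotopyCategory.quasiIso C (ComplexShape.up ℤ)
      ((HomotopyCategory.quotient C _).map f) := by
    rw [HomotopyCategory.quotient_map_mem_quasiIso_iff, HomologicalComplex.mem_quasiIso_iff]
    infer_instance
  rw [HomotopyCategory.quasiIso_eq_trW_subcategoryAcyclic] at h
  exact (HomotopyCategory.quotient_obj_mem_subcategoryAcyclic_iff_acyclic _).1
    ((ObjectProperty.trW_iff_of_distinguished _ _
      (HomotopyCategory.mappingCone_triangleh_distinguished f)).1 h)

/-- The split short exact sequence `G^i → Cone(f)^i → F^{i+1}`. -/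
theorem shortExact_mappingCone {F G : CochainComplex (AbSheaf X) ℤ} (f : F ⟶ G) (i j : ℤ)
    (hij : i + 1 = j) :
    (ShortComplex.mk ((CochainComplex.mappingCone.inr f).f i)
      ((CochainComplex.mappingCone.fst f).1.v i j hij) (by simp)).ShortExact :=
  ShortComplex.Splitting.shortExact
    { r := (CochainComplex.mappingCone.snd f).v i i (add_zero i)
      s := (CochainComplex.mappingCone.inl f).v j i (by lia)
      f_r := by simp
      s_g := by simp
      id := by
        have := CochainComplex.mappingCone.id_X f i j hij
        rw [add_comm] at this
        exact this }

theorem exists_of_quasiIso {F G : CochainComplex (AbSheaf X) ℤ} (f : F ⟶ G) [QuasiIso f]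
    {V : Opens X} (hF : ∀ i, IsAcyclicOn (F.X i) V) (hG : ∀ i, IsAcyclicOn (G.X i) V) (N : ℤ)
    (hFN : ∀ i < N, IsZero (F.X i)) (hGN : ∀ i < N, IsZero (G.X i)) {h i j k : ℤ}
    (hhi : h + 1 = i) (hij : i + 1 = j) (hjk : j + 1 = k) (m : (F.X j).obj.obj (op V))
    (n : (G.X i).obj.obj (op V)) (hm : sectionsMap V (F.d j k) m = 0)
    (hmn : sectionsMap V (f.f j) m = sectionsMap V (G.d i j) n) :
    ∃ m' n', sectionsMap V (F.d i j) m' = m ∧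
      sectionsMap V (f.f i) m' + sectionsMap V (G.d h i) n' = n := by
  let inl := sectionsMap V ((CochainComplex.mappingCone.inl f).v j i (by lia))
  let inr := sectionsMap V ((CochainComplex.mappingCone.inr f).f i)
  -- The hypotheses on `m` and `n` say that `inl m - inr n` is a cocycle of the cone. The cone is an
  -- extension of `F^{i+1}` by `G^i`, hence consists of acyclic sheaves; the shift by one is why the
  -- bound is `N - 1`.
  obtain ⟨w, hw⟩ := exists_of_d_eq_zero (acyclic_mappingCone f) (V := V)
    (fun i => IsAcyclicOn.middle (shortExact_mappingCone f i _ rfl) (hG i) (hF (i + 1))) (N - 1)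
    (fun i hi => (CochainComplex.mappingCone.isZero_X_iff f i).2
      ⟨hFN _ (by lia), hGN _ (by lia)⟩) hhi hij (inl m - inr n) (by
      change sectionsMap V _ _ = 0
      rw [map_sub, sub_eq_zero, ← sectionsMap_comp, ← sectionsMap_comp,
        CochainComplex.mappingCone.inl_v_d f j i k (by lia) (by lia), sectionsMap_sub,
        sectionsMap_comp, sectionsMap_comp, hm, map_zero, sub_zero, hmn,
        (CochainComplex.mappingCone.inr f).comm, sectionsMap_comp])
  change sectionsMap V _ _ = _ at hw
  -- The cone differential is `-d` on the shifted summand, and `n` enters with a minus sign, hence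
  -- the two signs.
  refine ⟨-sectionsMap V ((CochainComplex.mappingCone.fst f).1.v h i hhi) w,
    -sectionsMap V ((CochainComplex.mappingCone.snd f).v h h (add_zero h)) w, ?_, ?_⟩
  · have h1 := congrArg (sectionsMap V ((CochainComplex.mappingCone.fst f).1.v i j hij)) hw
    rw [← sectionsMap_comp, CochainComplex.mappingCone.d_fst_v f h i j hhi hij, map_sub,
      ← sectionsMap_comp, ← sectionsMap_comp, CochainComplex.mappingCone.inl_v_fst_v,
      CochainComplex.mappingCone.inr_f_fst_v, sectionsMap_neg, sectionsMap_comp, sectionsMap_id,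
      sectionsMap_zero, sub_zero] at h1
    rw [map_neg, h1]
  · have h1 := congrArg (sectionsMap V ((CochainComplex.mappingCone.snd f).v i i (add_zero i))) hw
    rw [← sectionsMap_comp, CochainComplex.mappingCone.d_snd_v f h i hhi, map_sub,
      ← sectionsMap_comp, ← sectionsMap_comp, CochainComplex.mappingCone.inl_v_snd_v,
      CochainComplex.mappingCone.inr_f_snd_v, sectionsMap_add, sectionsMap_comp, sectionsMap_id,
      sectionsMap_zero, zero_sub, sectionsMap_comp] at h1
    rw [map_neg, map_neg, ← neg_add, h1, neg_neg]

end AbSheaf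

namespace DGLASheaf

open AbSheaf CochainComplex

variable {K : Type u} [Field K] {X : TopCat.{u}}

theorem isZero_forgetModule {F : Sheaf (Opens.grothendieckTopology X) (ModuleCat.{u} K)}
    (hF : ∀ V : Opens X, Subsingleton (F.obj.obj (op V))) : IsZero ((forgetModule K X).obj F) := by
  rw [IsZero.iff_id_eq_zero]
  ext V s
  exact (hF V.unop).elim _ _

/-- A quasi-isomorphism between bounded below sheaves of DGLAs induces a quasi-isomorphism on
sections over any open on which both are acyclic. -/
theorem coneExact_app {L A : DGLASheaf K X} (hL : L.BoundedBelow) (hA : A.BoundedBelow)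
    (φ : L.Hom A) (hφ : IsQuasiIso φ) {V : Opens X} (hLV : L.AcyclicOn V) (hAV : A.AcyclicOn V) :
    ConeExact (φ.app (op V)).f := by
  intro h i j k hhi hij hjk m n hm hmn
  obtain ⟨N₁, hN₁⟩ := hL
  obtain ⟨N₂, hN₂⟩ := hA
  have : QuasiIso (complexMap φ) := hφ
  obtain ⟨m', n', h1, h2⟩ := exists_of_quasiIso
    (((forgetModule K X).mapHomologicalComplex (ComplexShape.up ℤ)).map (complexMap φ)) (V := V)
    (fun i => hLV i) (fun i => hAV i) (min N₁ N₂)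
    (fun i hi => isZero_forgetModule (hN₁ i (by lia)))
    (fun i hi => isZero_forgetModule (hN₂ i (by lia))) hhi hij hjk m n hm hmn
  exact ⟨m', h1, n', h2⟩

theorem coneExact_cechMap {L A : DGLASheaf K X} (hL : L.BoundedBelow) (hA : A.BoundedBelow)
    (φ : L.Hom A) (hφ : IsQuasiIso φ) {I : Type u} [LinearOrder I] (U : I → Opens X)
    (hUL : L.AcyclicCover U) (hUA : A.AcyclicCover U) (n : ℕ) :
    ConeExact ((cechMap U φ).app n).f := by
  intro h i j k hhi hij hjk x y hx hxy
  have key (α : Fin (n + 1) ↪o I) := coneExact_app hL hA φ hφ (hUL n α) (hUA n α) h i j k hhi hij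
    hjk (x α) (y α) (congrFun hx α) (congrFun hxy α)
  choose x' hx' y' hy' using key
  exact ⟨x', funext hx', y', funext hy'⟩

theorem isQuasiIso_totTWMap {L A : DGLASheaf K X} (hL : L.BoundedBelow) (hA : A.BoundedBelow)
    (φ : L.Hom A) (hφ : IsQuasiIso φ) {I : Type u} [LinearOrder I] (U : I → Opens X)
    (hUL : L.AcyclicCover U) (hUA : A.AcyclicCover U) : DGLA.IsQuasiIso (totTWMap U φ) := by
  obtain ⟨N₁, hN₁⟩ := id hL
  obtain ⟨N₂, hN₂⟩ := id hA
  refine ThomWhitney.totMap_isQuasiIso (cechMap U φ) (coneExact_cechMap hL hA φ hφ U hUL hUA)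
    (min N₁ N₂) (fun j hj n => ?_) (fun j hj n => ?_)
  · have := fun V => hN₁ j (by lia) V
    exact inferInstanceAs (Subsingleton (∀ α : Fin (n + 1) ↪o I, (L.sections (inter U α)).cx.X j))
  · have := fun V => hN₂ j (by lia) V
    exact inferInstanceAs (Subsingleton (∀ α : Fin (n + 1) ↪o I, (A.sections (inter U α)).cx.X j))

end DGLASheaf

end

noncomputable section

/-! ### The cochains of a full simplex -/

namespace FinsetCochain

variable {I : Type*} [LinearOrder I] {M : Type*} [AddCommGroup M]

/-- The sign of the position of `a` in `σ`. -/
def sign (σ : Finset I) (a : I) : ℤ := (-1) ^ (σ.filter (· < a)).card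

theorem sign_mul_self (σ : Finset I) (a : I) : sign σ a * sign σ a = 1 := by
  rw [sign, ← mul_pow]
  simp

/-- The simplicial coboundary. -/
def coboundary (C : Finset I → M) (σ : Finset I) : M :=
  ∑ a ∈ σ, sign σ a • C (σ.erase a)

/-- The contraction defined by the vertex `s`. -/
def contract (s : I) (C : Finset I → M) (τ : Finset I) : M :=
  if s ∈ τ then 0 else sign τ s • C (insert s τ)

theorem sign_erase_self (σ : Finset I) (s : I) : sign (σ.erase s) s = sign σ s := by
  simp only [sign]
  congr 2
  ext b
  simp only [Finset.mem_filter, Finset.mem_erase]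
  grind

theorem sign_insert_self (σ : Finset I) (s : I) : sign (insert s σ) s = sign σ s := by
  simp only [sign]
  congr 2
  ext b
  simp only [Finset.mem_filter, Finset.mem_insert]
  grind

/-- Inserting `s` and removing `a` in the two possible orders changes exactly one of the two
positions by one. -/
theorem sign_mul_sign_insert {σ : Finset I} {a s : I} (ha : a ∈ σ) (hs : s ∉ σ) :
    sign σ s * sign (insert s σ) a = -(sign σ a * sign (σ.erase a) s) := by
  simp only [sign, Finset.filter_insert, Finset.filter_erase]
  rcases lt_trichotomy a s with h | rfl | h
  · rw [if_neg h.not_gt, Finset.card_erase_of_mem (by simp [ha, h])]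
    obtain ⟨m, hm⟩ : ∃ m, (σ.filter (· < s)).card = m + 1 :=
      Nat.exists_eq_succ_of_ne_zero (Finset.card_ne_zero_of_mem (a := a) (by simp [ha, h]))
    rw [hm, Nat.add_sub_cancel, pow_succ]
    ring
  · exact absurd ha hs
  · rw [if_pos h, Finset.card_insert_of_notMem (by simp [hs]),
      Finset.erase_eq_of_notMem (by simp [h.le]), pow_succ]
    ring

/-- This is the cone contraction of a simplex onto `s`. If `s ∈ σ`, only the face omitting `s`
contributes. Otherwise the omission of `s` from `insert s σ` returns `C σ`, and the remaining terms
cancel in pairs. -/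
theorem coboundary_contract (s : I) (C : Finset I → M) (σ : Finset I) :
    coboundary (contract s C) σ + contract s (coboundary C) σ = C σ := by
  by_cases hs : s ∈ σ
  · rw [contract, if_pos hs, add_zero, coboundary, Finset.sum_eq_single s]
    · rw [contract, if_neg (by simp), sign_erase_self, smul_smul, sign_mul_self, one_smul,
        Finset.insert_erase hs]
    · intro a _ has
      rw [contract, if_pos (by simp [hs, has.symm]), smul_zero]
    · exact fun h => absurd hs h
  · rw [contract, if_neg hs, coboundary, coboundary, Finset.sum_insert hs, smul_add, sign_insert_self,
      smul_smul, sign_mul_self, one_smul, Finset.erase_insert hs, add_left_comm, Finset.smul_sum,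
      ← Finset.sum_add_distrib, Finset.sum_eq_zero, add_zero]
    intro a ha
    have has : s ≠ a := fun h => hs (h ▸ ha)
    rw [contract, if_neg (by simp [hs]), smul_smul, smul_smul, sign_mul_sign_insert ha hs,
      Finset.erase_insert_of_ne has, neg_smul, add_neg_cancel]

/-- The set of vertices of an ordered simplex. -/
def vertices {n : ℕ} (α : Fin n ↪o I) : Finset I := Finset.univ.map α.toEmbedding

theorem mem_vertices {n : ℕ} (α : Fin n ↪o I) (i : I) : i ∈ vertices α ↔ ∃ a, α a = i := by
  simp [vertices]

theorem card_vertices {n : ℕ} (α : Fin n ↪o I) : (vertices α).card = n := by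
  simp [vertices]

theorem vertices_orderEmbOfFin {n : ℕ} (σ : Finset I) (h : σ.card = n) :
    vertices (σ.orderEmbOfFin h) = σ := by
  simp [vertices]

theorem orderEmbOfFin_vertices {n : ℕ} (α : Fin n ↪o I) (h : (vertices α).card = n) :
    (vertices α).orderEmbOfFin h = α :=
  (Finset.orderEmbOfFin_unique' h fun a => (mem_vertices α _).2 ⟨a, rfl⟩).symm

theorem sign_vertices {n : ℕ} (α : Fin n ↪o I) (k : Fin n) :
    sign (vertices α) (α k) = (-1) ^ (k : ℕ) := by
  have h : (vertices α).filter (· < α k) = (Finset.Iio k).map α.toEmbedding := by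
    ext i
    simp only [Finset.mem_filter, mem_vertices, Finset.mem_map, Finset.mem_Iio]
    constructor
    · rintro ⟨⟨a, rfl⟩, ha⟩
      exact ⟨a, α.lt_iff_lt.1 ha, rfl⟩
    · rintro ⟨a, ha, rfl⟩
      exact ⟨⟨a, rfl⟩, α.lt_iff_lt.2 ha⟩
  rw [sign, h, Finset.card_map, Fin.card_Iio]

theorem vertices_erase {n : ℕ} (α : Fin (n + 1) ↪o I) (k : Fin (n + 1)) :
    (vertices α).erase (α k) = vertices ((Fin.succAboveOrderEmb k).trans α) := by
  ext i
  simp only [Finset.mem_erase, mem_vertices, RelEmbedding.coe_trans, Function.comp_apply,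
    Fin.succAboveOrderEmb_apply]
  constructor
  · rintro ⟨h, a, rfl⟩
    obtain ⟨b, rfl⟩ := Fin.exists_succAbove_eq (show a ≠ k from fun h' => h (by rw [h']))
    exact ⟨b, rfl⟩
  · rintro ⟨b, rfl⟩
    exact ⟨fun h => Fin.succAbove_ne k b (α.injective h), _, rfl⟩

theorem coboundary_vertices (C : Finset I → M) {n : ℕ} (α : Fin (n + 1) ↪o I) :
    coboundary C (vertices α) =
      ∑ k : Fin (n + 1), (-1 : ℤ) ^ (k : ℕ) • C (vertices ((Fin.succAboveOrderEmb k).trans α)) := by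
  rw [coboundary]
  conv_lhs => rw [vertices, Finset.sum_map]
  refine Finset.sum_congr rfl fun k _ => ?_
  change sign (vertices α) (α k) • C ((vertices α).erase (α k)) = _
  rw [sign_vertices, vertices_erase]

end FinsetCochain

/-! ### Čech cochains of abelian sheaves -/

namespace AbSheaf

open DGLASheaf

variable {X : TopCat.{u}} {I : Type u} [LinearOrder I] (U : I → Opens X)

/-- The ordered Čech cochains of a presheaf. -/
abbrev CechCochain (P : (Opens X)ᵒᵖ ⥤ AddCommGrpCat.{u}) (n : ℕ) : Type u :=
  ∀ α : Fin (n + 1) ↪o I, P.obj (op (inter U α))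

variable {U}

/-- The coface maps of Čech cochains. -/
def cechCoface (P : (Opens X)ᵒᵖ ⥤ AddCommGrpCat.{u}) (n : ℕ) (k : Fin (n + 2))
    (c : CechCochain U P n) : CechCochain U P (n + 1) :=
  fun α => P.map (homOfLE (inter_le U α k)).op (c ((Fin.succAboveOrderEmb k).trans α))

/-- The Čech coboundary. -/
def cechδ (P : (Opens X)ᵒᵖ ⥤ AddCommGrpCat.{u}) (n : ℕ) (c : CechCochain U P n) :
    CechCochain U P (n + 1) :=
  fun α => ∑ k : Fin (n + 2), (-1 : ℤ) ^ (k : ℕ) • cechCoface P n k c α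

theorem map_congr_index (P : (Opens X)ᵒᵖ ⥤ AddCommGrpCat.{u}) {n : ℕ} (c : CechCochain U P n)
    {α β : Fin (n + 1) ↪o I} (h : α = β) {V : Opens X} (hα : V ≤ inter U α) (hβ : V ≤ inter U β) :
    P.map (homOfLE hα).op (c α) = P.map (homOfLE hβ).op (c β) := by
  subst h
  rfl

theorem map_map (P : (Opens X)ᵒᵖ ⥤ AddCommGrpCat.{u}) {V₁ V₂ V₃ : Opens X} (h₁ : V₂ ≤ V₁)
    (h₂ : V₃ ≤ V₂) (s : P.obj (op V₁)) :
    P.map (homOfLE h₂).op (P.map (homOfLE h₁).op s) = P.map (homOfLE (h₂.trans h₁)).op s := by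
  rw [← ConcreteCategory.comp_apply, ← P.map_comp]
  rfl

theorem cechδ_cechδ (P : (Opens X)ᵒᵖ ⥤ AddCommGrpCat.{u}) (n : ℕ) (c : CechCochain U P n) :
    cechδ P (n + 1) (cechδ P n c) = 0 := by
  funext α
  have h := sum_sum_neg_one_pow_face ℤ
    (fun l k => cechCoface P (n + 1) k (cechCoface P n l c) α) (fun l k hlk => by
      simp only [cechCoface]
      rw [map_map, map_map]
      apply map_congr_index
      ext i
      simp only [RelEmbedding.coe_trans, Function.comp_apply, Fin.succAboveOrderEmb_apply]
      congr 1
      simp only [Fin.ext_iff, Fin.succAbove, Fin.lt_def, Fin.le_def] at hlk ⊢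
      grind)
  refine Eq.trans ?_ h
  refine Finset.sum_congr rfl fun k _ => ?_
  rw [← Finset.smul_sum, cechCoface, cechδ, map_sum]
  congr 1
  refine Finset.sum_congr rfl fun l _ => ?_
  rw [map_zsmul]
  rfl

theorem cechδ_add (P : (Opens X)ᵒᵖ ⥤ AddCommGrpCat.{u}) (n : ℕ) (c c' : CechCochain U P n) :
    cechδ P n (c + c') = cechδ P n c + cechδ P n c' := by
  funext α
  simp only [cechδ, cechCoface, Pi.add_apply, map_add, smul_add, Finset.sum_add_distrib]

/-- The map on Čech cochains induced by a morphism. -/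
def cechCochainMap {P Q : (Opens X)ᵒᵖ ⥤ AddCommGrpCat.{u}} (f : P ⟶ Q) {n : ℕ}
    (c : CechCochain U P n) : CechCochain U Q n :=
  fun α => f.app _ (c α)

theorem cechδ_cechCochainMap {P Q : (Opens X)ᵒᵖ ⥤ AddCommGrpCat.{u}} (f : P ⟶ Q) (n : ℕ)
    (c : CechCochain U P n) : cechδ Q n (cechCochainMap f c) = cechCochainMap f (cechδ P n c) := by
  funext α
  simp only [cechδ, cechCochainMap, map_sum, map_zsmul, cechCoface]
  refine Finset.sum_congr rfl fun k _ => ?_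
  rw [NatTrans.naturality_apply]

/-- The ordered Čech complex is exact in degree `n + 1`. -/
def CechExact (U : I → Opens X) (P : (Opens X)ᵒᵖ ⥤ AddCommGrpCat.{u}) (n : ℕ) : Prop :=
  ∀ c : CechCochain U P (n + 1), cechδ P (n + 1) c = 0 → ∃ w, cechδ P n w = c

theorem CechExact.of_retract {P Q : (Opens X)ᵒᵖ ⥤ AddCommGrpCat.{u}} (i : P ⟶ Q) (r : Q ⟶ P)
    (h : i ≫ r = 𝟙 P) {n : ℕ} (hQ : CechExact U Q n) : CechExact U P n := by
  intro c hc
  obtain ⟨w, hw⟩ := hQ (cechCochainMap i c) (by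
    rw [cechδ_cechCochainMap, hc]
    funext α
    exact map_zero (i.app _).hom)
  refine ⟨cechCochainMap r w, ?_⟩
  rw [cechδ_cechCochainMap, hw]
  funext α
  exact congrArg (fun f : P ⟶ P => f.app _ (c α)) h

/-! ### Sheaves of discontinuous sections -/

/-- The presheaf of families of elements of the groups `M x`. -/
def discontinuousPresheaf (M : X → AddCommGrpCat.{u}) : (Opens X)ᵒᵖ ⥤ AddCommGrpCat.{u} where
  obj V := AddCommGrpCat.of (∀ x : V.unop, M x.1)
  map f := AddCommGrpCat.ofHom
    { toFun := fun s x => s (f.unop x)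
      map_zero' := rfl
      map_add' := fun _ _ => rfl }

/-- The sheaf of families of elements of the groups `M x`. -/
def discontinuous (M : X → AddCommGrpCat.{u}) : AbSheaf X :=
  ⟨discontinuousPresheaf M, (TopCat.Presheaf.isSheaf_iff_isSheaf_comp'
    (forget AddCommGrpCat.{u}) (discontinuousPresheaf M)).2
      (TopCat.Presheaf.toTypes_isSheaf X fun x => M x)⟩

-- Without a continuity condition the contraction can be made point by point: over `x` one contracts
-- with a vertex `s x` whose open set contains `x`, however `s` varies with `x`.
open FinsetCochain in
theorem cechExact_discontinuous (hU : ⨆ i, U i = ⊤) (M : X → AddCommGrpCat.{u}) (n : ℕ) :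
    CechExact U (discontinuousPresheaf M) n := by
  intro c hc
  have hs (x : X) : ∃ i, x ∈ U i := by
    rw [← Opens.mem_iSup, hU]
    trivial
  choose s hs using hs
  have hmem {m : ℕ} (x : X) (α : Fin (m + 1) ↪o I) : x ∈ inter U α ↔ ∀ i ∈ vertices α, x ∈ U i := by
    rw [inter, ← SetLike.mem_coe, Opens.coe_iInf]
    simp [mem_vertices]
  classical
  -- Extension by zero to all finite sets of indices makes the cochain at `x` a function to which
  -- the contraction of the full simplex applies.
  let C (x : X) (σ : Finset I) : M x :=
    if h : σ.card = n + 2 ∧ ∀ i ∈ σ, x ∈ U i then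
      c (σ.orderEmbOfFin h.1) ⟨x, (hmem x _).2 (by rw [vertices_orderEmbOfFin]; exact h.2)⟩
    else 0
  have hC (x : X) (α : Fin (n + 2) ↪o I) (hx : x ∈ inter U α) : C x (vertices α) = c α ⟨x, hx⟩ := by
    simp only [C]
    rw [dif_pos ⟨card_vertices α, (hmem x α).1 hx⟩]
    have (β : Fin (n + 2) ↪o I) (hβ : β = α) (hx' : x ∈ inter U β) :
        c β ⟨x, hx'⟩ = c α ⟨x, hx⟩ := by
      subst hβ
      rfl
    exact this _ (orderEmbOfFin_vertices α _) _
  have hd (x : X) (σ : Finset I) (hσ : σ.card = n + 3) (hx : ∀ i ∈ σ, x ∈ U i) :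
      coboundary (C x) σ = 0 := by
    obtain ⟨γ, rfl⟩ : ∃ γ : Fin (n + 3) ↪o I, vertices γ = σ := ⟨_, vertices_orderEmbOfFin σ hσ⟩
    have hx' : x ∈ inter U γ := (hmem x γ).2 hx
    rw [coboundary_vertices]
    have h1 := congrFun (congrFun hc γ) ⟨x, hx'⟩
    refine Eq.trans ?_ h1
    rw [cechδ]
    erw [Finset.sum_apply]
    refine Finset.sum_congr rfl fun k _ => ?_
    rw [hC x _ (inter_le U γ k hx')]
    rfl
  let w : CechCochain U (discontinuousPresheaf M) n :=
    fun β x => contract (s x.1) (C x.1) (vertices β)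
  refine ⟨w, funext fun α => funext fun x => ?_⟩
  have h1 := coboundary_contract (s x.1) (C x.1) (vertices α)
  have h2 : contract (s x.1) (coboundary (C x.1)) (vertices α) = 0 := by
    rw [contract]
    split_ifs with h
    · rfl
    -- Adding `s x` keeps all the open sets around `x`, so the cocycle condition holds at `x` on the
    -- enlarged simplex.
    · rw [hd, smul_zero]
      · rw [Finset.card_insert_of_notMem h, card_vertices]
      · intro i hi
        rcases Finset.mem_insert.1 hi with rfl | hi
        · exact hs x.1
        · exact (hmem x.1 α).1 x.2 i hi
  rw [h2, add_zero, hC x.1 α x.2, coboundary_vertices] at h1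
  refine Eq.trans ?_ h1
  exact map_sum (Pi.evalAddMonoidHom (fun x : inter U α => M x.1) x)
    (fun k : Fin (n + 2) => (-1 : ℤ) ^ (k : ℕ) • cechCoface (discontinuousPresheaf M) n k w α) Finset.univ

/-- The morphism from a sheaf to the sheaf of discontinuous sections of its stalks. -/
def toDiscontinuous (F : AbSheaf X) :
    F ⟶ discontinuous fun x => TopCat.Presheaf.stalk (C := AddCommGrpCat.{u}) F.obj x :=
  ⟨{ app := fun V => AddCommGrpCat.ofHom
      { toFun := fun s x => TopCat.Presheaf.germ (C := AddCommGrpCat.{u}) F.obj V.unop x.1 x.2 s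
        map_zero' := funext fun x => map_zero _
        map_add' := fun s t => funext fun x => map_add _ s t }
     naturality := fun V W f => by
      ext s
      funext x
      exact TopCat.Presheaf.germ_res_apply (C := AddCommGrpCat.{u}) F.obj f.unop x.1 x.2 s }⟩

instance (F : AbSheaf X) : Mono (toDiscontinuous F) := by
  have : Mono (toDiscontinuous F).hom := by
    have (V : (Opens X)ᵒᵖ) : Mono ((toDiscontinuous F).hom.app V) := by
      rw [AddCommGrpCat.mono_iff_injective]
      intro s t hst
      exact TopCat.Presheaf.section_ext (C := AddCommGrpCat.{u}) F V.unop s t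
        fun x hx => congrFun hst ⟨x, hx⟩
    exact NatTrans.mono_of_mono_app _
  exact (sheafToPresheaf _ _).mono_of_mono_map this

/-- The embedding of an injective sheaf into the discontinuous sections of its stalks splits, and
Čech exactness passes to retracts. -/
theorem cechExact_of_injective (hU : ⨆ i, U i = ⊤) (F : AbSheaf X) [Injective F] (n : ℕ) :
    CechExact U F.obj n :=
  (cechExact_discontinuous hU _ n).of_retract (toDiscontinuous F).hom
    (Injective.factorThru (𝟙 F) (toDiscontinuous F)).hom
    (congrArg (fun f => f.hom) (Injective.comp_factorThru (𝟙 F) (toDiscontinuous F)))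

end AbSheaf

end

/-! ### Gluing and Leray's theorem. -/

noncomputable section

open Limits

namespace AbSheaf

open DGLASheaf

variable {X : TopCat.{u}} {I : Type u} [LinearOrder I] {U : I → Opens X}

/-- The simplex with the single vertex `i`. -/
def vertex (i : I) : Fin 1 ↪o I :=
  OrderEmbedding.ofStrictMono (fun _ => i) fun a b h => absurd h (by simp [Subsingleton.elim a b])

/-- The simplex with vertices `i < j`. -/
def edge {i j : I} (h : i < j) : Fin 2 ↪o I :=
  OrderEmbedding.ofStrictMono ![i, j] (Fin.strictMono_iff_lt_succ.2 fun a => by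
    fin_cases a
    exact h)

theorem top_le_iSup_inter (hU : ⨆ i, U i = ⊤) : (⊤ : Opens X) ≤ ⨆ α : Fin 1 ↪o I, inter U α := by
  rw [← hU]
  exact iSup_le fun i => (le_iInf fun _ => le_rfl : U i ≤ inter U (vertex i)).trans
    (le_iSup (fun α : Fin 1 ↪o I => inter U α) (vertex i))

theorem eq_of_restrict_eq (hU : ⨆ i, U i = ⊤) (F : AbSheaf X) (s t : F.obj.obj (op ⊤))
    (h : ∀ α : Fin 1 ↪o I, F.obj.map (homOfLE (le_top : inter U α ≤ ⊤)).op s =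
      F.obj.map (homOfLE le_top).op t) : s = t :=
  TopCat.Sheaf.eq_of_locally_eq' (C := AddCommGrpCat.{u}) F (fun α : Fin 1 ↪o I => inter U α) ⊤
    (fun _ => homOfLE le_top) (top_le_iSup_inter hU) s t h

/-- Ordered cochains give agreement only over pairs `i < j`; equal indices are trivial and the
reversed order follows by symmetry of the intersection. -/
theorem exists_glue (hU : ⨆ i, U i = ⊤) (F : AbSheaf X) (c : CechCochain U F.obj 0)
    (hc : cechCoface F.obj 0 0 c = cechCoface F.obj 0 1 c) :
    ∃ s : F.obj.obj (op ⊤), ∀ α, F.obj.map (homOfLE le_top).op s = c α := by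
  have key (α β : Fin 1 ↪o I) (h : α 0 < β 0) :
      F.obj.map (homOfLE (inf_le_left : inter U α ⊓ inter U β ≤ _)).op (c α) =
        F.obj.map (homOfLE inf_le_right).op (c β) := by
    have hα : (Fin.succAboveOrderEmb 1).trans (edge h) = α := by
      ext a
      rw [Subsingleton.elim a 0]
      rfl
    have hβ : (Fin.succAboveOrderEmb 0).trans (edge h) = β := by
      ext a
      rw [Subsingleton.elim a 0]
      rfl
    have hle : inter U α ⊓ inter U β ≤ inter U (edge h) := by
      refine le_iInf fun a => ?_
      fin_cases a
      · exact inf_le_left.trans (iInf_le _ 0)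
      · exact inf_le_right.trans (iInf_le _ 0)
    have h1 := congrArg (F.obj.map (homOfLE hle).op) (congrFun hc (edge h))
    simp only [cechCoface] at h1
    rw [map_map, map_map] at h1
    rw [map_congr_index F.obj c hα.symm _ (hle.trans (inter_le U (edge h) 1)),
      map_congr_index F.obj c hβ.symm _ (hle.trans (inter_le U (edge h) 0))]
    exact h1.symm
  obtain ⟨s, hs, -⟩ := TopCat.Sheaf.existsUnique_gluing' (C := AddCommGrpCat.{u}) F
    (fun α : Fin 1 ↪o I => inter U α) ⊤ (fun α => homOfLE le_top) (top_le_iSup_inter hU) c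
    (fun α β => by
      rcases lt_trichotomy (α 0) (β 0) with h | h | h
      · exact key α β h
      · obtain rfl : α = β := by
          ext a
          rw [Subsingleton.elim a 0, h]
        rfl
      · have h1 := congrArg (F.obj.map (homOfLE (le_inf inf_le_right inf_le_left :
          inter U α ⊓ inter U β ≤ inter U β ⊓ inter U α)).op) (key β α h)
        rw [map_map, map_map] at h1
        exact h1.symm)
  exact ⟨s, hs⟩

theorem cechδ_zero_eq_zero_iff (P : (Opens X)ᵒᵖ ⥤ AddCommGrpCat.{u}) (c : CechCochain U P 0) :
    cechδ P 0 c = 0 ↔ cechCoface P 0 0 c = cechCoface P 0 1 c := by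
  rw [← sub_eq_zero (a := cechCoface P 0 0 c)]
  have : cechδ P 0 c = cechCoface P 0 0 c - cechCoface P 0 1 c := by
    funext α
    simp [cechδ, Fin.sum_univ_two, sub_eq_add_neg]
  rw [this]

/-- The restriction of a global section. -/
def restrictCochain (P : (Opens X)ᵒᵖ ⥤ AddCommGrpCat.{u}) (s : P.obj (op ⊤)) :
    CechCochain U P 0 :=
  fun _ => P.map (homOfLE le_top).op s

theorem cechδ_restrictCochain (P : (Opens X)ᵒᵖ ⥤ AddCommGrpCat.{u}) (s : P.obj (op ⊤)) :
    cechδ P 0 (restrictCochain (U := U) P s) = 0 := by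
  rw [cechδ_zero_eq_zero_iff]
  funext α
  simp only [cechCoface, restrictCochain]
  rw [map_map, map_map]

/-- The embedding of a sheaf into an injective one, and its cokernel. -/
abbrev injectiveShortComplex (F : AbSheaf X) : ShortComplex (AbSheaf X) :=
  ShortComplex.mk (Injective.ι F) (cokernel.π (Injective.ι F)) (cokernel.condition _)

theorem shortExact_injective (F : AbSheaf X) : (injectiveShortComplex F).ShortExact where
  exact := ShortComplex.exact_cokernel _
  mono_f := inferInstanceAs (Mono (Injective.ι F))
  epi_g := inferInstanceAs (Epi (cokernel.π (Injective.ι F)))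

theorem map_f_g (F : AbSheaf X) {V : Opens X} (s : F.obj.obj (op V)) :
    (injectiveShortComplex F).g.hom.app (op V) ((injectiveShortComplex F).f.hom.app (op V) s) =
      0 := by
  have h := congrArg (fun f => f.hom.app (op V) s) (injectiveShortComplex F).zero
  exact h

/-- A cochain `b` bounding the image of `c` in the middle term of a short exact sequence can be
moved to the left term, if it agrees with a cocycle modulo the left term. -/
theorem exists_cechδ_eq {S : ShortComplex (AbSheaf X)} (hS : S.ShortExact) {n : ℕ}
    (c : CechCochain U S.X₁.obj (n + 1)) (a b : CechCochain U S.X₂.obj n)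
    (hb : cechδ S.X₂.obj n b = cechCochainMap S.f.hom c) (ha : cechδ S.X₂.obj n a = 0)
    (hab : cechCochainMap S.g.hom a = cechCochainMap S.g.hom b) :
    ∃ w, cechδ S.X₁.obj n w = c := by
  have := hS.mono_f
  have h (α : Fin (n + 1) ↪o I) : ∃ t, S.f.hom.app (op (inter U α)) t = b α - a α := by
    refine exists_of_exact hS.exact _ ?_
    rw [map_sub, sub_eq_zero]
    exact (congrFun hab α).symm
  choose w hw using h
  have hw' : b = cechCochainMap S.f.hom w + a := by
    funext α
    exact (sub_eq_iff_eq_add.1 (hw α).symm)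
  refine ⟨w, funext fun α => injective_of_mono S.f _ ?_⟩
  have h1 : cechCochainMap S.f.hom (cechδ S.X₁.obj n w) = cechCochainMap S.f.hom c := by
    rw [← hb, hw', cechδ_add, ha, add_zero, cechδ_cechCochainMap]
  exact congrFun h1 α

/-- Leray's theorem: the Čech complex of a sheaf with respect to an acyclic cover is exact in
positive degrees, if the sheaf has no higher cohomology. -/
theorem cechExact_of_isAcyclicOn (hU : ⨆ i, U i = ⊤) (n : ℕ) (F : AbSheaf X)
    (hX : F.IsAcyclicOn ⊤) (hF : ∀ (m : ℕ) (α : Fin (m + 1) ↪o I), F.IsAcyclicOn (inter U α)) :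
    CechExact U F.obj n := by
  induction n generalizing F with
  | zero =>
    intro c hc
    have hS := shortExact_injective F
    obtain ⟨b, hb⟩ := cechExact_of_injective hU (Injective.under F) 0
      (cechCochainMap (Injective.ι F).hom c) (by
        rw [cechδ_cechCochainMap, hc]
        exact funext fun α => map_zero _)
    have hb' : cechδ _ 0 (cechCochainMap (injectiveShortComplex F).g.hom b) = 0 := by
      rw [cechδ_cechCochainMap, hb]
      exact funext fun α => map_f_g F (c α)
    -- The image of `b` in the cokernel is a 0-cocycle, hence a global section; it lifts to the
    -- injective sheaf because `H^1(X; F) = 0`.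
    obtain ⟨s, hs⟩ := exists_glue hU _ _ ((cechδ_zero_eq_zero_iff _ _).1 hb')
    obtain ⟨t, rfl⟩ := hX.surjective hS s
    refine exists_cechδ_eq hS c (restrictCochain _ t) b hb (cechδ_restrictCochain _ t) ?_
    funext α
    rw [← hs α]
    exact NatTrans.naturality_apply (injectiveShortComplex F).g.hom
      (homOfLE (le_top : inter U α ≤ ⊤)).op t
  | succ n ih =>
    intro c hc
    have hS := shortExact_injective F
    obtain ⟨b, hb⟩ := cechExact_of_injective hU (Injective.under F) (n + 1)
      (cechCochainMap (Injective.ι F).hom c) (by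
        rw [cechδ_cechCochainMap, hc]
        exact funext fun α => map_zero _)
    have hb' : cechδ _ (n + 1) (cechCochainMap (injectiveShortComplex F).g.hom b) = 0 := by
      rw [cechδ_cechCochainMap, hb]
      exact funext fun α => map_f_g F (c α)
    -- The cokernel satisfies the same hypotheses, so the image of `b` is a coboundary `δ a'`. The
    -- cochain `a'` lifts on each intersection by vanishing of `H^1` there, and `δ a` is then a
    -- cocycle agreeing with `b` modulo `F`.
    obtain ⟨a', ha'⟩ := ih _ (hX.right hS (isAcyclicOn_of_injective (Injective.under F) _))
      (fun m α => (hF m α).right hS (isAcyclicOn_of_injective (Injective.under F) _)) _ hb'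
    choose a ha using fun α => (hF n α).surjective hS (a' α)
    obtain rfl : cechCochainMap (injectiveShortComplex F).g.hom a = a' := funext ha
    refine exists_cechδ_eq hS c (cechδ _ n a) b hb (cechδ_cechδ _ n a) ?_
    rw [← ha', cechδ_cechCochainMap]

end AbSheaf

end

/-! ### The augmentation by global sections, naturality, and the main theorem. -/

noncomputable section

namespace DGLASheaf

variable {K : Type u} [Field K] {X : TopCat.{u}} {I : Type u} [LinearOrder I] {U : I → Opens X}

/-- The abelian sheaf underlying the degree `m` component. -/
abbrev abDegree (A : DGLASheaf K X) (m : ℤ) : AbSheaf X := (AbSheaf.forgetModule K X).obj (A.degree m)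

theorem cechD_eq_cechδ (A : DGLASheaf K X) (m : ℤ) (n : ℕ)
    (w : AbSheaf.CechCochain U (A.abDegree m).obj n) :
    ((cech U A).deg m).cechD n w = AbSheaf.cechδ (A.abDegree m).obj n w := by
  refine (SemicosimplicialModule.cechD_apply n _).trans ?_
  funext α
  refine (Finset.sum_apply (M := fun α : Fin (n + 2) ↪o I => (A.sections (inter U α)).cx.X m) α
    Finset.univ (fun k : Fin (n + 2) => (-1 : K) ^ (k : ℕ) •
      ((cech U A).deg m).face n k w)).trans ?_
  refine Finset.sum_congr rfl fun k _ => ?_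
  have key (M : ModuleCat.{u} K) (x : M) (e : ℕ) : (-1 : K) ^ e • x = (-1 : ℤ) ^ e • x := by
    rcases Nat.even_or_odd e with he | he <;> simp [he.neg_one_pow]
  exact key ((A.sections (inter U α)).cx.X m) _ k

/-- The three conditions for the augmentation are separatedness, gluing, and Leray's theorem,
applied to each degree of `A` as an abelian sheaf. -/
theorem isQuasiIso_toTotTW [CharZero K] (A : DGLASheaf K X) (hU : ⨆ i, U i = ⊤)
    (hA : A.AcyclicOn ⊤) (hUA : A.AcyclicCover U) : DGLA.IsQuasiIso (A.toTotTW U) := by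
  refine ThomWhitney.augmentation_isQuasiIso (cechAugmentation U A) (fun m s t h => ?_)
    (fun m v hv => ?_) (fun m q v hv => ?_)
  · exact AbSheaf.eq_of_restrict_eq hU (A.abDegree m) s t fun α => congrFun h α
  · obtain ⟨s, hs⟩ := AbSheaf.exists_glue hU (A.abDegree m) v hv
    exact ⟨s, funext hs⟩
  · obtain ⟨w, hw⟩ := AbSheaf.cechExact_of_isAcyclicOn hU q (A.abDegree m) (hA m)
      (fun n α => hUA n α m) v ((cechD_eq_cechδ A m (q + 1) v).symm.trans hv)
    exact ⟨w, (cechD_eq_cechδ A m q w).trans hw⟩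

end DGLASheaf

/-! ### Naturality -/

namespace ThomWhitney

variable {K : Type u} [Field K] {g h h' l : SemicosimplicialDGLA K}

theorem totMap_comp_congr (φ : g.Hom h) (ψ : h.Hom l) (φ' : g.Hom h') (ψ' : h'.Hom l)
    (H : ∀ n, φ.app n ≫ ψ.app n = φ'.app n ≫ ψ'.app n) :
    totMap φ ≫ totMap ψ = totMap φ' ≫ totMap ψ' := by
  refine DGLA.hom_ext (HomologicalComplex.Hom.ext (funext fun m =>
    ModuleCat.hom_ext (LinearMap.ext fun x => ?_)))
  change totXMap ψ m (totXMap φ m x) = totXMap ψ' m (totXMap φ' m x)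
  induction x using tot_induction with
  | zero => simp
  | add x y hx hy => simp only [map_add, hx, hy]
  | inc i j hij x =>
    simp only [totXMap_inc]
    congr 1
    ext n
    simp only [bicomplexMap_apply]
    rw [← LinearMap.lTensor_comp_apply, ← LinearMap.lTensor_comp_apply, ← ModuleCat.hom_comp,
      ← ModuleCat.hom_comp, ← HomologicalComplex.comp_f, ← HomologicalComplex.comp_f,
      ← DGLA.comp_f, ← DGLA.comp_f, H]

theorem augIter_comp {L M : DGLA K} (ε : g.Augmentation L) (η : h.Augmentation M) (φ : g.Hom h)
    (f : L ⟶ M) (H : ε.hom ≫ φ.app 0 = f ≫ η.hom) (n : ℕ) :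
    augIter ε n ≫ φ.app n = f ≫ augIter η n := by
  induction n with
  | zero => exact H
  | succ n ih =>
    change (augIter ε n ≫ g.face n _) ≫ _ = f ≫ augIter η n ≫ h.face n _
    rw [Category.assoc, φ.face_app, ← Category.assoc, ih, Category.assoc]

theorem augmentation_comp_totMap {L M : DGLA K} (ε : g.Augmentation L) (η : h.Augmentation M)
    (φ : g.Hom h) (f : L ⟶ M) (H : ε.hom ≫ φ.app 0 = f ≫ η.hom) :
    augmentation ε ≫ totMap φ = f ≫ augmentation η := by
  refine DGLA.hom_ext (HomologicalComplex.Hom.ext (funext fun m =>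
    ModuleCat.hom_ext (LinearMap.ext fun x => ?_)))
  change totXMap φ m (inc g m 0 m _ (augBi ε m x)) = inc h m 0 m _ (augBi η m (f.f.f m x))
  rw [totXMap_inc]
  congr 1
  ext n
  simp only [bicomplexMap_apply, augBi_apply, LinearMap.lTensor_tmul]
  congr 1
  exact congrArg (fun ψ : L ⟶ h.obj n => (ψ.f.f m).hom x) (augIter_comp ε η φ f H n)

end ThomWhitney

namespace DGLASheaf

variable {K : Type u} [Field K] {X : TopCat.{u}} {I : Type u} [LinearOrder I] (U : I → Opens X)

theorem totTWMap_comp_congr {L A L' A' : DGLASheaf K X} (φ : L.Hom A) (β : A.Hom A')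
    (α : L.Hom L') (φ' : L'.Hom A') (H : φ ≫ β = α ≫ φ') :
    totTWMap U φ ≫ totTWMap U β = totTWMap U α ≫ totTWMap U φ' :=
  ThomWhitney.totMap_comp_congr _ _ _ _ fun _ => DGLA.pi_hom_ext fun σ =>
    congrArg (fun ψ : L.presheaf ⟶ A'.presheaf => DGLA.piProj
      (fun σ => L.sections (inter U σ)) σ ≫ ψ.app (op (inter U σ))) H

theorem toTotTW_comp_totTWMap {A A' : DGLASheaf K X} (β : A.Hom A') :
    A.toTotTW U ≫ totTWMap U β = β.app (op ⊤) ≫ A'.toTotTW U :=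
  ThomWhitney.augmentation_comp_totMap _ _ _ _ (DGLA.pi_hom_ext fun σ =>
    β.naturality (homOfLE (le_top : inter U σ ≤ ⊤)).op)

end DGLASheaf

theorem mainTheorem3 {K : Type u} [Field K] [CharZero K]
    {X : TopCat.{u}} [T2Space X] [ParacompactSpace X]
    (L A : DGLASheaf K X) (hL : L.BoundedBelow) (hA : A.BoundedBelow)
    (φ : L.Hom A) (hφ : DGLASheaf.IsAcyclicResolution φ)
    {I : Type u} [LinearOrder I] (U : I → Opens X) (hU : ⨆ i, U i = ⊤)
    (hUL : L.AcyclicCover U) (hUA : A.AcyclicCover U) :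
    DGLA.QuasiIsomorphic (L.totTW U) (A.sections ⊤) ∧
    DGLA.IsQuasiIso (DGLASheaf.totTWMap U φ) ∧
    DGLA.IsQuasiIso (A.toTotTW U) ∧
    ∀ (L' A' : DGLASheaf K X) (φ' : L'.Hom A') (α : L.Hom L') (β : A.Hom A'),
      φ ≫ β = α ≫ φ' →
      DGLASheaf.totTWMap U φ ≫ DGLASheaf.totTWMap U β =
          DGLASheaf.totTWMap U α ≫ DGLASheaf.totTWMap U φ' ∧
        A.toTotTW U ≫ DGLASheaf.totTWMap U β = β.app (op ⊤) ≫ A'.toTotTW U := by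
  have h₁ := DGLASheaf.isQuasiIso_totTWMap hL hA φ hφ.isQuasiIso U hUL hUA
  have h₂ := A.isQuasiIso_toTotTW hU hφ.acyclic hUA
  exact ⟨.trans _ _ _ (.rel _ _ ⟨_, h₁⟩) (.symm _ _ (.rel _ _ ⟨_, h₂⟩)), h₁, h₂,
    fun L' A' φ' α β H => ⟨DGLASheaf.totTWMap_comp_congr U φ β α φ' H,
      DGLASheaf.toTotTW_comp_totTWMap U β⟩⟩

end
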